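/- **Setting.** A *nearly Kaehler manifold* is a smooth Riemannian manifold $(\tilde M, g)$ with a smooth almost complex structure $J$ such that $g(JX,JY)=g(X,Y)$ and $(\tilde\nabla_XJ)Y+(\tilde\nabla_YJ)X=0$ for all vector fields $X,Y$, where $\tilde\nabla$ is the Levi-Civita connection. For a smooth isometric immersion $\psi:N\to\tilde M$ the second fundamental form is $h(X,Y)=(\tilde\nabla_XY)^\perp$, and $\|h\|^2=\sum_{i,j}g(h(e_i,e_j),h(e_i,e_j))$ for an orthonormal frame $(e_i)$ of $TN$. The submanifold $N$ is *totally geodesic* if $h=0$, *totally umbilical* if $h(X,Y)=g(X,Y)H$ for a normal vector field $H$, *holomorphic* if $J(T_pN)=T_pN$ for all $p$, *totally real* if $J(T_pN)\subseteq T_p^\perp N$ for all $p$, and *proper slant* with slant angle $\theta\in(0,\frac{\pi}{2})$ if the angle between $JX$ and $T_pN$ equals $\theta$ for all $p\in N$ and all $0\neq X\in T_pN$. **Theorem.** Let $(M_T,g_T)$, $(M_\perp,g_\perp)$, $(M_\theta,g_\theta)$ be non-empty Riemannian manifolds, $M_T$ connected, let $f_1,f_2:M_T\to(0,\infty)$ be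 smooth, and let $M=M_T\times_{f_1}M_\perp\times_{f_2}M_\theta$ be the bi-warped product, i.e. $M_T\times M_\perp\times M_\theta$ with the metric $g_T+f_1^2g_\perp+f_2^2g_\theta$. Let $M$ be isometrically immersed in a nearly Kaehler manifold $\tilde M$ such that all the leaves $M_T\times\{(y,z)\}$ are holomorphic, all the leaves $\{x\}\times M_\perp\times\{z\}$ are totally real and all the leaves $\{(x,y)\}\times M_\theta$ are proper slant with one and the same slant angle $\theta$ in $\tilde M$. Denote by $\mathfrak D,\mathfrak D^\perp,\mathfrak D^\theta\subset TM$ the distributions tangent to these three families of leaves, by $h$ the second fundamental form of $M$ in $\tilde M$, and put $p=\dim M_\perp$, $q=\frac12\dim M_\theta$. Then: (i) At every point of $M$, $$\|h\|^2\ \ge\ 2p\,\|\nabla(\ln f_1)\|^2+4q\left(1+\tfrac{10}{9}\cot^2\theta\right)\|\nabla(\ln f_2)\|^2 .$$ (ii) If equality holds in (i) at every point of $M$, then every leaf of $M_T$ is totally geodesic in $\tilde M$, and every leaf of $M_\perp$ and every leaf of $M_\theta$ is totally umbilical in $\tilde M$. Moreover, in this case: if $p>0$ and $f_1$ is not constant,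 then $M$ is not $\mathfrak D\oplus\mathfrak D^\perp$-mixed totally geodesic, i.e. $h(X,Z)\neq0$ for some $X\in\mathfrak D_m$, $Z\in\mathfrak D^\perp_m$, $m\in M$; and if $q>0$ and $f_2$ is not constant, then $M$ is not $\mathfrak D\oplus\mathfrak D^\theta$-mixed totally geodesic, i.e. $h(X,Z)\neq0$ for some $X\in\mathfrak D_m$, $Z\in\mathfrak D^\theta_m$, $m\in M$. -/

import Mathlib

open scoped Manifold ContDiff Bundle
open Bundle FiberBundle Module

noncomputable section

namespace BiWarped

/-! ### Levi-Civita connection, along maps and on a Riemannian manifold -/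

section Ambient

variable {E : Type*} [NormedAddCommGroup E] [NormedSpace ℝ E] [FiniteDimensional ℝ E]
  {H : Type*} [TopologicalSpace H] {I : ModelWithCorners ℝ E H}
  {M : Type*} [TopologicalSpace M] [ChartedSpace H M]

instance finiteDimensional_tangentSpace (x : M) : FiniteDimensional ℝ (TangentSpace I x) :=
  inferInstanceAs (FiniteDimensional ℝ E)

variable [IsManifold I ∞ M] [RiemannianBundle (fun x : M => TangentSpace I x)]

variable (I) in
/-- Christoffel symbols of the first kind at `y`, from the Koszul formula. For `v` in `T_y M`,
`extend E v` is the vector field near `y` with constant coefficients in the chart at `y` and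
value `v` at `y`; two such fields commute, so
`2 g(∇_u V, w) = u g(V, W) + v g(U, W) - w g(U, V)`. -/
def christoffelFirst (y : M) (u v w : TangentSpace I y) : ℝ :=
  (1 / 2 : ℝ) *
    (mvfderiv I (fun q : M => inner ℝ (extend E v q) (extend E w q)) y u
      + mvfderiv I (fun q : M => inner ℝ (extend E u q) (extend E w q)) y v
      - mvfderiv I (fun q : M => inner ℝ (extend E u q) (extend E v q)) y w)

variable (I) in
/-- Christoffel symbols of the second kind at `y` (in the chart at `y`): the vector `Γ(u, v)` with
`g(Γ(u, v), w) = christoffelFirst y u v w`. -/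
def christoffel (y : M) (u v : TangentSpace I y) : TangentSpace I y :=
  ∑ i, christoffelFirst I y u v (stdOrthonormalBasis ℝ (TangentSpace I y) i) •
    stdOrthonormalBasis ℝ (TangentSpace I y) i

variable {E' : Type*} [NormedAddCommGroup E'] [NormedSpace ℝ E']
  {H' : Type*} [TopologicalSpace H'] {I' : ModelWithCorners ℝ E' H'}
  {N : Type*} [TopologicalSpace N] [ChartedSpace H' N]

variable (I I') in
/-- The covariant derivative `∇_u V` at `p`, for the Levi-Civita connection of `M`, of a vector
field `V` along a map `φ : N → M`. In the chart of `M` at `φ p` it is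
`∂_u V^k + Γ^k_{ij} (dφ u)^i V^j`. -/
def covDerivAlong (φ : N → M) (V : ∀ q : N, TangentSpace I (φ q)) (p : N)
    (u : TangentSpace I' p) : TangentSpace I (φ p) :=
  (trivializationAt E (TangentSpace I : M → Type _) (φ p)).symm (φ p)
      (mvfderiv I' (fun q : N =>
        (trivializationAt E (TangentSpace I : M → Type _) (φ p) ⟨φ q, V q⟩).2) p u)
    + christoffel I (φ p) (mfderiv I' I φ p u) (V p)

variable (I) in
/-- The covariant derivative `∇_u Y` at `y` of a vector field `Y` on `M`, for the Levi-Civita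
connection of `M`. -/
def covDeriv (Y : ∀ q : M, TangentSpace I q) (y : M) (u : TangentSpace I y) : TangentSpace I y :=
  covDerivAlong I I (id : M → M) Y y u

/-- `(∇_X J) Y = ∇_X (J Y) - J (∇_X Y)` at `y`. -/
def covDerivEndo (J : ∀ q : M, TangentSpace I q →L[ℝ] TangentSpace I q)
    (X Y : ∀ q : M, TangentSpace I q) (y : M) : TangentSpace I y :=
  covDeriv I (fun q => J q (Y q)) y (X y) - J y (covDeriv I Y y (X y))

variable (I M) in
/-- A nearly Kaehler structure on a Riemannian manifold `M`: a smooth almost complex structure `J`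
which is compatible with the metric and satisfies `(∇_X J) Y + (∇_Y J) X = 0`. -/
structure NearlyKaehlerStructure where
  J : ∀ q : M, TangentSpace I q →L[ℝ] TangentSpace I q
  contMDiff_J : ContMDiff I (I.prod 𝓘(ℝ, E →L[ℝ] E)) ∞
    (fun q => TotalSpace.mk' (E →L[ℝ] E)
      (E := fun q : M => TangentSpace I q →L[ℝ] TangentSpace I q) q (J q))
  J_sq : ∀ (q : M) (v : TangentSpace I q), J q (J q v) = -v
  inner_J : ∀ (q : M) (v w : TangentSpace I q), inner ℝ (J q v) (J q w) = inner ℝ v w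
  nearly : ∀ (X Y : ∀ q : M, TangentSpace I q) (y : M),
    ContMDiffAt I I.tangent ∞ (fun q => (⟨q, X q⟩ : TangentBundle I M)) y →
    ContMDiffAt I I.tangent ∞ (fun q => (⟨q, Y q⟩ : TangentBundle I M)) y →
    covDerivEndo J X Y y + covDerivEndo J Y X y = 0

variable (I) in
/-- The gradient of a function at a point: the vector dual to its differential. -/
def riemannianGradient (f : M → ℝ) (x : M) : TangentSpace I x :=
  ∑ i, mvfderiv I f x (stdOrthonormalBasis ℝ (TangentSpace I x) i) •
    stdOrthonormalBasis ℝ (TangentSpace I x) i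

/-! ### Submanifolds -/

variable [FiniteDimensional ℝ E'] [IsManifold I' ∞ N]

variable (I I') in
/-- The tangent space of the immersed submanifold `φ : N → M`, as a subspace of `T_{φ p} M`. -/
def tangentImage (φ : N → M) (p : N) : Submodule ℝ (TangentSpace I (φ p)) :=
  LinearMap.range (mfderiv I' I φ p).toLinearMap

variable (I I') in
/-- The second fundamental form `h(u, v) = (∇_u dφ(V))^⊥`, where `V` is a vector field on `N` near
`p` with value `v` at `p` (the choice of `V` does not matter). -/
def secondFundamentalForm (φ : N → M) (p : N) (u v : TangentSpace I' p) :
    TangentSpace I (φ p) :=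
  (tangentImage I I' φ p)ᗮ.starProjection
    (covDerivAlong I I' φ (fun q => mfderiv I' I φ q (extend E' v q)) p u)

variable (I I') in
/-- `‖h‖² = ∑ g(h(e_i, e_j), h(e_i, e_j))` over an orthonormal basis of `T_p N`. -/
def normSqSecondFundamentalForm [RiemannianBundle (fun x : N => TangentSpace I' x)]
    (φ : N → M) (p : N) : ℝ :=
  ∑ i, ∑ j, ‖secondFundamentalForm I I' φ p (stdOrthonormalBasis ℝ (TangentSpace I' p) i)
    (stdOrthonormalBasis ℝ (TangentSpace I' p) j)‖ ^ 2

variable (I I') in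
/-- `φ` is a smooth isometric immersion. -/
def IsIsometricImmersion [RiemannianBundle (fun x : N => TangentSpace I' x)] (φ : N → M) : Prop :=
  ContMDiff I' I ∞ φ ∧ ∀ (p : N) (u v : TangentSpace I' p),
    inner ℝ (mfderiv I' I φ p u) (mfderiv I' I φ p v) = inner ℝ u v

variable (I I') in
def IsTotallyGeodesic (φ : N → M) : Prop :=
  ∀ (p : N) (u v : TangentSpace I' p), secondFundamentalForm I I' φ p u v = 0

variable (I I') in
/-- `h(u, v) = g(u, v) H` for a normal vector `H` (the mean curvature vector), `g` being the
induced metric. -/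
def IsTotallyUmbilical (φ : N → M) : Prop :=
  ∀ p : N, ∃ η ∈ (tangentImage I I' φ p)ᗮ, ∀ u v : TangentSpace I' p,
    secondFundamentalForm I I' φ p u v
      = (inner ℝ (mfderiv I' I φ p u) (mfderiv I' I φ p v) : ℝ) • η

variable (I I') in
/-- `J (T_p N) = T_p N`. -/
def IsHolomorphic (J : ∀ q : M, TangentSpace I q →L[ℝ] TangentSpace I q) (φ : N → M) : Prop :=
  ∀ p : N, (tangentImage I I' φ p).map (J (φ p)).toLinearMap = tangentImage I I' φ p

variable (I I') in
/-- `J (T_p N) ⊆ T_p^⊥ N`. -/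
def IsTotallyReal (J : ∀ q : M, TangentSpace I q →L[ℝ] TangentSpace I q) (φ : N → M) : Prop :=
  ∀ p : N, (tangentImage I I' φ p).map (J (φ p)).toLinearMap ≤ (tangentImage I I' φ p)ᗮ

variable (I I') in
/-- The Wirtinger angle, i.e. the angle between `J v` and the subspace `T_p N` (the angle between
`J v` and its orthogonal projection, which is `π / 2` if the projection vanishes), equals `θ` for
all `p` and all nonzero tangent vectors `v` at `p`. -/
def IsSlant (J : ∀ q : M, TangentSpace I q →L[ℝ] TangentSpace I q) (φ : N → M) (θ : ℝ) : Prop :=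
  ∀ p : N, ∀ v ∈ tangentImage I I' φ p, v ≠ 0 →
    InnerProductGeometry.angle (J (φ p) v)
      ((tangentImage I I' φ p).starProjection (J (φ p) v)) = θ

variable (I I') in
/-- Slant, and neither holomorphic (`θ = 0`) nor totally real (`θ = π / 2`). -/
def IsProperSlant (J : ∀ q : M, TangentSpace I q →L[ℝ] TangentSpace I q) (φ : N → M)
    (θ : ℝ) : Prop :=
  0 < θ ∧ θ < Real.pi / 2 ∧ IsSlant I I' J φ θ

variable (I I') in
/-- `h(u, v) = 0` for all `u` in the distribution `D₁` and `v` in the distribution `D₂`. -/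
def IsMixedTotallyGeodesic (φ : N → M) (D₁ D₂ : ∀ p : N, Submodule ℝ (TangentSpace I' p)) :
    Prop :=
  ∀ p : N, ∀ u ∈ D₁ p, ∀ v ∈ D₂ p, secondFundamentalForm I I' φ p u v = 0

end Ambient

/-! ### Bi-warped products -/

section Product

variable {E₀ : Type*} [NormedAddCommGroup E₀] [NormedSpace ℝ E₀]
  {E₁ : Type*} [NormedAddCommGroup E₁] [NormedSpace ℝ E₁]
  {E₂ : Type*} [NormedAddCommGroup E₂] [NormedSpace ℝ E₂]
  {M₀ : Type*} [TopologicalSpace M₀] [ChartedSpace E₀ M₀]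
  {M₁ : Type*} [TopologicalSpace M₁] [ChartedSpace E₁ M₁]
  {M₂ : Type*} [TopologicalSpace M₂] [ChartedSpace E₂ M₂]

variable (E₀ E₁ E₂) in
/-- The model of the product manifold `M₀ × M₁ × M₂`. -/
abbrev prodModel : ModelWithCorners ℝ (E₀ × E₁ × E₂) (ModelProd E₀ (ModelProd E₁ E₂)) :=
  𝓘(ℝ, E₀).prod (𝓘(ℝ, E₁).prod 𝓘(ℝ, E₂))

variable (E₀ E₁ E₂) in
/-- The tangent spaces of the leaves `M₀ × {(y, z)}`. -/
def dist₀ (p : M₀ × M₁ × M₂) : Submodule ℝ (TangentSpace (prodModel E₀ E₁ E₂) p) :=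
  LinearMap.range (mfderiv 𝓘(ℝ, E₀) (prodModel E₀ E₁ E₂)
    (fun x : M₀ => (x, p.2.1, p.2.2)) p.1).toLinearMap

variable (E₀ E₁ E₂) in
/-- The tangent spaces of the leaves `{x} × M₁ × {z}`. -/
def dist₁ (p : M₀ × M₁ × M₂) : Submodule ℝ (TangentSpace (prodModel E₀ E₁ E₂) p) :=
  LinearMap.range (mfderiv 𝓘(ℝ, E₁) (prodModel E₀ E₁ E₂)
    (fun y : M₁ => (p.1, y, p.2.2)) p.2.1).toLinearMap

variable (E₀ E₁ E₂) in
/-- The tangent spaces of the leaves `{(x, y)} × M₂`. -/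
def dist₂ (p : M₀ × M₁ × M₂) : Submodule ℝ (TangentSpace (prodModel E₀ E₁ E₂) p) :=
  LinearMap.range (mfderiv 𝓘(ℝ, E₂) (prodModel E₀ E₁ E₂)
    (fun z : M₂ => (p.1, p.2.1, z)) p.2.2).toLinearMap

variable [RiemannianBundle (fun x : M₀ => TangentSpace 𝓘(ℝ, E₀) x)]
  [RiemannianBundle (fun x : M₁ => TangentSpace 𝓘(ℝ, E₁) x)]
  [RiemannianBundle (fun x : M₂ => TangentSpace 𝓘(ℝ, E₂) x)]
  [RiemannianBundle (fun p : M₀ × M₁ × M₂ => TangentSpace (prodModel E₀ E₁ E₂) p)]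

variable (E₀ E₁ E₂ M₁ M₂) in
/-- The Riemannian metric of `M₀ × M₁ × M₂` is the bi-warped product metric
`π₀^* g₀ + (f₁ ∘ π₀)² π₁^* g₁ + (f₂ ∘ π₀)² π₂^* g₂`. -/
def IsBiWarpedProductMetric (f₁ f₂ : M₀ → ℝ) : Prop :=
  ∀ (p : M₀ × M₁ × M₂) (u v : TangentSpace (prodModel E₀ E₁ E₂) p),
    (inner ℝ u v : ℝ)
      = inner ℝ (mfderiv (prodModel E₀ E₁ E₂) 𝓘(ℝ, E₀) (fun q : M₀ × M₁ × M₂ => q.1) p u)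
          (mfderiv (prodModel E₀ E₁ E₂) 𝓘(ℝ, E₀) (fun q : M₀ × M₁ × M₂ => q.1) p v)
        + f₁ p.1 ^ 2 *
          inner ℝ (mfderiv (prodModel E₀ E₁ E₂) 𝓘(ℝ, E₁) (fun q : M₀ × M₁ × M₂ => q.2.1) p u)
            (mfderiv (prodModel E₀ E₁ E₂) 𝓘(ℝ, E₁) (fun q : M₀ × M₁ × M₂ => q.2.1) p v)
        + f₂ p.1 ^ 2 *
          inner ℝ (mfderiv (prodModel E₀ E₁ E₂) 𝓘(ℝ, E₂) (fun q : M₀ × M₁ × M₂ => q.2.2) p u)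
            (mfderiv (prodModel E₀ E₁ E₂) 𝓘(ℝ, E₂) (fun q : M₀ × M₁ × M₂ => q.2.2) p v)

end Product

end BiWarped

end

open scoped Topology

set_option linter.unusedSectionVars false

noncomputable section

namespace BiWarped

/-! ### Calculus of vector-valued functions on manifolds. -/

section Calculus

variable {E : Type*} [NormedAddCommGroup E] [NormedSpace ℝ E]
  {H : Type*} [TopologicalSpace H] {I : ModelWithCorners ℝ E H}
  {M : Type*} [TopologicalSpace M] [ChartedSpace H M]
  {F : Type*} [NormedAddCommGroup F] [NormedSpace ℝ F]

/-! Write ω(u, v) = g(J dφ u, dφ v) for the Kaehler form pulled back to the product and `hess` for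
∇_u dφ(V), whose normal part is h. Two facts about the connection drive everything.

First, Koszul's formula for the bi-warped metric gives the tangential part of `hess`: (X ln f₁)Z on
D × D^⊥, (X ln f₂)U on D × D^θ, and in the direction of D it gives -g(Z,W)∇ ln f₁ on D^⊥ × D^⊥ and
-g(U,V)∇ ln f₂ on D^θ × D^θ.

Second, g((∇_a J)b, c) is totally skew: the nearly Kaehler condition makes it skew in a and b,
compatibility of J with the metric makes it skew in b and c. If X is tangent to D, so that JX is
again tangent to D, then ω(X, ·) vanishes on D^⊥ and D^θ near the point. Differentiating ω(X,U),
ω(X,V) and ω(U,V) gives three linear equations in which ∇J enters through one number only;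
eliminating it yields `inner_hess_J`, ⟨hess(X,U), JV⟩ = -(1/3) X(ω(U,V)) + ⟨hess(U,V), JX⟩.

On D^⊥ the form ω vanishes, so ⟨h(X,Z), JW⟩ = -(JX ln f₁) g(Z,W). Cauchy–Schwarz against JZ and
summation over an orthonormal basis of D, which J permutes into another one, give p‖∇ ln f₁‖². The
block occurs twice in ‖h‖².

On D^θ the result is ⟨h(X,U), JV⟩ = -(1/3) X(ω(U,V)) + a ω(U,V) - b g(U,V) with a = X ln f₂ and b =
JX ln f₂. The derivative of ω is not determined entry by entry, but its component along ω is: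
slantness gives ∑ ω(b_k,b_l)² = 2q cos²θ f₂⁴ for a fixed orthonormal basis of the leaf metric, and
differentiating along X gives ∑ ω X(ω) = 2a ∑ ω². Hence -(1/3) X(ω) + aω is (a/3)ω plus a matrix
orthogonal to ω, with zero diagonal, while b g is diagonal; the sum of squares is at least that of
(a/3)ω plus that of b g (`le_sum_sq`). The part of JV normal to the slant leaf has length sin θ ‖V‖,
so a Bessel inequality (`sum_inner_sq_le`) turns this into a bound for ‖h(X,·)‖² with a division by
sin²θ. Summing over X, both a² and b² add up to ‖∇ ln f₂‖², and (1 + cos²θ/9)/sin²θ = 1 +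
(10/9)cot²θ.

In the case of equality the blocks of h on D × D, D^⊥ × D^⊥ and D^θ × D^θ, which the estimate
discards, must vanish. Then `hess` on a leaf is tangent to the product and the Koszul formulas show
the leaf to be totally geodesic or umbilical. The displayed values of ⟨h(X,Z), JZ⟩ show that a mixed
block can vanish identically only if the warping function has zero logarithmic derivative. -/

theorem mvfderiv_congr {f g : M → F} {x : M} (h : f =ᶠ[𝓝 x] g) :
    mvfderiv I f x = mvfderiv I g x := by
  ext v
  have := h.mfderiv_eq (I := I) (I' := 𝓘(ℝ, F))
  exact congrArg (fun L : E →L[ℝ] F => L v) this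

theorem mvfderiv_eq_of_hasMFDerivAt {f : M → F} {x : M} {f' : TangentSpace I x →L[ℝ] F}
    (h : HasMFDerivAt I 𝓘(ℝ, F) f x f') : mvfderiv I f x = f' := by
  ext v
  exact congrArg (fun L : E →L[ℝ] F => L v) h.mfderiv

theorem mvfderiv_fun_sum {ι : Type} (s : Finset ι) {f : ι → M → F} {x : M}
    (h : ∀ i ∈ s, MDifferentiableAt I 𝓘(ℝ, F) (f i) x) :
    mvfderiv I (fun q => ∑ i ∈ s, f i q) x = ∑ i ∈ s, mvfderiv I (f i) x := by
  have := HasMFDerivAt.sum (t := s) (fun i hi => (h i hi).hasMFDerivAt)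
  have h2 := mvfderiv_eq_of_hasMFDerivAt (f := ∑ i ∈ s, f i) this
  have h3 : (fun q => ∑ i ∈ s, f i q) = ∑ i ∈ s, f i := by ext; simp
  rw [h3, h2]
  rfl

theorem MDifferentiableAt.fun_sum {ι : Type} (s : Finset ι) {f : ι → M → F} {x : M}
    (h : ∀ i ∈ s, MDifferentiableAt I 𝓘(ℝ, F) (f i) x) :
    MDifferentiableAt I 𝓘(ℝ, F) (fun q => ∑ i ∈ s, f i q) x := by
  have h3 : (fun q => ∑ i ∈ s, f i q) = ∑ i ∈ s, f i := by ext; simp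
  rw [h3]; exact MDifferentiableAt.sum h

variable {E' : Type*} [NormedAddCommGroup E'] [NormedSpace ℝ E']
  {H' : Type*} [TopologicalSpace H'] {I' : ModelWithCorners ℝ E' H'}
  {N : Type*} [TopologicalSpace N] [ChartedSpace H' N]

theorem mvfderiv_comp_of_mdifferentiableAt {f : N → M} {g : M → F} {x : N} {y : M}
    (hy : f x = y) (hg : MDifferentiableAt I 𝓘(ℝ, F) g y) (hf : MDifferentiableAt I' I f x)
    (v : TangentSpace I' x) :
    mvfderiv I' (fun q => g (f q)) x v = mvfderiv I g (f x) (mfderiv I' I f x v) := by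
  subst hy
  exact mfderiv_comp_apply x hg hf v

theorem mvfderiv_clm_comp {G : Type*} [NormedAddCommGroup G] [NormedSpace ℝ G]
    (L : F →L[ℝ] G) {f : M → F} {x : M}
    (hf : MDifferentiableAt I 𝓘(ℝ, F) f x) (v : TangentSpace I x) :
    mvfderiv I (fun q => L (f q)) x v = L (mvfderiv I f x v) := by
  have := mfderiv_comp_apply x (L.differentiableAt.mdifferentiableAt) hf v
  rw [mfderiv_eq_fderiv, L.fderiv] at this
  exact this

end Calculus

/-! ### Components of tangent vectors and fields that are constant in a chart. -/

section Ambient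

variable {E : Type*} [NormedAddCommGroup E] [NormedSpace ℝ E]
  {H : Type*} [TopologicalSpace H] {I : ModelWithCorners ℝ E H}
  {M : Type*} [TopologicalSpace M] [ChartedSpace H M] [IsManifold I ∞ M]

variable (I) in
/-- The components of a tangent vector at `y'` in the trivialization at `y`. -/
def triv (y y' : M) : TangentSpace I y' →L[ℝ] E :=
  (trivializationAt E (TangentSpace I : M → Type _) y).continuousLinearMapAt ℝ y'

variable (I) in
/-- The tangent vector at `y'` with given components in the trivialization at `y`. -/
def constVec (y y' : M) : E →L[ℝ] TangentSpace I y' :=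
  (trivializationAt E (TangentSpace I : M → Type _) y).symmL ℝ y'

theorem coe_triv {y y' : M} (h : y' ∈ (chartAt H y).source) (v : TangentSpace I y') :
    (trivializationAt E (TangentSpace I : M → Type _) y ⟨y', v⟩).2 = triv I y y' v := by
  rw [triv, Trivialization.continuousLinearMapAt_apply, Trivialization.coe_linearMapAt_of_mem]
  exact h

theorem triv_constVec {y y' : M} (v : E) (h : y' ∈ (chartAt H y).source) :
    triv I y y' (constVec I y y' v) = v :=
  Trivialization.continuousLinearMapAt_symmL _ h _

theorem constVec_triv {y y' : M} (v : TangentSpace I y') (h : y' ∈ (chartAt H y).source) :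
    constVec I y y' (triv I y y' v) = v :=
  Trivialization.symmL_continuousLinearMapAt _ h _

theorem symm_eq_constVec {y y' : M} (v : E) (h : y' ∈ (chartAt H y).source) :
    (trivializationAt E (TangentSpace I : M → Type _) y).symm y' v = constVec I y y' v :=
  (Trivialization.symmL_apply _ h _).symm

theorem extend_eq {y y' : M} (v : TangentSpace I y) (h : y' ∈ (chartAt H y).source) :
    extend E v y' = constVec I y y' (triv I y y v) := by
  have h1 : extend E v y' = (trivializationAt E (TangentSpace I : M → Type _) y).symm y'
      (trivializationAt E (TangentSpace I : M → Type _) y ⟨y, v⟩).2 := rfl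
  rw [h1, symm_eq_constVec _ h, coe_triv (by simp)]

theorem extend_constVec {y y' : M} (v : E) (h : y' ∈ (chartAt H y).source) :
    extend E (constVec I y y v) y' = constVec I y y' v := by
  rw [extend_eq _ h, triv_constVec v (by simp)]

variable (H) in
theorem chart_source_mem_nhds {N : Type*} [TopologicalSpace N] {φ : N → M} {p : N}
    (h : ContinuousAt φ p) : ∀ᶠ q in 𝓝 p, φ q ∈ (chartAt H (φ p)).source :=
  h.preimage_mem_nhds ((chartAt H (φ p)).open_source.mem_nhds (by simp))

variable (H) in
theorem chart_source_mem_nhds_self (y : M) : ∀ᶠ q in 𝓝 y, q ∈ (chartAt H y).source :=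
  (chartAt H y).open_source.mem_nhds (by simp)

end Ambient

/-! ### Christoffel symbols: bilinearity, symmetry, compatibility with the metric. -/

section Metric

variable {E : Type*} [NormedAddCommGroup E] [NormedSpace ℝ E] [FiniteDimensional ℝ E]
  {H : Type*} [TopologicalSpace H] {I : ModelWithCorners ℝ E H}
  {M : Type*} [TopologicalSpace M] [ChartedSpace H M] [IsManifold I ∞ M]
  [RiemannianBundle (fun x : M => TangentSpace I x)]

variable (I) in
/-- The components of the metric in the trivialization at `y`. -/
def metricCoeff (y : M) (a b : E) (q : M) : ℝ := inner ℝ (constVec I y q a) (constVec I y q b)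

variable (I) in
/-- The derivative at `y` of the components of the metric in the trivialization at `y`. -/
def metricDeriv (y : M) (u : TangentSpace I y) (a b : E) : ℝ :=
  mvfderiv I (metricCoeff I y a b) y u

theorem metricDeriv_comm (y : M) (u : TangentSpace I y) (a b : E) :
    metricDeriv I y u a b = metricDeriv I y u b a := by
  unfold metricDeriv
  congr 2
  ext q
  exact real_inner_comm _ _

theorem mvfderiv_inner_extend (y : M) (u v w : TangentSpace I y) :
    mvfderiv I (fun q : M => inner ℝ (extend E v q) (extend E w q)) y u
      = metricDeriv I y u (triv I y y v) (triv I y y w) := by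
  unfold metricDeriv
  rw [mvfderiv_congr]
  filter_upwards [chart_source_mem_nhds_self H y] with q hq
  rw [extend_eq v hq, extend_eq w hq]
  rfl

theorem christoffelFirst_eq (y : M) (u v w : TangentSpace I y) :
    christoffelFirst I y u v w = (1 / 2 : ℝ) *
      (metricDeriv I y u (triv I y y v) (triv I y y w)
        + metricDeriv I y v (triv I y y u) (triv I y y w)
        - metricDeriv I y w (triv I y y u) (triv I y y v)) := by
  unfold christoffelFirst
  rw [mvfderiv_inner_extend, mvfderiv_inner_extend, mvfderiv_inner_extend]

theorem christoffelFirst_comm (y : M) (u v w : TangentSpace I y) :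
    christoffelFirst I y u v w = christoffelFirst I y v u w := by
  rw [christoffelFirst_eq, christoffelFirst_eq, metricDeriv_comm y w]
  ring

theorem christoffel_comm (y : M) (u v : TangentSpace I y) :
    christoffel I y u v = christoffel I y v u := by
  unfold christoffel
  simp_rw [christoffelFirst_comm y u v]

variable [IsContMDiffRiemannianBundle I ∞ E (fun x : M => TangentSpace I x)]

theorem mdifferentiableAt_inner {E' : Type*} [NormedAddCommGroup E'] [NormedSpace ℝ E']
    {H' : Type*} [TopologicalSpace H'] {I' : ModelWithCorners ℝ E' H'}
    {N : Type*} [TopologicalSpace N] [ChartedSpace H' N] {φ : N → M}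
    {V W : ∀ q : N, TangentSpace I (φ q)} {p : N}
    (hV : MDifferentiableAt I' I.tangent (fun q => (⟨φ q, V q⟩ : TangentBundle I M)) p)
    (hW : MDifferentiableAt I' I.tangent (fun q => (⟨φ q, W q⟩ : TangentBundle I M)) p) :
    MDifferentiableAt I' 𝓘(ℝ, ℝ) (fun q => inner ℝ (V q) (W q)) p :=
  MDifferentiableAt.inner_bundle (IB := I) (F := E) (E := fun x : M => TangentSpace I x) hV hW

theorem mdifferentiableAt_metricCoeff (y : M) (a b : E) :
    MDifferentiableAt I 𝓘(ℝ, ℝ) (metricCoeff I y a b) y := by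
  have h := mdifferentiableAt_inner (I := I) (φ := fun q : M => q)
    (mdifferentiableAt_extend I E (V := fun x : M => TangentSpace I x) (constVec I y y a))
    (mdifferentiableAt_extend I E (V := fun x : M => TangentSpace I x) (constVec I y y b))
  refine h.congr_of_eventuallyEq ?_
  filter_upwards [chart_source_mem_nhds_self H y] with q hq
  rw [extend_constVec _ hq, extend_constVec _ hq]
  rfl

theorem metricDeriv_add_left (y : M) (u : TangentSpace I y) (a a' b : E) :
    metricDeriv I y u (a + a') b = metricDeriv I y u a b + metricDeriv I y u a' b := by
  have h : metricCoeff I y (a + a') b = fun q => metricCoeff I y a b q + metricCoeff I y a' b q := by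
    ext q
    simp only [metricCoeff, map_add, inner_add_left]
  unfold metricDeriv
  rw [h, mvfderiv_fun_add (mdifferentiableAt_metricCoeff y a b)
    (mdifferentiableAt_metricCoeff y a' b)]
  rfl

theorem metricDeriv_smul_left (y : M) (u : TangentSpace I y) (c : ℝ) (a b : E) :
    metricDeriv I y u (c • a) b = c * metricDeriv I y u a b := by
  have h : metricCoeff I y (c • a) b = fun q => (c • ContinuousLinearMap.id ℝ ℝ)
      (metricCoeff I y a b q) := by
    ext q
    simp [metricCoeff, inner_smul_left]
  unfold metricDeriv
  rw [h, mvfderiv_clm_comp _ (mdifferentiableAt_metricCoeff y a b)]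
  rfl

variable (I) in
/-- `metricDeriv` as a bilinear form. -/
def metricDerivForm (y : M) (u : TangentSpace I y) : E →ₗ[ℝ] E →ₗ[ℝ] ℝ :=
  LinearMap.mk₂ ℝ (metricDeriv I y u) (metricDeriv_add_left y u) (metricDeriv_smul_left y u)
    (fun a b b' => by
      rw [metricDeriv_comm, metricDeriv_add_left, metricDeriv_comm y u b,
        metricDeriv_comm y u b'])
    (fun c a b => by
      rw [metricDeriv_comm, metricDeriv_smul_left, metricDeriv_comm y u b]; rfl)

variable (I) in
theorem christoffelFirst_add_third (y : M) (u v w w' : TangentSpace I y) :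
    christoffelFirst I y u v (w + w') = christoffelFirst I y u v w + christoffelFirst I y u v w' := by
  have h := (mvfderiv I (metricCoeff I y (triv I y y u) (triv I y y v)) y).map_add w w'
  simp only [christoffelFirst_eq, map_add, metricDeriv_comm y _ _ (_ + _), metricDeriv_add_left]
  rw [metricDeriv_comm y u (triv I y y v), metricDeriv_comm y u (triv I y y v),
    metricDeriv_comm y v (triv I y y u), metricDeriv_comm y v (triv I y y u)]
  unfold metricDeriv at *
  rw [h]
  ring

variable (I) in
theorem christoffelFirst_smul_third (y : M) (c : ℝ) (u v w : TangentSpace I y) :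
    christoffelFirst I y u v (c • w) = c * christoffelFirst I y u v w := by
  have h := (mvfderiv I (metricCoeff I y (triv I y y u) (triv I y y v)) y).map_smul c w
  simp only [christoffelFirst_eq, map_smul, metricDeriv_comm y _ _ (_ • _), metricDeriv_smul_left]
  rw [metricDeriv_comm y u (triv I y y v), metricDeriv_comm y v (triv I y y u)]
  unfold metricDeriv at *
  rw [h, smul_eq_mul]
  ring

variable (I) in
theorem christoffelFirst_add_second (y : M) (u v v' w : TangentSpace I y) :
    christoffelFirst I y u (v + v') w = christoffelFirst I y u v w + christoffelFirst I y u v' w := by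
  have h := (mvfderiv I (metricCoeff I y (triv I y y u) (triv I y y w)) y).map_add v v'
  simp only [christoffelFirst_eq, map_add, metricDeriv_comm y w (triv I y y u),
    metricDeriv_add_left]
  unfold metricDeriv at *
  rw [h]
  ring

variable (I) in
theorem christoffelFirst_smul_second (y : M) (c : ℝ) (u v w : TangentSpace I y) :
    christoffelFirst I y u (c • v) w = c * christoffelFirst I y u v w := by
  have h := (mvfderiv I (metricCoeff I y (triv I y y u) (triv I y y w)) y).map_smul c v
  simp only [christoffelFirst_eq, map_smul, metricDeriv_comm y w (triv I y y u),
    metricDeriv_smul_left]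
  unfold metricDeriv at *
  rw [h, smul_eq_mul]
  ring

theorem inner_christoffel (y : M) (u v w : TangentSpace I y) :
    inner ℝ (christoffel I y u v) w = christoffelFirst I y u v w := by
  set e := stdOrthonormalBasis ℝ (TangentSpace I y) with he
  let ℓ : TangentSpace I y →ₗ[ℝ] ℝ :=
    { toFun := christoffelFirst I y u v
      map_add' := christoffelFirst_add_third I y u v
      map_smul' := fun c => christoffelFirst_smul_third I y c u v }
  have hw : ℓ w = ∑ i, inner ℝ (e i) w * ℓ (e i) := by
    conv_lhs => rw [← e.sum_repr' w]
    simp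
  change _ = ℓ w
  rw [hw, christoffel, sum_inner]
  refine Finset.sum_congr rfl fun i _ => ?_
  rw [inner_smul_left, mul_comm]
  rfl

/-- Compatibility with the metric at the level of symbols: in the sum of the two Koszul expressions
the derivatives in the directions v and w cancel. -/
theorem inner_christoffel_add (y : M) (u v w : TangentSpace I y) :
    inner ℝ (christoffel I y u v) w + inner ℝ v (christoffel I y u w)
      = metricDeriv I y u (triv I y y v) (triv I y y w) := by
  rw [real_inner_comm _ v, inner_christoffel, inner_christoffel, christoffelFirst_eq,
    christoffelFirst_eq, metricDeriv_comm y u (triv I y y w), metricDeriv_comm y v (triv I y y u),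
    metricDeriv_comm y w (triv I y y u)]
  ring

variable (I) in
/-- The Christoffel symbols as a bilinear map. -/
def christoffelForm (y : M) :
    TangentSpace I y →ₗ[ℝ] TangentSpace I y →ₗ[ℝ] TangentSpace I y :=
  have hadd (u v v' : TangentSpace I y) :
      christoffel I y u (v + v') = christoffel I y u v + christoffel I y u v' := by
    refine ext_inner_right ℝ fun w => ?_
    rw [inner_add_left, inner_christoffel, inner_christoffel, inner_christoffel,
      christoffelFirst_add_second]
  have hsmul (c : ℝ) (u v : TangentSpace I y) :
      christoffel I y u (c • v) = c • christoffel I y u v := by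
    refine ext_inner_right ℝ fun w => ?_
    rw [inner_smul_left, inner_christoffel, inner_christoffel, christoffelFirst_smul_second]
    rfl
  LinearMap.mk₂ ℝ (christoffel I y)
    (fun a b c => by
      rw [christoffel_comm, hadd, christoffel_comm y c, christoffel_comm y c])
    (fun a b c => by rw [christoffel_comm, hsmul, christoffel_comm y c])
    (fun a b c => hadd a b c) (fun c a b => hsmul c a b)

end Metric

/-! ### The covariant derivative along a map is compatible with the metric. -/

section Along

variable {E : Type*} [NormedAddCommGroup E] [NormedSpace ℝ E] [FiniteDimensional ℝ E]
  {H : Type*} [TopologicalSpace H] {I : ModelWithCorners ℝ E H}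
  {M : Type*} [TopologicalSpace M] [ChartedSpace H M] [IsManifold I ∞ M]
  {E' : Type*} [NormedAddCommGroup E'] [NormedSpace ℝ E']
  {H' : Type*} [TopologicalSpace H'] {I' : ModelWithCorners ℝ E' H'}
  {N : Type*} [TopologicalSpace N] [ChartedSpace H' N]
  {φ : N → M} {V W : ∀ q : N, TangentSpace I (φ q)} {p : N}

theorem MDifferentiableAt.base_along
    (hV : MDifferentiableAt I' I.tangent (fun q => (⟨φ q, V q⟩ : TangentBundle I M)) p) :
    MDifferentiableAt I' I φ p :=
  ((mdifferentiableAt_totalSpace I _).1 hV).1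

theorem MDifferentiableAt.triv_along
    (hV : MDifferentiableAt I' I.tangent (fun q => (⟨φ q, V q⟩ : TangentBundle I M)) p) :
    MDifferentiableAt I' 𝓘(ℝ, E) (fun q => triv I (φ p) (φ q) (V q)) p := by
  refine ((mdifferentiableAt_totalSpace I _).1 hV).2.congr_of_eventuallyEq ?_
  filter_upwards [chart_source_mem_nhds H (MDifferentiableAt.base_along hV).continuousAt] with q hq
  exact (coe_triv hq _).symm

/-- Reduces differentiability of a field along a map to that of the map and of the components in the
single chart at `φ p`, the form in which `covDerivAlong` differentiates. -/
theorem mdifferentiableAt_along_iff :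
    MDifferentiableAt I' I.tangent (fun q => (⟨φ q, V q⟩ : TangentBundle I M)) p ↔
      MDifferentiableAt I' I φ p ∧
        MDifferentiableAt I' 𝓘(ℝ, E) (fun q => triv I (φ p) (φ q) (V q)) p := by
  refine ⟨fun h => ⟨MDifferentiableAt.base_along h, MDifferentiableAt.triv_along h⟩, fun h =>
    (mdifferentiableAt_totalSpace I _).2 ⟨h.1, h.2.congr_of_eventuallyEq ?_⟩⟩
  filter_upwards [chart_source_mem_nhds H h.1.continuousAt] with q hq
  exact coe_triv hq _

variable [RiemannianBundle (fun x : M => TangentSpace I x)]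

theorem covDerivAlong_eq (hφ : ContinuousAt φ p) (V : ∀ q : N, TangentSpace I (φ q))
    (u : TangentSpace I' p) :
    covDerivAlong I I' φ V p u = constVec I (φ p) (φ p)
        (mvfderiv I' (fun q => triv I (φ p) (φ q) (V q)) p u)
      + christoffel I (φ p) (mfderiv I' I φ p u) (V p) := by
  have h : mvfderiv I' (fun q =>
      (trivializationAt E (TangentSpace I : M → Type _) (φ p) ⟨φ q, V q⟩).2) p
      = mvfderiv I' (fun q => triv I (φ p) (φ q) (V q)) p := by
    refine mvfderiv_congr ?_
    filter_upwards [chart_source_mem_nhds H hφ] with q hq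
    exact coe_triv hq _
  unfold covDerivAlong
  rw [symm_eq_constVec _ (by simp), h]

variable [IsContMDiffRiemannianBundle I ∞ E (fun x : M => TangentSpace I x)]

theorem sum_basis_bilinear {ι : Type*} [Fintype ι] (b : Basis ι ℝ E) (A : E →ₗ[ℝ] E →ₗ[ℝ] ℝ)
    (x y : E) : A x y = ∑ i, ∑ j, b.repr x i * (b.repr y j * A (b i) (b j)) := by
  conv_lhs => rw [← b.sum_repr x, ← b.sum_repr y]
  simp only [map_sum, LinearMap.sum_apply, map_smul, LinearMap.smul_apply, smul_eq_mul,
    Finset.mul_sum]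
  rw [Finset.sum_comm]
  refine Finset.sum_congr rfl fun i _ => Finset.sum_congr rfl fun j _ => ?_
  ring

variable (I) in
/-- `metricCoeff` as a bilinear form. -/
def metricForm (y q : M) : E →ₗ[ℝ] E →ₗ[ℝ] ℝ :=
  LinearMap.mk₂ ℝ (fun a b => metricCoeff I y a b q)
    (fun a b c => by simp [metricCoeff, inner_add_left])
    (fun a b c => by simp [metricCoeff, inner_smul_left])
    (fun a b c => by simp [metricCoeff, inner_add_right])
    (fun a b c => by simp [metricCoeff, inner_smul_right])

/-- The product rule is applied to components times metric coefficients. The two terms that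
differentiate components are the ordinary part of the covariant derivatives; the term that
differentiates the metric is absorbed by the Christoffel symbols through `inner_christoffel_add`. -/
theorem mvfderiv_inner_along
    (hV : MDifferentiableAt I' I.tangent (fun q => (⟨φ q, V q⟩ : TangentBundle I M)) p)
    (hW : MDifferentiableAt I' I.tangent (fun q => (⟨φ q, W q⟩ : TangentBundle I M)) p)
    (u : TangentSpace I' p) :
    mvfderiv I' (fun q => inner ℝ (V q) (W q)) p u
      = inner ℝ (covDerivAlong I I' φ V p u) (W p)
        + inner ℝ (V p) (covDerivAlong I I' φ W p u) := by
  have hφ := MDifferentiableAt.base_along hV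
  have hv := MDifferentiableAt.triv_along hV
  have hw := MDifferentiableAt.triv_along hW
  set v : N → E := fun q => triv I (φ p) (φ q) (V q) with hvdef
  set w : N → E := fun q => triv I (φ p) (φ q) (W q) with hwdef
  let b := finBasis ℝ E
  let c : Fin (finrank ℝ E) → E →L[ℝ] ℝ := fun i => (b.coord i).toContinuousLinearMap
  let g : Fin (finrank ℝ E) → Fin (finrank ℝ E) → M → ℝ := fun i j =>
    metricCoeff I (φ p) (b i) (b j)
  have key : (fun q => inner ℝ (V q) (W q)) =ᶠ[𝓝 p]
      fun q => ∑ i, ∑ j, c i (v q) * (c j (w q) * g i j (φ q)) := by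
    filter_upwards [chart_source_mem_nhds H hφ.continuousAt] with q hq
    have h1 := sum_basis_bilinear b (metricForm I (φ p) (φ q)) (v q) (w q)
    rw [← constVec_triv (V q) hq, ← constVec_triv (W q) hq]
    exact h1
  have hc (i) : MDifferentiableAt I' 𝓘(ℝ, ℝ) (fun q => c i (v q)) p :=
    (c i).differentiableAt.mdifferentiableAt.comp p hv
  have hd (i) : MDifferentiableAt I' 𝓘(ℝ, ℝ) (fun q => c i (w q)) p :=
    (c i).differentiableAt.mdifferentiableAt.comp p hw
  have hg (i j) : MDifferentiableAt I' 𝓘(ℝ, ℝ) (fun q => g i j (φ q)) p :=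
    (mdifferentiableAt_metricCoeff (φ p) (b i) (b j)).comp p hφ
  have hdg (i j) : MDifferentiableAt I' 𝓘(ℝ, ℝ) (fun q => c j (w q) * g i j (φ q)) p :=
    (hd j).mul (hg i j)
  have hcdg (i j) :
      MDifferentiableAt I' 𝓘(ℝ, ℝ) (fun q => c i (v q) * (c j (w q) * g i j (φ q))) p :=
    (hc i).mul (hdg i j)
  have hterm (i j) : mvfderiv I' (fun q => c i (v q) * (c j (w q) * g i j (φ q))) p u
      = c i (v p) * (c j (w p) * mvfderiv I (g i j) (φ p) (mfderiv I' I φ p u))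
        + c i (v p) * (c j (mvfderiv I' w p u) * g i j (φ p))
        + c i (mvfderiv I' v p u) * (c j (w p) * g i j (φ p)) := by
    rw [mvfderiv_fun_mul (hc i) (hdg i j), mvfderiv_fun_mul (hd j) (hg i j)]
    have e1 := mvfderiv_clm_comp (c i) hv u
    have e2 := mvfderiv_clm_comp (c j) hw u
    have e3 := mvfderiv_comp_of_mdifferentiableAt (f := φ) rfl
      (mdifferentiableAt_metricCoeff (I := I) (φ p) (b i) (b j)) hφ u
    simp only [add_apply, smul_apply, smul_eq_mul]
    rw [e1, e2, e3]
    ring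
  have hsum : mvfderiv I' (fun q => inner ℝ (V q) (W q)) p u
      = metricDeriv I (φ p) (mfderiv I' I φ p u) (v p) (w p)
        + metricCoeff I (φ p) (v p) (mvfderiv I' w p u) (φ p)
        + metricCoeff I (φ p) (mvfderiv I' v p u) (w p) (φ p) := by
    rw [mvfderiv_congr key, mvfderiv_fun_sum _
      (fun i _ => MDifferentiableAt.fun_sum _ fun j _ => hcdg i j)]
    have : ∀ i, mvfderiv I' (fun q => ∑ j, c i (v q) * (c j (w q) * g i j (φ q))) p
        = ∑ j, mvfderiv I' (fun q => c i (v q) * (c j (w q) * g i j (φ q))) p := fun i =>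
      mvfderiv_fun_sum _ fun j _ => hcdg i j
    simp_rw [this, sum_apply, hterm, Finset.sum_add_distrib]
    congr 1
    · congr 1
      · exact (sum_basis_bilinear b (metricDerivForm I (φ p) (mfderiv I' I φ p u))
          (v p) (w p)).symm
      · exact (sum_basis_bilinear b (metricForm I (φ p) (φ p)) (v p) (mvfderiv I' w p u)).symm
    · exact (sum_basis_bilinear b (metricForm I (φ p) (φ p)) (mvfderiv I' v p u) (w p)).symm
  rw [hsum, covDerivAlong_eq hφ.continuousAt, covDerivAlong_eq hφ.continuousAt, inner_add_left,
    inner_add_right, ← inner_christoffel_add]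
  simp only [metricCoeff, hvdef, hwdef]
  rw [constVec_triv _ (by simp), constVec_triv _ (by simp)]
  ring

end Along

/-! ### The second covariant derivative of a map. -/

section Hessian

variable {E : Type*} [NormedAddCommGroup E] [NormedSpace ℝ E] [FiniteDimensional ℝ E]
  {H : Type*} [TopologicalSpace H] {I : ModelWithCorners ℝ E H}
  {M : Type*} [TopologicalSpace M] [ChartedSpace H M] [IsManifold I ∞ M]
  {E' : Type*} [NormedAddCommGroup E'] [NormedSpace ℝ E']
  {H' : Type*} [TopologicalSpace H'] {I' : ModelWithCorners ℝ E' H'}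
  {N : Type*} [TopologicalSpace N] [ChartedSpace H' N] [IsManifold I' ∞ N]
  {φ : N → M} {p : N}

variable (I I') in
/-- The expression of `φ` in the charts at `p` and `φ p`. -/
def localExpr (φ : N → M) (p : N) : E' → E :=
  fun x => extChartAt I (φ p) (φ ((extChartAt I' p).symm x))

theorem contDiffAt_localExpr [I'.Boundaryless] (hφ : ContMDiff I' I ∞ φ) {q : N}
    (hq : q ∈ (chartAt H' p).source) (hφq : φ q ∈ (chartAt H (φ p)).source) :
    ContDiffAt ℝ ∞ (localExpr I I' φ p) (extChartAt I' p q) := by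
  have h1 : ContMDiffAt 𝓘(ℝ, E') I' ∞ (extChartAt I' p).symm (extChartAt I' p q) :=
    (contMDiffOn_extChartAt_symm p).contMDiffAt
      ((isOpen_extChartAt_target p).mem_nhds ((extChartAt I' p).map_source (by simpa using hq)))
  have hinv : (extChartAt I' p).symm (extChartAt I' p q) = q :=
    (extChartAt I' p).left_inv (by simpa using hq)
  have h2 : ContMDiffAt I 𝓘(ℝ, E) ∞ (extChartAt I (φ p)) (φ q) :=
    contMDiffAt_extChartAt' hφq
  have h3 : ContMDiffAt I' 𝓘(ℝ, E) ∞ (fun q => extChartAt I (φ p) (φ q)) q :=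
    h2.comp q (hφ q)
  rw [← hinv] at h3
  exact (h3.comp _ h1).contDiffAt

/-- The chain rule through both charts, valid at all q near p. The components of dφ of a
chart-constant field are thus a first derivative of the coordinate expression, and differentiating
them once more produces the honest second derivative `localHess`. -/
theorem triv_mfderiv [I'.Boundaryless] (hφ : ContMDiff I' I ∞ φ) {q : N}
    (hq : q ∈ (chartAt H' p).source) (hφq : φ q ∈ (chartAt H (φ p)).source)
    (v : TangentSpace I' p) :
    triv I (φ p) (φ q) (mfderiv I' I φ q (extend E' v q))
      = fderiv ℝ (localExpr I I' φ p) (extChartAt I' p q) (triv I' p p v) := by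
  have hinv : (extChartAt I' p).symm (extChartAt I' p q) = q :=
    (extChartAt I' p).left_inv (by simpa using hq)
  have hext : extend E' v q
      = mfderivWithin 𝓘(ℝ, E') I' (extChartAt I' p).symm (Set.range I') (extChartAt I' p q)
        (triv I' p p v) := by
    rw [extend_eq v hq, constVec, TangentBundle.symmL_trivializationAt hq]
    rfl
  rw [hext, I'.range_eq_univ, mfderivWithin_univ, triv,
    TangentBundle.continuousLinearMapAt_trivializationAt hφq, ← mfderiv_eq_fderiv]
  have d1 : MDifferentiableAt 𝓘(ℝ, E') I' (extChartAt I' p).symm (extChartAt I' p q) := by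
    have := mdifferentiableWithinAt_extChartAt_symm (I := I')
      ((extChartAt I' p).map_source (x := q) (by simpa using hq))
    rwa [I'.range_eq_univ, mdifferentiableWithinAt_univ] at this
  have d2 : MDifferentiableAt I' I φ ((extChartAt I' p).symm (extChartAt I' p q)) :=
    (hφ _).mdifferentiableAt (by simp)
  have d3 : MDifferentiableAt I 𝓘(ℝ, E) (extChartAt I (φ p))
      (φ ((extChartAt I' p).symm (extChartAt I' p q))) := by
    rw [hinv]; exact mdifferentiableAt_extChartAt hφq
  have e1 := mfderiv_comp_apply (extChartAt I' p q) d2 d1 (triv I' p p v)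
  have e2 := mfderiv_comp_apply (extChartAt I' p q) (f := φ ∘ (extChartAt I' p).symm) d3
    (d2.comp _ d1) (triv I' p p v)
  rw [e1] at e2
  refine Eq.trans ?_ e2.symm
  simp only [Function.comp]
  rw [hinv]
  rfl

variable (I I') in
/-- The second derivative of the coordinate expression of `φ` in the charts at `p` and `φ p`. -/
def localHess (φ : N → M) (p : N) : E' →L[ℝ] E' →L[ℝ] E :=
  fderiv ℝ (fderiv ℝ (localExpr I I' φ p)) (extChartAt I' p p)

theorem hasMFDerivAt_triv_mfderiv [I'.Boundaryless] (hφ : ContMDiff I' I ∞ φ)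
    (v : TangentSpace I' p) :
    HasMFDerivAt I' 𝓘(ℝ, E) (fun q => triv I (φ p) (φ q) (mfderiv I' I φ q (extend E' v q))) p
      (((localHess I I' φ p).flip (triv I' p p v)) ∘L triv I' p p) := by
  have hc := contDiffAt_localExpr (I := I) (I' := I') (p := p) (q := p) hφ (by simp) (by simp)
  have hd : DifferentiableAt ℝ (fderiv ℝ (localExpr I I' φ p)) (extChartAt I' p p) :=
    (hc.fderiv_right (m := 1) (by norm_cast)).differentiableAt (by simp)
  have h1 : HasFDerivAt (fun x => fderiv ℝ (localExpr I I' φ p) x (triv I' p p v))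
      ((localHess I I' φ p).flip (triv I' p p v)) (extChartAt I' p p) :=
    ((ContinuousLinearMap.apply ℝ E (triv I' p p v)).hasFDerivAt.comp _ hd.hasFDerivAt)
  have h2 : HasMFDerivAt I' 𝓘(ℝ, E') (extChartAt I' p) p (triv I' p p) := by
    have := (mdifferentiableAt_extChartAt (I := I') (x := p) (y := p) (by simp)).hasMFDerivAt
    rwa [← TangentBundle.continuousLinearMapAt_trivializationAt (by simp)] at this
  refine (h1.hasMFDerivAt.comp p h2).congr_of_eventuallyEq ?_
  filter_upwards [chart_source_mem_nhds_self H' p,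
    chart_source_mem_nhds H (hφ.continuous.continuousAt (x := p))] with q hq hφq
  exact triv_mfderiv hφ hq hφq v

theorem mdifferentiableAt_mfderiv_extend [I'.Boundaryless] (hφ : ContMDiff I' I ∞ φ)
    (v : TangentSpace I' p) :
    MDifferentiableAt I' I.tangent
      (fun q => (⟨φ q, mfderiv I' I φ q (extend E' v q)⟩ : TangentBundle I M)) p :=
  mdifferentiableAt_along_iff.2 ⟨(hφ p).mdifferentiableAt (by simp),
    (hasMFDerivAt_triv_mfderiv hφ v).mdifferentiableAt⟩

theorem localHess_comm [I'.Boundaryless] (hφ : ContMDiff I' I ∞ φ) (u v : E') :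
    localHess I I' φ p u v = localHess I I' φ p v u :=
  (contDiffAt_localExpr (I := I) (I' := I') (p := p) (q := p) hφ (by simp)
    (by simp)).isSymmSndFDerivAt (by simp; norm_cast) u v

variable [RiemannianBundle (fun x : M => TangentSpace I x)]
  [IsContMDiffRiemannianBundle I ∞ E (fun x : M => TangentSpace I x)]

variable (I I') in
/-- The second covariant derivative of the map `φ`. -/
def hess (φ : N → M) (p : N) (u v : TangentSpace I' p) : TangentSpace I (φ p) :=
  covDerivAlong I I' φ (fun q => mfderiv I' I φ q (extend E' v q)) p u

/-- Coordinate form ∂²φ + Γ(dφ, dφ): bilinearity and symmetry of `hess` are read off from it. -/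
theorem hess_eq [I'.Boundaryless] (hφ : ContMDiff I' I ∞ φ) (u v : TangentSpace I' p) :
    hess I I' φ p u v
      = constVec I (φ p) (φ p) (localHess I I' φ p (triv I' p p u) (triv I' p p v))
        + christoffelForm I (φ p) (mfderiv I' I φ p u) (mfderiv I' I φ p v) := by
  unfold hess
  rw [covDerivAlong_eq hφ.continuous.continuousAt,
    mvfderiv_eq_of_hasMFDerivAt (hasMFDerivAt_triv_mfderiv hφ v), extend_apply_self]
  rfl

/-- The connection is torsion free and second derivatives commute. -/
theorem hess_comm [I'.Boundaryless] (hφ : ContMDiff I' I ∞ φ) (u v : TangentSpace I' p) :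
    hess I I' φ p u v = hess I I' φ p v u := by
  rw [hess_eq hφ, hess_eq hφ, localHess_comm hφ]
  congr 1
  exact christoffel_comm _ _ _

/-- `hess` as a bilinear map. -/
def hessForm [I'.Boundaryless] (hφ : ContMDiff I' I ∞ φ) (p : N) :
    TangentSpace I' p →ₗ[ℝ] TangentSpace I' p →ₗ[ℝ] TangentSpace I (φ p) :=
  LinearMap.mk₂ ℝ (hess I I' φ p)
    (fun a b c => by simp only [hess_eq hφ, map_add, add_apply, LinearMap.add_apply]; abel)
    (fun a b c => by simp only [hess_eq hφ, map_smul, smul_apply, LinearMap.smul_apply, smul_add])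
    (fun a b c => by simp only [hess_eq hφ, map_add]; abel)
    (fun a b c => by simp only [hess_eq hφ, map_smul, smul_add])

theorem mvfderiv_inner_mfderiv [I'.Boundaryless] (hφ : ContMDiff I' I ∞ φ)
    (u v w : TangentSpace I' p) :
    mvfderiv I' (fun q => inner ℝ (mfderiv I' I φ q (extend E' v q))
        (mfderiv I' I φ q (extend E' w q))) p u
      = inner ℝ (hess I I' φ p u v) (mfderiv I' I φ p w)
        + inner ℝ (mfderiv I' I φ p v) (hess I I' φ p u w) := by
  rw [mvfderiv_inner_along (mdifferentiableAt_mfderiv_extend hφ v)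
    (mdifferentiableAt_mfderiv_extend hφ w), extend_apply_self, extend_apply_self]
  rfl

end Hessian

/-! ### The tensor ∇J of a nearly Kaehler structure and its skew symmetries. -/

section AlmostComplex

theorem mvfderiv_clm_apply {E : Type*} [NormedAddCommGroup E] [NormedSpace ℝ E]
    {H : Type*} [TopologicalSpace H] {I : ModelWithCorners ℝ E H}
    {M : Type*} [TopologicalSpace M] [ChartedSpace H M]
    {F G : Type*} [NormedAddCommGroup F] [NormedSpace ℝ F]
    [NormedAddCommGroup G] [NormedSpace ℝ G] {A : M → F →L[ℝ] G} {v : M → F} {x : M}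
    (hA : MDifferentiableAt I 𝓘(ℝ, F →L[ℝ] G) A x) (hv : MDifferentiableAt I 𝓘(ℝ, F) v x)
    (u : TangentSpace I x) :
    mvfderiv I (fun q => A q (v q)) x u
      = mvfderiv I A x u (v x) + A x (mvfderiv I v x u) := by
  have h1 := HasFDerivWithinAt.clm_apply (E := E) (G := F) (H := G) hA.hasMFDerivAt.2
    hv.hasMFDerivAt.2
  have h2 : HasMFDerivAt I 𝓘(ℝ, G) (fun q => A q (v q)) x _ := ⟨(hA.clm_apply hv).continuousAt, h1⟩
  have h3 := congrArg (fun L : E →L[ℝ] G => L u) (mvfderiv_eq_of_hasMFDerivAt h2)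
  refine h3.trans ((add_comm _ _).trans ?_)
  simp only [writtenInExtChartAt, Function.comp, extChartAt_to_inv]
  rfl

variable {E : Type*} [NormedAddCommGroup E] [NormedSpace ℝ E] [FiniteDimensional ℝ E]
  {H : Type*} [TopologicalSpace H] {I : ModelWithCorners ℝ E H}
  {M : Type*} [TopologicalSpace M] [ChartedSpace H M] [IsManifold I ∞ M]
  {E' : Type*} [NormedAddCommGroup E'] [NormedSpace ℝ E']
  {H' : Type*} [TopologicalSpace H'] {I' : ModelWithCorners ℝ E' H'}
  {N : Type*} [TopologicalSpace N] [ChartedSpace H' N]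
  {J : ∀ q : M, TangentSpace I q →L[ℝ] TangentSpace I q}

namespace NearlyKaehlerStructure

variable [RiemannianBundle (fun x : M => TangentSpace I x)] (K : NearlyKaehlerStructure I M)

theorem inner_J_left (y : M) (a b : TangentSpace I y) :
    inner ℝ (K.J y a) b = -inner ℝ a (K.J y b) := by
  rw [← K.inner_J y (K.J y a) b, K.J_sq, inner_neg_left]

theorem inner_J_self (y : M) (a : TangentSpace I y) : inner ℝ (K.J y a) a = 0 := by
  have h := K.inner_J_left y a a
  have h' := real_inner_comm a (K.J y a)
  linarith

theorem norm_J (y : M) (a : TangentSpace I y) : ‖K.J y a‖ = ‖a‖ := by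
  rw [norm_eq_sqrt_real_inner, norm_eq_sqrt_real_inner, K.inner_J]

end NearlyKaehlerStructure

/-- The expression of an endomorphism field in the trivialization at `y`. -/
def endoTriv (J : ∀ q : M, TangentSpace I q →L[ℝ] TangentSpace I q) (y q : M) : E →L[ℝ] E :=
  triv I y q ∘L J q ∘L constVec I y q

theorem mdifferentiableAt_endoTriv
    (hJ : ContMDiff I (I.prod 𝓘(ℝ, E →L[ℝ] E)) ∞
      (fun q => TotalSpace.mk' (E →L[ℝ] E)
        (E := fun q : M => TangentSpace I q →L[ℝ] TangentSpace I q) q (J q))) (y : M) :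
    MDifferentiableAt I 𝓘(ℝ, E →L[ℝ] E) (endoTriv J y) y :=
  ((contMDiffAt_hom_bundle _).1 (hJ y)).2.mdifferentiableAt (by simp)

section Along

variable {φ : N → M} {V : ∀ q : N, TangentSpace I (φ q)} {p : N}

theorem triv_endo (V : ∀ q : N, TangentSpace I (φ q)) (hφ : ContinuousAt φ p) :
    (fun q => triv I (φ p) (φ q) (J (φ q) (V q))) =ᶠ[𝓝 p]
      fun q => endoTriv J (φ p) (φ q) (triv I (φ p) (φ q) (V q)) := by
  filter_upwards [chart_source_mem_nhds H hφ] with q hq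
  simp only [endoTriv, ContinuousLinearMap.comp_apply]
  rw [constVec_triv _ hq]

theorem MDifferentiableAt.endo_along
    (hJ : ContMDiff I (I.prod 𝓘(ℝ, E →L[ℝ] E)) ∞
      (fun q => TotalSpace.mk' (E →L[ℝ] E)
        (E := fun q : M => TangentSpace I q →L[ℝ] TangentSpace I q) q (J q)))
    (hV : MDifferentiableAt I' I.tangent (fun q => (⟨φ q, V q⟩ : TangentBundle I M)) p) :
    MDifferentiableAt I' I.tangent
      (fun q => (⟨φ q, J (φ q) (V q)⟩ : TangentBundle I M)) p := by
  have hφ := MDifferentiableAt.base_along hV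
  refine mdifferentiableAt_along_iff.2 ⟨hφ, ?_⟩
  refine MDifferentiableAt.congr_of_eventuallyEq ?_ (triv_endo V hφ.continuousAt)
  exact ((mdifferentiableAt_endoTriv hJ (φ p)).comp p hφ).clm_apply
    (MDifferentiableAt.triv_along hV)

variable [RiemannianBundle (fun x : M => TangentSpace I x)]
  [IsContMDiffRiemannianBundle I ∞ E (fun x : M => TangentSpace I x)]

/-- The tensor `(∇_a J) b`. -/
def nablaEndo (J : ∀ q : M, TangentSpace I q →L[ℝ] TangentSpace I q) (y : M)
    (a b : TangentSpace I y) : TangentSpace I y :=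
  constVec I y y (mvfderiv I (endoTriv J y) y a (triv I y y b)) + christoffelForm I y a (J y b)
    - J y (christoffelForm I y a b)

/-- Leibniz rule along a map. ∇J enters through its value at the image point only, so identities for
vector fields on the ambient manifold can be used along `φ`, although dφ of a field need not extend
to such a vector field. -/
theorem covDerivAlong_endo
    (hJ : ContMDiff I (I.prod 𝓘(ℝ, E →L[ℝ] E)) ∞
      (fun q => TotalSpace.mk' (E →L[ℝ] E)
        (E := fun q : M => TangentSpace I q →L[ℝ] TangentSpace I q) q (J q)))
    (hV : MDifferentiableAt I' I.tangent (fun q => (⟨φ q, V q⟩ : TangentBundle I M)) p)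
    (u : TangentSpace I' p) :
    covDerivAlong I I' φ (fun q => J (φ q) (V q)) p u
      = nablaEndo J (φ p) (mfderiv I' I φ p u) (V p)
        + J (φ p) (covDerivAlong I I' φ V p u) := by
  have hφ := MDifferentiableAt.base_along hV
  have hA : MDifferentiableAt I' 𝓘(ℝ, E →L[ℝ] E) (fun q => endoTriv J (φ p) (φ q)) p :=
    (mdifferentiableAt_endoTriv hJ (φ p)).comp p hφ
  rw [covDerivAlong_eq hφ.continuousAt, covDerivAlong_eq hφ.continuousAt,
    mvfderiv_congr (triv_endo V hφ.continuousAt),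
    mvfderiv_clm_apply hA (MDifferentiableAt.triv_along hV),
    mvfderiv_comp_of_mdifferentiableAt (f := φ) rfl (mdifferentiableAt_endoTriv hJ (φ p)) hφ u]
  have h1 (w : E) : constVec I (φ p) (φ p) (endoTriv J (φ p) (φ p) w)
      = J (φ p) (constVec I (φ p) (φ p) w) := by
    simp only [endoTriv, ContinuousLinearMap.comp_apply]
    rw [constVec_triv _ (by simp)]
  rw [map_add, map_add, h1, nablaEndo]
  change _ + _ + christoffelForm I _ _ _ = _ + _ - _ + (_ + J (φ p) (christoffelForm I _ _ _))
  abel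

end Along

variable [RiemannianBundle (fun x : M => TangentSpace I x)]
  [IsContMDiffRiemannianBundle I ∞ E (fun x : M => TangentSpace I x)]

theorem covDerivEndo_eq
    (hJ : ContMDiff I (I.prod 𝓘(ℝ, E →L[ℝ] E)) ∞
      (fun q => TotalSpace.mk' (E →L[ℝ] E)
        (E := fun q : M => TangentSpace I q →L[ℝ] TangentSpace I q) q (J q)))
    (X Y : ∀ q : M, TangentSpace I q) (y : M)
    (hY : MDifferentiableAt I I.tangent (fun q => (⟨q, Y q⟩ : TangentBundle I M)) y) :
    covDerivEndo J X Y y = nablaEndo J y (X y) (Y y) := by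
  have h := covDerivAlong_endo (φ := (id : M → M)) (V := Y) hJ hY (X y)
  rw [mfderiv_id] at h
  unfold covDerivEndo covDeriv
  exact sub_eq_iff_eq_add.2 h

namespace NearlyKaehlerStructure

variable (K : NearlyKaehlerStructure I M)

/-- Since ∇J is a tensor, the nearly Kaehler condition for the chart-constant extensions of a and b
suffices. -/
theorem nablaEndo_swap (y : M) (a b : TangentSpace I y) :
    nablaEndo K.J y a b = -nablaEndo K.J y b a := by
  have ha := contMDiffAt_extend I E (V := fun x : M => TangentSpace I x) (k := ∞) a
  have hb := contMDiffAt_extend I E (V := fun x : M => TangentSpace I x) (k := ∞) b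
  have h := K.nearly (extend E a) (extend E b) y ha hb
  rw [covDerivEndo_eq K.contMDiff_J _ _ _ (ha.mdifferentiableAt (by simp)),
    covDerivEndo_eq K.contMDiff_J _ _ _ (hb.mdifferentiableAt (by simp)), extend_apply_self,
    extend_apply_self] at h
  exact eq_neg_of_add_eq_zero_left h

/-- Obtained by differentiating g(JB, C) = -g(B, JC) and cancelling the terms without ∇J. Together
with `nablaEndo_swap` this makes g((∇_a J)b, c) totally skew. -/
theorem inner_nablaEndo_swap (y : M) (a b c : TangentSpace I y) :
    inner ℝ (nablaEndo K.J y a b) c = -inner ℝ (nablaEndo K.J y a c) b := by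
  have hb := mdifferentiableAt_extend I E (V := fun x : M => TangentSpace I x) b
  have hc := mdifferentiableAt_extend I E (V := fun x : M => TangentSpace I x) c
  have hJb := MDifferentiableAt.endo_along (φ := fun q : M => q) K.contMDiff_J hb
  have hJc := MDifferentiableAt.endo_along (φ := fun q : M => q) K.contMDiff_J hc
  have h1 := mvfderiv_inner_along (φ := fun q : M => q) hJb hc a
  have h2 := mvfderiv_inner_along (φ := fun q : M => q) hb hJc a
  have h0 : (fun q : M => inner ℝ (K.J q (extend E b q)) (extend E c q))
      = -fun q : M => inner ℝ (extend E b q) (K.J q (extend E c q)) := by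
    ext q
    exact K.inner_J_left q _ _
  rw [h0, mvfderiv_neg, covDerivAlong_endo (φ := fun q : M => q) K.contMDiff_J hb,
    neg_apply, h2, covDerivAlong_endo (φ := fun q : M => q) K.contMDiff_J hc] at h1
  have hid : mfderiv I I (fun q : M => q) y a = a := by
    have := mfderiv_id (I := I) (x := y)
    exact congrArg (fun L : TangentSpace I y →L[ℝ] TangentSpace I y => L a) this
  simp only [extend_apply_self, inner_add_left, inner_add_right, K.inner_J_left] at h1
  rw [hid] at h1
  rw [real_inner_comm b (nablaEndo K.J y a c)] at *
  linarith

theorem mvfderiv_inner_J_mfderiv [I'.Boundaryless] [IsManifold I' ∞ N] {φ : N → M}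
    (hφ : ContMDiff I' I ∞ φ) (p : N) (u v w : TangentSpace I' p) :
    mvfderiv I' (fun q => inner ℝ (K.J (φ q) (mfderiv I' I φ q (extend E' v q)))
        (mfderiv I' I φ q (extend E' w q))) p u
      = inner ℝ (nablaEndo K.J (φ p) (mfderiv I' I φ p u) (mfderiv I' I φ p v))
          (mfderiv I' I φ p w)
        + inner ℝ (K.J (φ p) (hess I I' φ p u v)) (mfderiv I' I φ p w)
        + inner ℝ (K.J (φ p) (mfderiv I' I φ p v)) (hess I I' φ p u w) := by
  rw [mvfderiv_inner_along
    (MDifferentiableAt.endo_along K.contMDiff_J (mdifferentiableAt_mfderiv_extend hφ v))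
    (mdifferentiableAt_mfderiv_extend hφ w),
    covDerivAlong_endo K.contMDiff_J (mdifferentiableAt_mfderiv_extend hφ v),
    extend_apply_self, extend_apply_self, inner_add_left]
  rfl

theorem mdifferentiableAt_inner_J_mfderiv [I'.Boundaryless] [IsManifold I' ∞ N] {φ : N → M}
    (hφ : ContMDiff I' I ∞ φ) (p : N) (v w : TangentSpace I' p) :
    MDifferentiableAt I' 𝓘(ℝ, ℝ)
      (fun q => inner ℝ (K.J (φ q) (mfderiv I' I φ q (extend E' v q)))
        (mfderiv I' I φ q (extend E' w q))) p :=
  mdifferentiableAt_inner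
    (MDifferentiableAt.endo_along K.contMDiff_J (mdifferentiableAt_mfderiv_extend hφ v))
    (mdifferentiableAt_mfderiv_extend hφ w)

end NearlyKaehlerStructure

end AlmostComplex

/-! ### Product manifolds: splitting of tangent vectors and of chart-constant fields. -/

section TwoFactors

variable {E : Type*} [NormedAddCommGroup E] [NormedSpace ℝ E]
  {H : Type*} [TopologicalSpace H] {I : ModelWithCorners ℝ E H}
  {M : Type*} [TopologicalSpace M] [ChartedSpace H M] [IsManifold I ∞ M]
  {E' : Type*} [NormedAddCommGroup E'] [NormedSpace ℝ E']
  {H' : Type*} [TopologicalSpace H'] {I' : ModelWithCorners ℝ E' H'}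
  {N : Type*} [TopologicalSpace N] [ChartedSpace H' N] [IsManifold I' ∞ N]

theorem triv_prod {p q : M × N} (hq : q.1 ∈ (chartAt H p.1).source)
    (hq' : q.2 ∈ (chartAt H' p.2).source) (w : TangentSpace (I.prod I') q) :
    triv (I.prod I') p q w = ((triv I p.1 q.1 w.1, triv I' p.2 q.2 w.2) : E × E') := by
  unfold triv
  rw [TangentBundle.continuousLinearMapAt_trivializationAt hq,
    TangentBundle.continuousLinearMapAt_trivializationAt hq',
    TangentBundle.continuousLinearMapAt_trivializationAt (by simp [hq, hq'])]
  have h : mfderiv (I.prod I') 𝓘(ℝ, E × E') (extChartAt (I.prod I') p) q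
      = mfderiv (I.prod I') (𝓘(ℝ, E).prod 𝓘(ℝ, E'))
        (Prod.map (extChartAt I p.1) (extChartAt I' p.2)) q := by
    rw [extChartAt_prod, modelWithCornersSelf_prod, ← chartedSpaceSelf_prod]
    rfl
  rw [h]
  rw [mfderiv_prodMap (mdifferentiableAt_extChartAt hq) (mdifferentiableAt_extChartAt hq')]
  rfl

theorem constVec_prod {p q : M × N} (hq : q.1 ∈ (chartAt H p.1).source)
    (hq' : q.2 ∈ (chartAt H' p.2).source) (a : E) (b : E') :
    constVec (I.prod I') p q (a, b)
      = ((constVec I p.1 q.1 a, constVec I' p.2 q.2 b) : E × E') := by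
  have h := triv_prod (I := I) (I' := I') hq hq'
    ((constVec I p.1 q.1 a, constVec I' p.2 q.2 b) : E × E')
  have h1 : triv I p.1 q.1 (constVec I p.1 q.1 a) = a := triv_constVec a hq
  have h2 : triv I' p.2 q.2 (constVec I' p.2 q.2 b) = b := triv_constVec b hq'
  have h3 : triv (I.prod I') p q ((constVec I p.1 q.1 a, constVec I' p.2 q.2 b) : E × E')
    = (a, b) := h.trans (Prod.ext h1 h2)
  have h4 := constVec_triv (I := I.prod I') (y := p) (y' := q)
    ((constVec I p.1 q.1 a, constVec I' p.2 q.2 b) : E × E') (by simp [hq, hq'])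
  exact (congrArg (constVec (I.prod I') p q) h3).symm.trans h4

theorem extend_prod {p q : M × N} (hq : q.1 ∈ (chartAt H p.1).source)
    (hq' : q.2 ∈ (chartAt H' p.2).source) (a : TangentSpace I p.1) (b : TangentSpace I' p.2) :
    extend (E × E') (show TangentSpace (I.prod I') p from ((a, b) : E × E')) q
      = ((extend E a q.1, extend E' b q.2) : E × E') := by
  rw [extend_eq _ (by simp [hq, hq']), extend_eq a hq, extend_eq b hq', ← constVec_prod hq hq']
  congr 1
  exact triv_prod (by simp) (by simp) _

end TwoFactors

section Product

variable {E₀ : Type*} [NormedAddCommGroup E₀] [NormedSpace ℝ E₀]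
  {E₁ : Type*} [NormedAddCommGroup E₁] [NormedSpace ℝ E₁]
  {E₂ : Type*} [NormedAddCommGroup E₂] [NormedSpace ℝ E₂]
  {M₀ : Type*} [TopologicalSpace M₀] [ChartedSpace E₀ M₀]
  {M₁ : Type*} [TopologicalSpace M₁] [ChartedSpace E₁ M₁]
  {M₂ : Type*} [TopologicalSpace M₂] [ChartedSpace E₂ M₂]

variable (E₀ E₁ E₂) in
/-- The inclusion of the tangent space of the first factor. -/
def inc₀ (p : M₀ × M₁ × M₂) :
    TangentSpace 𝓘(ℝ, E₀) p.1 →L[ℝ] TangentSpace (prodModel E₀ E₁ E₂) p :=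
  ContinuousLinearMap.inl ℝ E₀ (E₁ × E₂)

variable (E₀ E₁ E₂) in
/-- The inclusion of the tangent space of the second factor. -/
def inc₁ (p : M₀ × M₁ × M₂) :
    TangentSpace 𝓘(ℝ, E₁) p.2.1 →L[ℝ] TangentSpace (prodModel E₀ E₁ E₂) p :=
  ContinuousLinearMap.inr ℝ E₀ (E₁ × E₂) ∘L ContinuousLinearMap.inl ℝ E₁ E₂

variable (E₀ E₁ E₂) in
/-- The inclusion of the tangent space of the third factor. -/
def inc₂ (p : M₀ × M₁ × M₂) :
    TangentSpace 𝓘(ℝ, E₂) p.2.2 →L[ℝ] TangentSpace (prodModel E₀ E₁ E₂) p :=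
  ContinuousLinearMap.inr ℝ E₀ (E₁ × E₂) ∘L ContinuousLinearMap.inr ℝ E₁ E₂

variable (E₀ E₁ E₂) in
/-- The projection to the tangent space of the first factor. -/
def pr₀ (p : M₀ × M₁ × M₂) :
    TangentSpace (prodModel E₀ E₁ E₂) p →L[ℝ] TangentSpace 𝓘(ℝ, E₀) p.1 :=
  ContinuousLinearMap.fst ℝ E₀ (E₁ × E₂)

variable (E₀ E₁ E₂) in
/-- The projection to the tangent space of the second factor. -/
def pr₁ (p : M₀ × M₁ × M₂) :
    TangentSpace (prodModel E₀ E₁ E₂) p →L[ℝ] TangentSpace 𝓘(ℝ, E₁) p.2.1 :=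
  ContinuousLinearMap.fst ℝ E₁ E₂ ∘L ContinuousLinearMap.snd ℝ E₀ (E₁ × E₂)

variable (E₀ E₁ E₂) in
/-- The projection to the tangent space of the third factor. -/
def pr₂ (p : M₀ × M₁ × M₂) :
    TangentSpace (prodModel E₀ E₁ E₂) p →L[ℝ] TangentSpace 𝓘(ℝ, E₂) p.2.2 :=
  ContinuousLinearMap.snd ℝ E₁ E₂ ∘L ContinuousLinearMap.snd ℝ E₀ (E₁ × E₂)

variable (p : M₀ × M₁ × M₂)

@[simp] theorem pr₀_inc₀ (v : TangentSpace 𝓘(ℝ, E₀) p.1) :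
    pr₀ E₀ E₁ E₂ p (inc₀ E₀ E₁ E₂ p v) = v := rfl
@[simp] theorem pr₁_inc₀ (v : TangentSpace 𝓘(ℝ, E₀) p.1) :
    pr₁ E₀ E₁ E₂ p (inc₀ E₀ E₁ E₂ p v) = 0 := rfl
@[simp] theorem pr₂_inc₀ (v : TangentSpace 𝓘(ℝ, E₀) p.1) :
    pr₂ E₀ E₁ E₂ p (inc₀ E₀ E₁ E₂ p v) = 0 := rfl
@[simp] theorem pr₀_inc₁ (v : TangentSpace 𝓘(ℝ, E₁) p.2.1) :
    pr₀ E₀ E₁ E₂ p (inc₁ E₀ E₁ E₂ p v) = 0 := rfl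
@[simp] theorem pr₁_inc₁ (v : TangentSpace 𝓘(ℝ, E₁) p.2.1) :
    pr₁ E₀ E₁ E₂ p (inc₁ E₀ E₁ E₂ p v) = v := rfl
@[simp] theorem pr₂_inc₁ (v : TangentSpace 𝓘(ℝ, E₁) p.2.1) :
    pr₂ E₀ E₁ E₂ p (inc₁ E₀ E₁ E₂ p v) = 0 := rfl
@[simp] theorem pr₀_inc₂ (v : TangentSpace 𝓘(ℝ, E₂) p.2.2) :
    pr₀ E₀ E₁ E₂ p (inc₂ E₀ E₁ E₂ p v) = 0 := rfl
@[simp] theorem pr₁_inc₂ (v : TangentSpace 𝓘(ℝ, E₂) p.2.2) :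
    pr₁ E₀ E₁ E₂ p (inc₂ E₀ E₁ E₂ p v) = 0 := rfl
@[simp] theorem pr₂_inc₂ (v : TangentSpace 𝓘(ℝ, E₂) p.2.2) :
    pr₂ E₀ E₁ E₂ p (inc₂ E₀ E₁ E₂ p v) = v := rfl

theorem inc_pr (v : TangentSpace (prodModel E₀ E₁ E₂) p) :
    inc₀ E₀ E₁ E₂ p (pr₀ E₀ E₁ E₂ p v) + inc₁ E₀ E₁ E₂ p (pr₁ E₀ E₁ E₂ p v)
      + inc₂ E₀ E₁ E₂ p (pr₂ E₀ E₁ E₂ p v) = v := by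
  have h (v : E₀ × E₁ × E₂) : ((v.1, 0) + (0, (v.2.1, 0)) + (0, (0, v.2.2)) : E₀ × E₁ × E₂) = v := by
    ext <;> simp
  exact h v

theorem hasMFDerivAt_leaf₀ : HasMFDerivAt 𝓘(ℝ, E₀) (prodModel E₀ E₁ E₂)
    (fun x : M₀ => (x, p.2.1, p.2.2)) p.1 (inc₀ E₀ E₁ E₂ p) :=
  HasMFDerivAt.prodMk (hasMFDerivAt_id p.1) (hasMFDerivAt_const (p.2.1, p.2.2) p.1)

theorem hasMFDerivAt_leaf₁ : HasMFDerivAt 𝓘(ℝ, E₁) (prodModel E₀ E₁ E₂)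
    (fun y : M₁ => (p.1, y, p.2.2)) p.2.1 (inc₁ E₀ E₁ E₂ p) :=
  HasMFDerivAt.prodMk (hasMFDerivAt_const p.1 p.2.1)
    (HasMFDerivAt.prodMk (hasMFDerivAt_id p.2.1) (hasMFDerivAt_const p.2.2 p.2.1))

theorem hasMFDerivAt_leaf₂ : HasMFDerivAt 𝓘(ℝ, E₂) (prodModel E₀ E₁ E₂)
    (fun z : M₂ => (p.1, p.2.1, z)) p.2.2 (inc₂ E₀ E₁ E₂ p) :=
  HasMFDerivAt.prodMk (hasMFDerivAt_const p.1 p.2.2)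
    (HasMFDerivAt.prodMk (hasMFDerivAt_const p.2.1 p.2.2) (hasMFDerivAt_id p.2.2))

theorem hasMFDerivAt_proj₀ : HasMFDerivAt (prodModel E₀ E₁ E₂) 𝓘(ℝ, E₀)
    (fun q : M₀ × M₁ × M₂ => q.1) p (pr₀ E₀ E₁ E₂ p) :=
  hasMFDerivAt_fst p

theorem hasMFDerivAt_proj₁ : HasMFDerivAt (prodModel E₀ E₁ E₂) 𝓘(ℝ, E₁)
    (fun q : M₀ × M₁ × M₂ => q.2.1) p (pr₁ E₀ E₁ E₂ p) :=
  (hasMFDerivAt_fst p.2).comp p (hasMFDerivAt_snd p)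

theorem hasMFDerivAt_proj₂ : HasMFDerivAt (prodModel E₀ E₁ E₂) 𝓘(ℝ, E₂)
    (fun q : M₀ × M₁ × M₂ => q.2.2) p (pr₂ E₀ E₁ E₂ p) :=
  (hasMFDerivAt_snd p.2).comp p (hasMFDerivAt_snd p)

section Extend

variable [IsManifold 𝓘(ℝ, E₀) ∞ M₀] [IsManifold 𝓘(ℝ, E₁) ∞ M₁] [IsManifold 𝓘(ℝ, E₂) ∞ M₂]

variable {p} in
-- The chart of the product is the product of the charts, so a chart-constant field splits into
-- chart-constant fields of the factors. In particular the extension of a vector tangent to one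
-- family of leaves stays tangent to that family.
theorem extend_eq_inc {q : M₀ × M₁ × M₂}
    (hq : q ∈ (chartAt (ModelProd E₀ (ModelProd E₁ E₂)) p).source)
    (v : TangentSpace (prodModel E₀ E₁ E₂) p) :
    extend (E₀ × E₁ × E₂) v q = inc₀ E₀ E₁ E₂ q (extend E₀ (pr₀ E₀ E₁ E₂ p v) q.1)
      + inc₁ E₀ E₁ E₂ q (extend E₁ (pr₁ E₀ E₁ E₂ p v) q.2.1)
      + inc₂ E₀ E₁ E₂ q (extend E₂ (pr₂ E₀ E₁ E₂ p v) q.2.2) := by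
  have hq0 : q.1 ∈ (chartAt E₀ p.1).source := by simp at hq; exact hq.1
  have hq1 : q.2.1 ∈ (chartAt E₁ p.2.1).source := by simp at hq; exact hq.2.1
  have hq2 : q.2.2 ∈ (chartAt E₂ p.2.2).source := by simp at hq; exact hq.2.2
  have h1 := extend_prod (I := 𝓘(ℝ, E₀)) (I' := 𝓘(ℝ, E₁).prod 𝓘(ℝ, E₂)) (p := p) (q := q) hq0
    (by simp [hq1, hq2]) (pr₀ E₀ E₁ E₂ p v)
    (show TangentSpace (𝓘(ℝ, E₁).prod 𝓘(ℝ, E₂)) p.2 from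
      ((pr₁ E₀ E₁ E₂ p v, pr₂ E₀ E₁ E₂ p v) : E₁ × E₂))
  have h2 := extend_prod (I := 𝓘(ℝ, E₁)) (I' := 𝓘(ℝ, E₂)) (p := p.2) (q := q.2) hq1 hq2
    (pr₁ E₀ E₁ E₂ p v) (pr₂ E₀ E₁ E₂ p v)
  have h3 (a : E₀) (b : E₁) (c : E₂) :
      ((a, (b, c)) : E₀ × E₁ × E₂) = (a, 0) + (0, (b, 0)) + (0, (0, c)) := by
    ext <;> simp
  refine h1.trans ?_
  refine Eq.trans ?_ (h3 _ _ _)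
  exact Prod.ext rfl h2

theorem extend_zero {E : Type*} [NormedAddCommGroup E] [NormedSpace ℝ E]
    {H : Type*} [TopologicalSpace H] {I : ModelWithCorners ℝ E H}
    {M : Type*} [TopologicalSpace M] [ChartedSpace H M] [IsManifold I ∞ M] {y q : M}
    (hq : q ∈ (chartAt H y).source) :
    extend E (0 : TangentSpace I y) q = 0 := by
  rw [extend_eq _ hq, map_zero, map_zero]

variable {p} in
theorem extend_inc₀ {q : M₀ × M₁ × M₂}
    (hq : q ∈ (chartAt (ModelProd E₀ (ModelProd E₁ E₂)) p).source)
    (v : TangentSpace 𝓘(ℝ, E₀) p.1) :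
    extend (E₀ × E₁ × E₂) (inc₀ E₀ E₁ E₂ p v) q = inc₀ E₀ E₁ E₂ q (extend E₀ v q.1) := by
  rw [extend_eq_inc hq, pr₀_inc₀, pr₁_inc₀, pr₂_inc₀]
  simp at hq
  rw [extend_zero hq.2.1, extend_zero hq.2.2]
  simp

variable {p} in
theorem extend_inc₁ {q : M₀ × M₁ × M₂}
    (hq : q ∈ (chartAt (ModelProd E₀ (ModelProd E₁ E₂)) p).source)
    (v : TangentSpace 𝓘(ℝ, E₁) p.2.1) :
    extend (E₀ × E₁ × E₂) (inc₁ E₀ E₁ E₂ p v) q = inc₁ E₀ E₁ E₂ q (extend E₁ v q.2.1) := by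
  rw [extend_eq_inc hq, pr₀_inc₁, pr₁_inc₁, pr₂_inc₁]
  simp at hq
  rw [extend_zero hq.1, extend_zero hq.2.2]
  simp

variable {p} in
theorem extend_inc₂ {q : M₀ × M₁ × M₂}
    (hq : q ∈ (chartAt (ModelProd E₀ (ModelProd E₁ E₂)) p).source)
    (v : TangentSpace 𝓘(ℝ, E₂) p.2.2) :
    extend (E₀ × E₁ × E₂) (inc₂ E₀ E₁ E₂ p v) q = inc₂ E₀ E₁ E₂ q (extend E₂ v q.2.2) := by
  rw [extend_eq_inc hq, pr₀_inc₂, pr₁_inc₂, pr₂_inc₂]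
  simp at hq
  rw [extend_zero hq.1, extend_zero hq.2.1]
  simp

end Extend

variable [RiemannianBundle (fun x : M₀ => TangentSpace 𝓘(ℝ, E₀) x)]
  [RiemannianBundle (fun x : M₁ => TangentSpace 𝓘(ℝ, E₁) x)]
  [RiemannianBundle (fun x : M₂ => TangentSpace 𝓘(ℝ, E₂) x)]
  [RiemannianBundle (fun p : M₀ × M₁ × M₂ => TangentSpace (prodModel E₀ E₁ E₂) p)]
  {f₁ f₂ : M₀ → ℝ}

theorem IsBiWarpedProductMetric.inner_eq (h : IsBiWarpedProductMetric E₀ E₁ E₂ M₁ M₂ f₁ f₂)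
    (u v : TangentSpace (prodModel E₀ E₁ E₂) p) :
    inner ℝ u v = inner ℝ (pr₀ E₀ E₁ E₂ p u) (pr₀ E₀ E₁ E₂ p v)
      + f₁ p.1 ^ 2 * inner ℝ (pr₁ E₀ E₁ E₂ p u) (pr₁ E₀ E₁ E₂ p v)
      + f₂ p.1 ^ 2 * inner ℝ (pr₂ E₀ E₁ E₂ p u) (pr₂ E₀ E₁ E₂ p v) := by
  rw [h p u v, (hasMFDerivAt_proj₀ p).mfderiv, (hasMFDerivAt_proj₁ p).mfderiv,
    (hasMFDerivAt_proj₂ p).mfderiv]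

end Product

/-! ### Koszul's formula for the bi-warped product metric. -/

section Koszul

/-- The derivative of the warping factor is written with ln f; this is where the gradients of ln f₁
and ln f₂ in the theorem originate. -/
theorem mvfderiv_sq_eq {E : Type*} [NormedAddCommGroup E] [NormedSpace ℝ E]
    {H : Type*} [TopologicalSpace H] {I : ModelWithCorners ℝ E H}
    {M : Type*} [TopologicalSpace M] [ChartedSpace H M] {f : M → ℝ} {x : M}
    (hf : MDifferentiableAt I 𝓘(ℝ, ℝ) f x) (hpos : 0 < f x) (u : TangentSpace I x) :
    mvfderiv I (fun y => f y ^ 2) x u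
      = f x ^ 2 * (2 * mvfderiv I (fun y => Real.log (f y)) x u) := by
  have h1 : mvfderiv I (fun y => f y ^ 2) x u = 2 * f x * mvfderiv I f x u := by
    have : (fun y => f y ^ 2) = fun y => f y * f y := by ext; ring
    rw [this, mvfderiv_fun_mul hf hf]
    simp only [add_apply, smul_apply, smul_eq_mul]
    ring
  have h2 : HasMFDerivAt I 𝓘(ℝ, ℝ) (fun y => Real.log (f y)) x
      ((f x)⁻¹ • mvfderiv I f x) :=
    ((Real.hasDerivAt_log hpos.ne').hasFDerivAt.hasMFDerivAt.comp x hf.hasMFDerivAt).congr_mfderiv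
      (by
        ext v
        exact mul_comm (mvfderiv I f x v) (f x)⁻¹)
  rw [h1, mvfderiv_eq_of_hasMFDerivAt h2]
  simp only [smul_apply, smul_eq_mul]
  field_simp

variable {E₀ : Type*} [NormedAddCommGroup E₀] [NormedSpace ℝ E₀] [FiniteDimensional ℝ E₀]
  {E₁ : Type*} [NormedAddCommGroup E₁] [NormedSpace ℝ E₁] [FiniteDimensional ℝ E₁]
  {E₂ : Type*} [NormedAddCommGroup E₂] [NormedSpace ℝ E₂] [FiniteDimensional ℝ E₂]
  {M₀ : Type*} [TopologicalSpace M₀] [ChartedSpace E₀ M₀] [IsManifold 𝓘(ℝ, E₀) ∞ M₀]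
  {M₁ : Type*} [TopologicalSpace M₁] [ChartedSpace E₁ M₁] [IsManifold 𝓘(ℝ, E₁) ∞ M₁]
  {M₂ : Type*} [TopologicalSpace M₂] [ChartedSpace E₂ M₂] [IsManifold 𝓘(ℝ, E₂) ∞ M₂]
  [RiemannianBundle (fun x : M₀ => TangentSpace 𝓘(ℝ, E₀) x)]
  [IsContMDiffRiemannianBundle 𝓘(ℝ, E₀) ∞ E₀ (fun x : M₀ => TangentSpace 𝓘(ℝ, E₀) x)]
  [RiemannianBundle (fun x : M₁ => TangentSpace 𝓘(ℝ, E₁) x)]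
  [IsContMDiffRiemannianBundle 𝓘(ℝ, E₁) ∞ E₁ (fun x : M₁ => TangentSpace 𝓘(ℝ, E₁) x)]
  [RiemannianBundle (fun x : M₂ => TangentSpace 𝓘(ℝ, E₂) x)]
  [IsContMDiffRiemannianBundle 𝓘(ℝ, E₂) ∞ E₂ (fun x : M₂ => TangentSpace 𝓘(ℝ, E₂) x)]
  [RiemannianBundle (fun p : M₀ × M₁ × M₂ => TangentSpace (prodModel E₀ E₁ E₂) p)]
  {f₁ f₂ : M₀ → ℝ}

section Coeff

variable {E : Type*} [NormedAddCommGroup E] [NormedSpace ℝ E] [FiniteDimensional ℝ E]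
  {H : Type*} [TopologicalSpace H] {I : ModelWithCorners ℝ E H}
  {M : Type*} [TopologicalSpace M] [ChartedSpace H M] [IsManifold I ∞ M]
  [RiemannianBundle (fun x : M => TangentSpace I x)]

variable (I) in
/-- The derivative at `y` of the inner product of two fields which are constant in the chart. -/
def extendDeriv (y : M) (u v w : TangentSpace I y) : ℝ :=
  mvfderiv I (fun q : M => inner ℝ (extend E v q) (extend E w q)) y u

@[simp] theorem extendDeriv_zero_left (y : M) (v w : TangentSpace I y) :
    extendDeriv I y 0 v w = 0 := by
  simp [extendDeriv]

variable [IsContMDiffRiemannianBundle I ∞ E (fun x : M => TangentSpace I x)]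

@[simp] theorem extendDeriv_zero_mid (y : M) (u w : TangentSpace I y) :
    extendDeriv I y u 0 w = 0 := by
  rw [extendDeriv, mvfderiv_inner_extend, map_zero]
  simpa using metricDeriv_smul_left y u 0 0 (triv I y y w)

@[simp] theorem extendDeriv_zero_right (y : M) (u v : TangentSpace I y) :
    extendDeriv I y u v 0 = 0 := by
  rw [extendDeriv, mvfderiv_inner_extend, map_zero, metricDeriv_comm]
  simpa using metricDeriv_smul_left y u 0 0 (triv I y y v)

theorem mdifferentiableAt_inner_extend (y : M) (v w : TangentSpace I y) :
    MDifferentiableAt I 𝓘(ℝ, ℝ) (fun q : M => inner ℝ (extend E v q) (extend E w q)) y :=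
  mdifferentiableAt_inner (φ := fun q : M => q)
    (mdifferentiableAt_extend I E (V := fun x : M => TangentSpace I x) v)
    (mdifferentiableAt_extend I E (V := fun x : M => TangentSpace I x) w)

end Coeff

/-- For chart-constant fields each summand of the metric is a product of functions of separate
factors, and the warping functions see only the component of u in the first factor. All formulas for
`hess` below result from setting components equal to zero here. -/
theorem IsBiWarpedProductMetric.extendDeriv_eq
    (h : IsBiWarpedProductMetric E₀ E₁ E₂ M₁ M₂ f₁ f₂)
    (hf₁ : ContMDiff 𝓘(ℝ, E₀) 𝓘(ℝ, ℝ) ∞ f₁) (hf₂ : ContMDiff 𝓘(ℝ, E₀) 𝓘(ℝ, ℝ) ∞ f₂)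
    (hf₁_pos : ∀ x, 0 < f₁ x) (hf₂_pos : ∀ x, 0 < f₂ x)
    (p : M₀ × M₁ × M₂) (u v w : TangentSpace (prodModel E₀ E₁ E₂) p) :
    extendDeriv (prodModel E₀ E₁ E₂) p u v w
      = extendDeriv 𝓘(ℝ, E₀) p.1 (pr₀ E₀ E₁ E₂ p u) (pr₀ E₀ E₁ E₂ p v) (pr₀ E₀ E₁ E₂ p w)
        + (f₁ p.1 ^ 2 * (2 * mvfderiv 𝓘(ℝ, E₀) (fun x => Real.log (f₁ x)) p.1
              (pr₀ E₀ E₁ E₂ p u)) * inner ℝ (pr₁ E₀ E₁ E₂ p v) (pr₁ E₀ E₁ E₂ p w)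
          + f₁ p.1 ^ 2 * extendDeriv 𝓘(ℝ, E₁) p.2.1 (pr₁ E₀ E₁ E₂ p u) (pr₁ E₀ E₁ E₂ p v)
              (pr₁ E₀ E₁ E₂ p w))
        + (f₂ p.1 ^ 2 * (2 * mvfderiv 𝓘(ℝ, E₀) (fun x => Real.log (f₂ x)) p.1
              (pr₀ E₀ E₁ E₂ p u)) * inner ℝ (pr₂ E₀ E₁ E₂ p v) (pr₂ E₀ E₁ E₂ p w)
          + f₂ p.1 ^ 2 * extendDeriv 𝓘(ℝ, E₂) p.2.2 (pr₂ E₀ E₁ E₂ p u) (pr₂ E₀ E₁ E₂ p v)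
              (pr₂ E₀ E₁ E₂ p w)) := by
  set G₀ : M₀ → ℝ := fun x => inner ℝ (extend E₀ (pr₀ E₀ E₁ E₂ p v) x)
    (extend E₀ (pr₀ E₀ E₁ E₂ p w) x) with hG₀
  set G₁ : M₁ → ℝ := fun x => inner ℝ (extend E₁ (pr₁ E₀ E₁ E₂ p v) x)
    (extend E₁ (pr₁ E₀ E₁ E₂ p w) x) with hG₁
  set G₂ : M₂ → ℝ := fun x => inner ℝ (extend E₂ (pr₂ E₀ E₁ E₂ p v) x)
    (extend E₂ (pr₂ E₀ E₁ E₂ p w) x) with hG₂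
  have key : (fun q : M₀ × M₁ × M₂ => inner ℝ (extend (E₀ × E₁ × E₂) v q)
      (extend (E₀ × E₁ × E₂) w q)) =ᶠ[𝓝 p] fun q => G₀ q.1 + f₁ q.1 ^ 2 * G₁ q.2.1
        + f₂ q.1 ^ 2 * G₂ q.2.2 := by
    filter_upwards [chart_source_mem_nhds_self (ModelProd E₀ (ModelProd E₁ E₂)) p] with q hq
    rw [h.inner_eq, extend_eq_inc hq, extend_eq_inc hq]
    simp [hG₀, hG₁, hG₂]
  have d₀ : MDifferentiableAt 𝓘(ℝ, E₀) 𝓘(ℝ, ℝ) G₀ p.1 := mdifferentiableAt_inner_extend _ _ _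
  have d₁ : MDifferentiableAt 𝓘(ℝ, E₁) 𝓘(ℝ, ℝ) G₁ p.2.1 := mdifferentiableAt_inner_extend _ _ _
  have d₂ : MDifferentiableAt 𝓘(ℝ, E₂) 𝓘(ℝ, ℝ) G₂ p.2.2 := mdifferentiableAt_inner_extend _ _ _
  have a₁ : MDifferentiableAt 𝓘(ℝ, E₀) 𝓘(ℝ, ℝ) f₁ p.1 := (hf₁ _).mdifferentiableAt (by simp)
  have a₂ : MDifferentiableAt 𝓘(ℝ, E₀) 𝓘(ℝ, ℝ) f₂ p.1 := (hf₂ _).mdifferentiableAt (by simp)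
  have b₁ : MDifferentiableAt 𝓘(ℝ, E₀) 𝓘(ℝ, ℝ) (fun x => f₁ x ^ 2) p.1 := a₁.pow 2
  have b₂ : MDifferentiableAt 𝓘(ℝ, E₀) 𝓘(ℝ, ℝ) (fun x => f₂ x ^ 2) p.1 := a₂.pow 2
  have c₀ := hasMFDerivAt_proj₀ (E₀ := E₀) (E₁ := E₁) (E₂ := E₂) p
  have c₁ := hasMFDerivAt_proj₁ (E₀ := E₀) (E₁ := E₁) (E₂ := E₂) p
  have c₂ := hasMFDerivAt_proj₂ (E₀ := E₀) (E₁ := E₁) (E₂ := E₂) p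
  have e₀ : MDifferentiableAt (prodModel E₀ E₁ E₂) 𝓘(ℝ, ℝ)
    (fun q : M₀ × M₁ × M₂ => G₀ q.1) p := d₀.comp p c₀.mdifferentiableAt
  have e₁ : MDifferentiableAt (prodModel E₀ E₁ E₂) 𝓘(ℝ, ℝ)
    (fun q : M₀ × M₁ × M₂ => G₁ q.2.1) p := d₁.comp p c₁.mdifferentiableAt
  have e₂ : MDifferentiableAt (prodModel E₀ E₁ E₂) 𝓘(ℝ, ℝ)
    (fun q : M₀ × M₁ × M₂ => G₂ q.2.2) p := d₂.comp p c₂.mdifferentiableAt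
  have g₁ : MDifferentiableAt (prodModel E₀ E₁ E₂) 𝓘(ℝ, ℝ)
    (fun q : M₀ × M₁ × M₂ => f₁ q.1 ^ 2) p := b₁.comp p c₀.mdifferentiableAt
  have g₂ : MDifferentiableAt (prodModel E₀ E₁ E₂) 𝓘(ℝ, ℝ)
    (fun q : M₀ × M₁ × M₂ => f₂ q.1 ^ 2) p := b₂.comp p c₀.mdifferentiableAt
  have s₁ : MDifferentiableAt (prodModel E₀ E₁ E₂) 𝓘(ℝ, ℝ)
    (fun q : M₀ × M₁ × M₂ => f₁ q.1 ^ 2 * G₁ q.2.1) p := g₁.mul e₁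
  have s₂ : MDifferentiableAt (prodModel E₀ E₁ E₂) 𝓘(ℝ, ℝ)
    (fun q : M₀ × M₁ × M₂ => f₂ q.1 ^ 2 * G₂ q.2.2) p := g₂.mul e₂
  have s₃ : MDifferentiableAt (prodModel E₀ E₁ E₂) 𝓘(ℝ, ℝ)
    (fun q : M₀ × M₁ × M₂ => G₀ q.1 + f₁ q.1 ^ 2 * G₁ q.2.1) p := e₀.add s₁
  have t₀ := mvfderiv_comp_of_mdifferentiableAt (f := fun q : M₀ × M₁ × M₂ => q.1) rfl d₀
    c₀.mdifferentiableAt u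
  have t₁ := mvfderiv_comp_of_mdifferentiableAt (f := fun q : M₀ × M₁ × M₂ => q.2.1) rfl d₁
    c₁.mdifferentiableAt u
  have t₂ := mvfderiv_comp_of_mdifferentiableAt (f := fun q : M₀ × M₁ × M₂ => q.2.2) rfl d₂
    c₂.mdifferentiableAt u
  have r₁ := mvfderiv_comp_of_mdifferentiableAt (f := fun q : M₀ × M₁ × M₂ => q.1) rfl b₁
    c₀.mdifferentiableAt u
  have r₂ := mvfderiv_comp_of_mdifferentiableAt (f := fun q : M₀ × M₁ × M₂ => q.1) rfl b₂
    c₀.mdifferentiableAt u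
  rw [c₀.mfderiv] at t₀ r₁ r₂
  rw [c₁.mfderiv] at t₁
  rw [c₂.mfderiv] at t₂
  rw [mvfderiv_sq_eq a₁ (hf₁_pos _)] at r₁
  rw [mvfderiv_sq_eq a₂ (hf₂_pos _)] at r₂
  have v₁ : G₁ p.2.1 = inner ℝ (pr₁ E₀ E₁ E₂ p v) (pr₁ E₀ E₁ E₂ p w) := by
    simp only [hG₁, extend_apply_self]
  have v₂ : G₂ p.2.2 = inner ℝ (pr₂ E₀ E₁ E₂ p v) (pr₂ E₀ E₁ E₂ p w) := by
    simp only [hG₂, extend_apply_self]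
  rw [extendDeriv, mvfderiv_congr key, mvfderiv_fun_add s₃ s₂, mvfderiv_fun_add e₀ s₁,
    mvfderiv_fun_mul g₁ e₁, mvfderiv_fun_mul g₂ e₂]
  simp only [add_apply, smul_apply, smul_eq_mul]
  rw [t₀, t₁, t₂, r₁, r₂, v₁, v₂]
  simp only [extendDeriv]
  ring

variable {E : Type*} [NormedAddCommGroup E] [NormedSpace ℝ E] [FiniteDimensional ℝ E]
  {H : Type*} [TopologicalSpace H] {I : ModelWithCorners ℝ E H}
  {M : Type*} [TopologicalSpace M] [ChartedSpace H M] [IsManifold I ∞ M]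
  [RiemannianBundle (fun x : M => TangentSpace I x)]
  [IsContMDiffRiemannianBundle I ∞ E (fun x : M => TangentSpace I x)]

/-- Koszul's formula for the second covariant derivative of an isometric immersion. -/
theorem IsIsometricImmersion.inner_hess {E' : Type*} [NormedAddCommGroup E'] [NormedSpace ℝ E']
    [FiniteDimensional ℝ E'] {H' : Type*} [TopologicalSpace H'] {I' : ModelWithCorners ℝ E' H'}
    [I'.Boundaryless] {N : Type*} [TopologicalSpace N] [ChartedSpace H' N] [IsManifold I' ∞ N]
    [RiemannianBundle (fun x : N => TangentSpace I' x)] {φ : N → M}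
    (hφ : IsIsometricImmersion I I' φ) (p : N) (u v w : TangentSpace I' p) :
    inner ℝ (hess I I' φ p u v) (mfderiv I' I φ p w)
      = (1 / 2 : ℝ) * (extendDeriv I' p u v w + extendDeriv I' p v u w
        - extendDeriv I' p w u v) := by
  have key (u v w : TangentSpace I' p) : extendDeriv I' p u v w
      = inner ℝ (hess I I' φ p u v) (mfderiv I' I φ p w)
        + inner ℝ (hess I I' φ p u w) (mfderiv I' I φ p v) := by
    have h := mvfderiv_inner_mfderiv hφ.1 u v w
    simp_rw [hφ.2] at h
    rw [extendDeriv, h, real_inner_comm (mfderiv I' I φ p v)]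
  -- By symmetry of `hess` all terms of the alternating sum cancel except two copies of the
  -- left-hand side.
  rw [key, key, key, hess_comm hφ.1 v u, hess_comm hφ.1 w u, hess_comm hφ.1 w v]
  ring

section Hess

variable {φ : M₀ × M₁ × M₂ → M} (hφ : IsIsometricImmersion I (prodModel E₀ E₁ E₂) φ)
    (h : IsBiWarpedProductMetric E₀ E₁ E₂ M₁ M₂ f₁ f₂)
    (hf₁ : ContMDiff 𝓘(ℝ, E₀) 𝓘(ℝ, ℝ) ∞ f₁) (hf₂ : ContMDiff 𝓘(ℝ, E₀) 𝓘(ℝ, ℝ) ∞ f₂)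
    (hf₁_pos : ∀ x, 0 < f₁ x) (hf₂_pos : ∀ x, 0 < f₂ x) (p : M₀ × M₁ × M₂)
include hφ h hf₁ hf₂ hf₁_pos hf₂_pos

/-- The classical ∇_X Z = (X ln f₁) Z. The test vector w is arbitrary, so the whole tangential part
is determined. -/
theorem inner_hess_zero_one (X : TangentSpace 𝓘(ℝ, E₀) p.1) (Z : TangentSpace 𝓘(ℝ, E₁) p.2.1)
    (w : TangentSpace (prodModel E₀ E₁ E₂) p) :
    inner ℝ (hess I (prodModel E₀ E₁ E₂) φ p (inc₀ E₀ E₁ E₂ p X) (inc₁ E₀ E₁ E₂ p Z))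
        (mfderiv (prodModel E₀ E₁ E₂) I φ p w)
      = mvfderiv 𝓘(ℝ, E₀) (fun x => Real.log (f₁ x)) p.1 X
        * inner ℝ (inc₁ E₀ E₁ E₂ p Z) w := by
  rw [hφ.inner_hess, h.extendDeriv_eq hf₁ hf₂ hf₁_pos hf₂_pos,
    h.extendDeriv_eq hf₁ hf₂ hf₁_pos hf₂_pos, h.extendDeriv_eq hf₁ hf₂ hf₁_pos hf₂_pos, h.inner_eq]
  simp
  ring

theorem inner_hess_zero_two (X : TangentSpace 𝓘(ℝ, E₀) p.1) (Z : TangentSpace 𝓘(ℝ, E₂) p.2.2)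
    (w : TangentSpace (prodModel E₀ E₁ E₂) p) :
    inner ℝ (hess I (prodModel E₀ E₁ E₂) φ p (inc₀ E₀ E₁ E₂ p X) (inc₂ E₀ E₁ E₂ p Z))
        (mfderiv (prodModel E₀ E₁ E₂) I φ p w)
      = mvfderiv 𝓘(ℝ, E₀) (fun x => Real.log (f₂ x)) p.1 X
        * inner ℝ (inc₂ E₀ E₁ E₂ p Z) w := by
  rw [hφ.inner_hess, h.extendDeriv_eq hf₁ hf₂ hf₁_pos hf₂_pos,
    h.extendDeriv_eq hf₁ hf₂ hf₁_pos hf₂_pos, h.extendDeriv_eq hf₁ hf₂ hf₁_pos hf₂_pos, h.inner_eq]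
  simp
  ring

/-- The component -g(Z, W)∇ ln f₁ of ∇_Z W; it becomes the mean curvature vector of the leaves in
the equality case. -/
theorem inner_hess_one_one_zero (X : TangentSpace 𝓘(ℝ, E₀) p.1)
    (Z W : TangentSpace 𝓘(ℝ, E₁) p.2.1) :
    inner ℝ (hess I (prodModel E₀ E₁ E₂) φ p (inc₁ E₀ E₁ E₂ p Z) (inc₁ E₀ E₁ E₂ p W))
        (mfderiv (prodModel E₀ E₁ E₂) I φ p (inc₀ E₀ E₁ E₂ p X))
      = -mvfderiv 𝓘(ℝ, E₀) (fun x => Real.log (f₁ x)) p.1 X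
        * inner ℝ (inc₁ E₀ E₁ E₂ p Z) (inc₁ E₀ E₁ E₂ p W) := by
  rw [hφ.inner_hess, h.extendDeriv_eq hf₁ hf₂ hf₁_pos hf₂_pos,
    h.extendDeriv_eq hf₁ hf₂ hf₁_pos hf₂_pos, h.extendDeriv_eq hf₁ hf₂ hf₁_pos hf₂_pos, h.inner_eq]
  simp
  ring

theorem inner_hess_one_one_two (U : TangentSpace 𝓘(ℝ, E₂) p.2.2)
    (Z W : TangentSpace 𝓘(ℝ, E₁) p.2.1) :
    inner ℝ (hess I (prodModel E₀ E₁ E₂) φ p (inc₁ E₀ E₁ E₂ p Z) (inc₁ E₀ E₁ E₂ p W))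
        (mfderiv (prodModel E₀ E₁ E₂) I φ p (inc₂ E₀ E₁ E₂ p U)) = 0 := by
  rw [hφ.inner_hess, h.extendDeriv_eq hf₁ hf₂ hf₁_pos hf₂_pos,
    h.extendDeriv_eq hf₁ hf₂ hf₁_pos hf₂_pos, h.extendDeriv_eq hf₁ hf₂ hf₁_pos hf₂_pos]
  simp

theorem inner_hess_two_two_zero (X : TangentSpace 𝓘(ℝ, E₀) p.1)
    (U V : TangentSpace 𝓘(ℝ, E₂) p.2.2) :
    inner ℝ (hess I (prodModel E₀ E₁ E₂) φ p (inc₂ E₀ E₁ E₂ p U) (inc₂ E₀ E₁ E₂ p V))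
        (mfderiv (prodModel E₀ E₁ E₂) I φ p (inc₀ E₀ E₁ E₂ p X))
      = -mvfderiv 𝓘(ℝ, E₀) (fun x => Real.log (f₂ x)) p.1 X
        * inner ℝ (inc₂ E₀ E₁ E₂ p U) (inc₂ E₀ E₁ E₂ p V) := by
  rw [hφ.inner_hess, h.extendDeriv_eq hf₁ hf₂ hf₁_pos hf₂_pos,
    h.extendDeriv_eq hf₁ hf₂ hf₁_pos hf₂_pos, h.extendDeriv_eq hf₁ hf₂ hf₁_pos hf₂_pos, h.inner_eq]
  simp
  ring

theorem inner_hess_two_two_one (U V : TangentSpace 𝓘(ℝ, E₂) p.2.2)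
    (Z : TangentSpace 𝓘(ℝ, E₁) p.2.1) :
    inner ℝ (hess I (prodModel E₀ E₁ E₂) φ p (inc₂ E₀ E₁ E₂ p U) (inc₂ E₀ E₁ E₂ p V))
        (mfderiv (prodModel E₀ E₁ E₂) I φ p (inc₁ E₀ E₁ E₂ p Z)) = 0 := by
  rw [hφ.inner_hess, h.extendDeriv_eq hf₁ hf₂ hf₁_pos hf₂_pos,
    h.extendDeriv_eq hf₁ hf₂ hf₁_pos hf₂_pos, h.extendDeriv_eq hf₁ hf₂ hf₁_pos hf₂_pos]
  simp

theorem inner_hess_zero_zero_one (X Y : TangentSpace 𝓘(ℝ, E₀) p.1)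
    (Z : TangentSpace 𝓘(ℝ, E₁) p.2.1) :
    inner ℝ (hess I (prodModel E₀ E₁ E₂) φ p (inc₀ E₀ E₁ E₂ p X) (inc₀ E₀ E₁ E₂ p Y))
        (mfderiv (prodModel E₀ E₁ E₂) I φ p (inc₁ E₀ E₁ E₂ p Z)) = 0 := by
  rw [hφ.inner_hess, h.extendDeriv_eq hf₁ hf₂ hf₁_pos hf₂_pos,
    h.extendDeriv_eq hf₁ hf₂ hf₁_pos hf₂_pos, h.extendDeriv_eq hf₁ hf₂ hf₁_pos hf₂_pos]
  simp

theorem inner_hess_zero_zero_two (X Y : TangentSpace 𝓘(ℝ, E₀) p.1)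
    (U : TangentSpace 𝓘(ℝ, E₂) p.2.2) :
    inner ℝ (hess I (prodModel E₀ E₁ E₂) φ p (inc₀ E₀ E₁ E₂ p X) (inc₀ E₀ E₁ E₂ p Y))
        (mfderiv (prodModel E₀ E₁ E₂) I φ p (inc₂ E₀ E₁ E₂ p U)) = 0 := by
  rw [hφ.inner_hess, h.extendDeriv_eq hf₁ hf₂ hf₁_pos hf₂_pos,
    h.extendDeriv_eq hf₁ hf₂ hf₁_pos hf₂_pos, h.extendDeriv_eq hf₁ hf₂ hf₁_pos hf₂_pos]
  simp

end Hess

end Koszul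

/-! ### Inequalities and identities of Euclidean linear algebra. -/

section LinearAlgebra

variable {V W : Type*} [NormedAddCommGroup V] [InnerProductSpace ℝ V]
  [NormedAddCommGroup W] [InnerProductSpace ℝ W] {ι : Type*} [Fintype ι]

/-- Parseval for the range of a map that scales inner products by c. The factor c is the squared
warping function when A is dφ on the third factor. -/
theorem sum_inner_sq_eq_norm_starProjection_sq (A : V →ₗ[ℝ] W) {c : ℝ}
    (hA : ∀ a b, inner ℝ (A a) (A b) = c * inner ℝ a b) (b : OrthonormalBasis ι ℝ V) (w : W)
    [(LinearMap.range A).HasOrthogonalProjection] :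
    ∑ l, inner ℝ w (A (b l)) ^ 2 = c * ‖(LinearMap.range A).starProjection w‖ ^ 2 := by
  obtain ⟨a, ha⟩ := Submodule.starProjection_apply_mem (LinearMap.range A) w
  have h1 (l) : inner ℝ w (A (b l)) = c * inner ℝ a (b l) := by
    rw [← hA, ha]
    have := Submodule.starProjection_inner_eq_zero (K := LinearMap.range A) w (A (b l)) ⟨_, rfl⟩
    rw [inner_sub_left] at this
    linarith
  have h2 := b.sum_sq_norm_inner_left a
  simp only [Real.norm_eq_abs, sq_abs] at h2
  rw [← ha, ← real_inner_self_eq_norm_sq, hA, real_inner_self_eq_norm_sq]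
  simp only [h1, mul_pow, ← Finset.mul_sum, h2]
  ring

/-- A Bessel inequality for vectors that need not be orthogonal. Since ξ is orthogonal to the range
of A, only the part of B normal to that range contributes, and this part scales norms by s relative
to A. In the application B = J ∘ A and s = sin θ. -/
theorem sum_inner_sq_le (A B : V →ₗ[ℝ] W) {c s : ℝ} (hc : 0 ≤ c)
    (hA : ∀ a b, inner ℝ (A a) (A b) = c * inner ℝ a b) (b : OrthonormalBasis ι ℝ V)
    [(LinearMap.range A).HasOrthogonalProjection]
    (hB : ∀ a, ‖B a - (LinearMap.range A).starProjection (B a)‖ ^ 2 = s ^ 2 * ‖A a‖ ^ 2)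
    (ξ : W) (hξ : ∀ a, inner ℝ ξ (A a) = 0) :
    ∑ l, inner ℝ ξ (B (b l)) ^ 2 ≤ c * s ^ 2 * ‖ξ‖ ^ 2 := by
  set t := ∑ l, inner ℝ ξ (B (b l)) ^ 2 with ht
  -- The vector dual to a ↦ ⟨ξ, B a⟩: both ‖y‖² and ⟨ξ, B y⟩ equal t, so Cauchy–Schwarz at y bounds
  -- t² by a multiple of t.
  set y : V := ∑ l, inner ℝ ξ (B (b l)) • b l with hy
  have ht0 : 0 ≤ t := Finset.sum_nonneg fun _ _ => sq_nonneg _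
  have hy2 : ‖y‖ ^ 2 = t := by
    have := b.sum_sq_norm_inner_right y
    rw [← this]
    refine Finset.sum_congr rfl fun l _ => ?_
    rw [hy, Real.norm_eq_abs, sq_abs, b.orthonormal.inner_right_fintype]
  have h1 : inner ℝ ξ (B y) = t := by
    rw [hy, map_sum, inner_sum]
    refine Finset.sum_congr rfl fun l _ => ?_
    rw [map_smul, inner_smul_right, sq]
  obtain ⟨a, ha⟩ := Submodule.starProjection_apply_mem (LinearMap.range A) (B y)
  have h2 : t = inner ℝ ξ (B y - (LinearMap.range A).starProjection (B y)) := by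
    rw [inner_sub_right, h1, ← ha, hξ, sub_zero]
  have h3 : t ^ 2 ≤ ‖ξ‖ ^ 2 * (s ^ 2 * (c * t)) := by
    have h4 := abs_real_inner_le_norm ξ (B y - (LinearMap.range A).starProjection (B y))
    rw [← h2, abs_of_nonneg ht0] at h4
    calc t ^ 2 ≤ (‖ξ‖ * ‖B y - (LinearMap.range A).starProjection (B y)‖) ^ 2 :=
          pow_le_pow_left₀ ht0 h4 2
      _ = _ := by
          rw [mul_pow, hB, ← real_inner_self_eq_norm_sq (A y), hA, real_inner_self_eq_norm_sq, hy2]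
  rcases ht0.eq_or_lt with h0 | h0
  · rw [← h0]; positivity
  · nlinarith

/-- The second sum condition says that R = F' - 2aF is orthogonal to F. So -F'/3 + aF = (a/3)F - R/3
has squared norm at least a²T/9, and, its diagonal being zero, it does not interact with the
diagonal term. -/
theorem le_sum_sq [DecidableEq ι] (F F' : ι → ι → ℝ) {a b κ T : ℝ} (hF : ∀ k, F k k = 0)
    (hF' : ∀ k, F' k k = 0) (hT : ∑ k, ∑ l, F k l ^ 2 = T)
    (hT' : ∑ k, ∑ l, F k l * F' k l = 2 * a * T) :
    a ^ 2 * T / 9 + Fintype.card ι * (b * κ) ^ 2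
      ≤ ∑ k, ∑ l, (-(1 / 3) * F' k l + a * F k l - b * (if k = l then κ else 0)) ^ 2 := by
  -- Entrywise estimate obtained by discarding R²/9. The cross term F·R is kept because it
  -- disappears only after summation.
  have h1 : ∀ k l, a ^ 2 / 9 * F k l ^ 2 - 2 * a / 9 * (F k l * F' k l - 2 * a * F k l ^ 2)
      + (if k = l then (b * κ) ^ 2 else 0)
      ≤ (-(1 / 3) * F' k l + a * F k l - b * (if k = l then κ else 0)) ^ 2 := by
    intro k l
    by_cases hkl : k = l
    · subst hkl
      simp only [hF, hF', if_true]
      ring_nf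
      exact le_refl _
    · simp only [hkl, if_false]
      nlinarith [sq_nonneg (F' k l - 2 * a * F k l)]
  refine le_trans (le_of_eq ?_) (Finset.sum_le_sum fun k _ => Finset.sum_le_sum fun l _ => h1 k l)
  simp only [Finset.sum_add_distrib, Finset.sum_sub_distrib, ← Finset.mul_sum, hT, hT']
  simp
  ring

theorem sum_norm_sq_apply_eq_trace [FiniteDimensional ℝ V] [FiniteDimensional ℝ W]
    (A : V →ₗ[ℝ] W) (b : OrthonormalBasis ι ℝ V) :
    ∑ i, ‖A (b i)‖ ^ 2 = LinearMap.trace ℝ V (LinearMap.adjoint A ∘ₗ A) := by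
  rw [LinearMap.trace_eq_sum_inner _ b]
  refine Finset.sum_congr rfl fun i _ => ?_
  rw [LinearMap.comp_apply, LinearMap.adjoint_inner_right, real_inner_self_eq_norm_sq]

/-- Hilbert–Schmidt norms do not depend on the basis: each slot separately gives the trace of A*A.
Hence ‖h‖² may be computed in a frame adapted to the three distributions. -/
theorem sum_sum_norm_sq_apply_eq {ι' : Type*} [Fintype ι'] [FiniteDimensional ℝ V]
    [FiniteDimensional ℝ W] (B : V →ₗ[ℝ] V →ₗ[ℝ] W)
    (b : OrthonormalBasis ι ℝ V) (b' : OrthonormalBasis ι' ℝ V) :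
    ∑ i, ∑ j, ‖B (b i) (b j)‖ ^ 2 = ∑ i, ∑ j, ‖B (b' i) (b' j)‖ ^ 2 := by
  have h1 : ∀ i, ∑ j, ‖B (b i) (b j)‖ ^ 2 = ∑ j, ‖B (b i) (b' j)‖ ^ 2 := fun i => by
    rw [sum_norm_sq_apply_eq_trace, sum_norm_sq_apply_eq_trace]
  have h2 : ∀ j, ∑ i, ‖B (b i) (b' j)‖ ^ 2 = ∑ i, ‖B (b' i) (b' j)‖ ^ 2 := fun j =>
    (sum_norm_sq_apply_eq_trace (B.flip (b' j)) b).trans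
      (sum_norm_sq_apply_eq_trace (B.flip (b' j)) b').symm
  rw [Finset.sum_congr rfl fun i _ => h1 i, Finset.sum_comm, Finset.sum_congr rfl fun j _ => h2 j,
    Finset.sum_comm]

end LinearAlgebra

/-! ### The second fundamental form and the pulled back Kaehler form. -/

section SecondFundamentalForm

variable {E : Type*} [NormedAddCommGroup E] [NormedSpace ℝ E] [FiniteDimensional ℝ E]
  {H : Type*} [TopologicalSpace H] {I : ModelWithCorners ℝ E H}
  {M : Type*} [TopologicalSpace M] [ChartedSpace H M] [IsManifold I ∞ M]
  [RiemannianBundle (fun x : M => TangentSpace I x)]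
  [IsContMDiffRiemannianBundle I ∞ E (fun x : M => TangentSpace I x)]
  {E' : Type*} [NormedAddCommGroup E'] [NormedSpace ℝ E'] [FiniteDimensional ℝ E']
  {H' : Type*} [TopologicalSpace H'] {I' : ModelWithCorners ℝ E' H'} [I'.Boundaryless]
  {N : Type*} [TopologicalSpace N] [ChartedSpace H' N] [IsManifold I' ∞ N]
  {φ : N → M} {p : N}

theorem secondFundamentalForm_eq_sub {u v t : TangentSpace I' p}
    (ht : ∀ w, inner ℝ (hess I I' φ p u v) (mfderiv I' I φ p w)
      = inner ℝ (mfderiv I' I φ p t) (mfderiv I' I φ p w)) :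
    secondFundamentalForm I I' φ p u v = hess I I' φ p u v - mfderiv I' I φ p t := by
  refine Submodule.eq_starProjection_of_mem_orthogonal ?_ ?_
  · rw [Submodule.mem_orthogonal']
    rintro _ ⟨w, rfl⟩
    change inner ℝ (_ - _) (mfderiv I' I φ p w) = 0
    rw [inner_sub_left, ht, sub_self]
  · change hess I I' φ p u v - _ ∈ _
    rw [sub_sub_cancel]
    exact Submodule.le_orthogonal_orthogonal _ ⟨t, rfl⟩

theorem inner_secondFundamentalForm_mfderiv (u v w : TangentSpace I' p) :
    inner ℝ (secondFundamentalForm I I' φ p u v) (mfderiv I' I φ p w) = 0 := by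
  have h : secondFundamentalForm I I' φ p u v ∈ (tangentImage I I' φ p)ᗮ :=
    Submodule.starProjection_apply_mem _ _
  rw [Submodule.mem_orthogonal'] at h
  exact h _ ⟨w, rfl⟩

theorem exists_secondFundamentalForm_eq (u v : TangentSpace I' p) :
    ∃ t, secondFundamentalForm I I' φ p u v = hess I I' φ p u v - mfderiv I' I φ p t := by
  obtain ⟨t, ht⟩ := Submodule.starProjection_apply_mem (tangentImage I I' φ p) (hess I I' φ p u v)
  refine ⟨t, secondFundamentalForm_eq_sub fun w => ?_⟩
  have := Submodule.starProjection_inner_eq_zero (K := tangentImage I I' φ p)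
    (hess I I' φ p u v) (mfderiv I' I φ p w) ⟨w, rfl⟩
  rw [← ht, inner_sub_left] at this
  exact sub_eq_zero.1 this

/-- The second fundamental form as a bilinear map. -/
def secondFundamentalFormₗ (hφ : ContMDiff I' I ∞ φ) (p : N) :
    TangentSpace I' p →ₗ[ℝ] TangentSpace I' p →ₗ[ℝ] TangentSpace I (φ p) :=
  (hessForm hφ p).compr₂ (tangentImage I I' φ p)ᗮ.starProjection.toLinearMap

theorem secondFundamentalFormₗ_apply (hφ : ContMDiff I' I ∞ φ) (u v : TangentSpace I' p) :
    secondFundamentalFormₗ hφ p u v = secondFundamentalForm I I' φ p u v := rfl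

theorem secondFundamentalForm_comm (hφ : ContMDiff I' I ∞ φ) (u v : TangentSpace I' p) :
    secondFundamentalForm I I' φ p u v = secondFundamentalForm I I' φ p v u :=
  congrArg (tangentImage I I' φ p)ᗮ.starProjection (hess_comm hφ u v)

/-- The pullback of the Kaehler form, evaluated at fields which are constant in the chart at
`p`. -/
def pullbackForm (K : NearlyKaehlerStructure I M) (φ : N → M) (p : N) (u v : TangentSpace I' p)
    (q : N) : ℝ :=
  inner ℝ (K.J (φ q) (mfderiv I' I φ q (extend E' u q))) (mfderiv I' I φ q (extend E' v q))

@[simp] theorem mvfderiv_pullbackForm_self (K : NearlyKaehlerStructure I M)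
    (u w : TangentSpace I' p) : mvfderiv I' (pullbackForm K φ p u u) p w = 0 := by
  have h : pullbackForm K φ p u u = fun _ => 0 := funext fun q => K.inner_J_self _ _
  rw [h, mvfderiv_const, zero_apply]

/-- The main identity. Differentiating ω(x,v) along u, ω(x,u) along v and ω(u,v) along x gives three
equations; by total skewness of ∇J they all contain the same number ⟨(∇_x J)u, v⟩ up to sign, which
is then eliminated. The forms ω(x,u), ω(x,v) must vanish near p, since their derivatives are used.
-/
theorem inner_hess_J (K : NearlyKaehlerStructure I M) (hφ : ContMDiff I' I ∞ φ)
    {x y u v : TangentSpace I' p}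
    (hy : K.J (φ p) (mfderiv I' I φ p x) = mfderiv I' I φ p y)
    (hu : pullbackForm K φ p x u =ᶠ[𝓝 p] fun _ => 0)
    (hv : pullbackForm K φ p x v =ᶠ[𝓝 p] fun _ => 0) :
    inner ℝ (hess I I' φ p x u) (K.J (φ p) (mfderiv I' I φ p v))
      = -(1 / 3) * mvfderiv I' (pullbackForm K φ p u v) p x
        + inner ℝ (hess I I' φ p u v) (mfderiv I' I φ p y) := by
  have key (a b c : TangentSpace I' p) : mvfderiv I' (pullbackForm K φ p b c) p a = _ :=
    K.mvfderiv_inner_J_mfderiv hφ p a b c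
  have h1 := key u x v
  have h2 := key v x u
  have h3 := key x u v
  rw [mvfderiv_congr hv, mvfderiv_const, hy, K.inner_J_left] at h1
  rw [mvfderiv_congr hu, mvfderiv_const, hy, K.inner_J_left, hess_comm hφ v u] at h2
  rw [K.inner_J_left] at h3
  rw [K.nablaEndo_swap, inner_neg_left] at h1 h2
  rw [K.inner_nablaEndo_swap _ _ (mfderiv I' I φ p v)] at h2
  rw [hess_comm hφ u x] at h1
  rw [hess_comm hφ v x] at h2
  rw [real_inner_comm (hess I I' φ p x v)] at h3
  rw [real_inner_comm (mfderiv I' I φ p y)]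
  simp only [zero_apply] at h1 h2
  -- With T = ⟨(∇_x J)u, v⟩, A = ⟨hess(x,u), Jv⟩, B = ⟨hess(x,v), Ju⟩ and C = ⟨hess(u,v), Jx⟩ the
  -- equations read A = C - T, B = C + T and x(ω(u,v)) = T - A + B = 3T. This is the source of the
  -- factor 1/3.
  linarith

end SecondFundamentalForm

/-! ### Gradients, orthonormal bases, composition of maps, and constancy of functions. -/

section Gradient

variable {E : Type*} [NormedAddCommGroup E] [NormedSpace ℝ E] [FiniteDimensional ℝ E]
  {H : Type*} [TopologicalSpace H] {I : ModelWithCorners ℝ E H}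
  {M : Type*} [TopologicalSpace M] [ChartedSpace H M]
  [RiemannianBundle (fun x : M => TangentSpace I x)]

theorem inner_riemannianGradient [IsManifold I ∞ M] (f : M → ℝ) (x : M) (v : TangentSpace I x) :
    inner ℝ (riemannianGradient I f x) v = mvfderiv I f x v := by
  conv_rhs => rw [← (stdOrthonormalBasis ℝ (TangentSpace I x)).sum_repr' v, map_sum]
  rw [riemannianGradient, sum_inner]
  refine Finset.sum_congr rfl fun i _ => ?_
  rw [real_inner_smul_left, map_smul, smul_eq_mul, mul_comm]

theorem norm_riemannianGradient_sq [IsManifold I ∞ M] (f : M → ℝ) (x : M) {ι : Type*} [Fintype ι]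
    (b : OrthonormalBasis ι ℝ (TangentSpace I x)) :
    ‖riemannianGradient I f x‖ ^ 2 = ∑ i, mvfderiv I f x (b i) ^ 2 := by
  rw [← b.sum_sq_norm_inner_left]
  simp only [Real.norm_eq_abs, sq_abs, inner_riemannianGradient]

end Gradient

theorem exists_orthonormalBasis_coe_eq {V : Type*} [NormedAddCommGroup V] [InnerProductSpace ℝ V]
    [FiniteDimensional ℝ V]
    {ι : Type*} [Fintype ι] {v : ι → V} (hv : Orthonormal ℝ v)
    (hcard : Fintype.card ι = finrank ℝ V) : ∃ b : OrthonormalBasis ι ℝ V, ⇑b = v :=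
  ⟨OrthonormalBasis.mk hv (hv.linearIndependent.span_eq_top_of_card_eq_finrank' hcard).ge,
    OrthonormalBasis.coe_mk _ _⟩

theorem eq_zero_of_sum_norm_sq_le_zero {V W ι : Type*} [AddCommGroup V] [Module ℝ V]
    [NormedAddCommGroup W] [NormedSpace ℝ W] [Fintype ι] (B : V →ₗ[ℝ] V →ₗ[ℝ] W)
    (b : Basis ι ℝ V) (hB : ∑ i, ∑ j, ‖B (b i) (b j)‖ ^ 2 ≤ 0) (x y : V) : B x y = 0 := by
  have h1 := (Finset.sum_eq_zero_iff_of_nonneg fun i _ => by positivity).1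
    (le_antisymm hB (by positivity))
  have h2 : B = 0 := by
    refine b.ext fun i => b.ext fun j => ?_
    have := (Finset.sum_eq_zero_iff_of_nonneg fun j _ => by positivity).1
      (h1 i (Finset.mem_univ i)) j (Finset.mem_univ j)
    simpa using this
  rw [h2]
  rfl

section Hessian

variable {E : Type*} [NormedAddCommGroup E] [NormedSpace ℝ E] [FiniteDimensional ℝ E]
  {H : Type*} [TopologicalSpace H] {I : ModelWithCorners ℝ E H}
  {M : Type*} [TopologicalSpace M] [ChartedSpace H M] [IsManifold I ∞ M]
  [RiemannianBundle (fun x : M => TangentSpace I x)]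
  [IsContMDiffRiemannianBundle I ∞ E (fun x : M => TangentSpace I x)]
  {E' : Type*} [NormedAddCommGroup E'] [NormedSpace ℝ E'] [FiniteDimensional ℝ E']
  {H' : Type*} [TopologicalSpace H'] {I' : ModelWithCorners ℝ E' H'} [I'.Boundaryless]
  {N : Type*} [TopologicalSpace N] [ChartedSpace H' N] [IsManifold I' ∞ N]
  {φ : N → M} {p : N}

theorem secondFundamentalForm_eq_of_hess_eq {u v t : TangentSpace I' p} {ξ : TangentSpace I (φ p)}
    (ht : hess I I' φ p u v = mfderiv I' I φ p t + ξ)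
    (hξ : ∀ w, inner ℝ ξ (mfderiv I' I φ p w) = 0) : secondFundamentalForm I I' φ p u v = ξ := by
  rw [secondFundamentalForm_eq_sub (t := t) fun w => by rw [ht, inner_add_left, hξ, add_zero], ht,
    add_sub_cancel_left]

/-- There is no correction term dφ(∇df), because f is assumed to carry the chart-constant field of v
to that of w. The inclusions of the leaves have this property. -/
theorem hess_comp {E'' : Type*} [NormedAddCommGroup E''] [NormedSpace ℝ E'']
    {H'' : Type*} [TopologicalSpace H''] {I'' : ModelWithCorners ℝ E'' H''}
    {N' : Type*} [TopologicalSpace N'] [ChartedSpace H'' N'] [IsManifold I'' ∞ N'] {f : N' → N}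
    {x : N'} (hφ : ContMDiff I' I ∞ φ) (hf : MDifferentiable I'' I' f) {u v : TangentSpace I'' x}
    {w : TangentSpace I' (f x)}
    (hv : ∀ᶠ y in 𝓝 x, mfderiv I'' I' f y (extend E'' v y) = extend E' w (f y)) :
    hess I I'' (fun y => φ (f y)) x u v = hess I I' φ (f x) (mfderiv I'' I' f x u) w := by
  have hφd : MDifferentiable I' I φ := hφ.mdifferentiable (by simp)
  have hd (y) : HasMFDerivAt I'' I (fun y => φ (f y)) y
      (mfderiv I' I φ (f y) ∘L mfderiv I'' I' f y) :=
    (hφd (f y)).hasMFDerivAt.comp y (hf y).hasMFDerivAt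
  unfold hess
  rw [covDerivAlong_eq (φ := fun y => φ (f y))
      (hφ.continuous.continuousAt.comp (hf x).continuousAt),
    covDerivAlong_eq hφ.continuous.continuousAt]
  have h1 : (fun y => triv I (φ (f x)) (φ (f y)) (mfderiv I'' I (fun y => φ (f y)) y
      (extend E'' v y))) =ᶠ[𝓝 x] fun y => triv I (φ (f x)) (φ (f y))
        (mfderiv I' I φ (f y) (extend E' w (f y))) := by
    filter_upwards [hv] with y hy
    rw [(hd y).mfderiv, ← hy]
    rfl
  have h2 := mvfderiv_comp_of_mdifferentiableAt (f := f) rfl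
    (hasMFDerivAt_triv_mfderiv hφ w).mdifferentiableAt (hf x) u
  have h3 : mfderiv I'' I (fun y => φ (f y)) x (extend E'' v x)
      = mfderiv I' I φ (f x) (extend E' w (f x)) := by
    rw [(hd x).mfderiv, ← hv.self_of_nhds]
    rfl
  have h4 : mfderiv I'' I (fun y => φ (f y)) x u
      = mfderiv I' I φ (f x) (mfderiv I'' I' f x u) := by
    rw [(hd x).mfderiv]
    rfl
  rw [mvfderiv_congr h1, h2, h3, h4]

end Hessian

/-- In a chart the function has zero derivative on a ball, so it is locally constant. -/
theorem eq_of_mvfderiv_eq_zero {E : Type*} [NormedAddCommGroup E] [NormedSpace ℝ E]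
    {M : Type*} [TopologicalSpace M] [ChartedSpace E M] [IsManifold 𝓘(ℝ, E) ∞ M]
    [PreconnectedSpace M] {f : M → ℝ} (hf : MDifferentiable 𝓘(ℝ, E) 𝓘(ℝ, ℝ) f)
    (hf' : ∀ x, mvfderiv 𝓘(ℝ, E) f x = 0) (x y : M) : f x = f y := by
  refine IsLocallyConstant.apply_eq_of_preconnectedSpace
    ((IsLocallyConstant.iff_eventually_eq f).2 fun a => ?_) x y
  set e := chartAt E a
  obtain ⟨r, hr, hball⟩ := Metric.isOpen_iff.1 e.open_target (e a) (e.map_source (by simp [e]))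
  have hsymm : ∀ z ∈ e.target, MDifferentiableAt 𝓘(ℝ, E) 𝓘(ℝ, E) e.symm z := fun z hz =>
    ((contMDiffOn_chart_symm (n := ∞) (I := 𝓘(ℝ, E)) (x := a)).contMDiffAt
      (e.open_target.mem_nhds hz)).mdifferentiableAt (by simp)
  have hg : ∀ z ∈ e.target, HasFDerivAt (fun z => f (e.symm z)) (0 : E →L[ℝ] ℝ) z := by
    intro z hz
    have h1 := (hf (e.symm z)).hasMFDerivAt.comp z (hsymm z hz).hasMFDerivAt
    refine (h1.congr_mfderiv ?_).hasFDerivAt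
    ext v
    exact congrArg (fun L : E →L[ℝ] ℝ => L (mfderiv 𝓘(ℝ, E) 𝓘(ℝ, E) e.symm z v)) (hf' (e.symm z))
  have hconst : ∀ z ∈ Metric.ball (e a) r, f (e.symm z) = f (e.symm (e a)) := fun z hz =>
    Metric.isOpen_ball.is_const_of_fderiv_eq_zero (convex_ball _ _).isPreconnected
      (fun z hz => (hg z (hball hz)).differentiableAt.differentiableWithinAt)
      (fun z hz => (hg z (hball hz)).fderiv) hz (Metric.mem_ball_self hr)
  have ha : a ∈ e.source := by simp [e]
  filter_upwards [e.open_source.mem_nhds ha,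
    (e.continuousAt ha).preimage_mem_nhds (Metric.ball_mem_nhds _ hr)] with b hb hb'
  have := hconst (e b) hb'
  rwa [e.left_inv hb, e.left_inv ha] at this

theorem exists_mvfderiv_log_ne_zero {E : Type*} [NormedAddCommGroup E] [NormedSpace ℝ E]
    {M : Type*} [TopologicalSpace M] [ChartedSpace E M] [IsManifold 𝓘(ℝ, E) ∞ M]
    [ConnectedSpace M] {f : M → ℝ} (hf : ContMDiff 𝓘(ℝ, E) 𝓘(ℝ, ℝ) ∞ f) (hpos : ∀ x, 0 < f x)
    (hc : ¬ ∃ c, ∀ x, f x = c) : ∃ x v, mvfderiv 𝓘(ℝ, E) (fun y => Real.log (f y)) x v ≠ 0 := by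
  by_contra! h0
  have hd : MDifferentiable 𝓘(ℝ, E) 𝓘(ℝ, ℝ) (fun y => Real.log (f y)) := fun x =>
    ((Real.hasDerivAt_log (hpos x).ne').hasFDerivAt.hasMFDerivAt.comp x
      ((hf x).mdifferentiableAt (by simp)).hasMFDerivAt).mdifferentiableAt
  obtain ⟨a⟩ : Nonempty M := inferInstance
  refine hc ⟨f a, fun x => ?_⟩
  have h1 := eq_of_mvfderiv_eq_zero hd (fun x => by ext v; exact h0 x v) x a
  rw [← Real.exp_log (hpos x), h1, Real.exp_log (hpos a)]

/-! ### Pointwise geometry of the three distributions under the immersion. -/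

section BiWarpedImmersion

variable {E : Type*} [NormedAddCommGroup E] [NormedSpace ℝ E] [FiniteDimensional ℝ E]
  {H : Type*} [TopologicalSpace H] {I : ModelWithCorners ℝ E H}
  {M : Type*} [TopologicalSpace M] [ChartedSpace H M] [IsManifold I ∞ M]
  [RiemannianBundle (fun x : M => TangentSpace I x)]
  {E₀ : Type*} [NormedAddCommGroup E₀] [NormedSpace ℝ E₀] [FiniteDimensional ℝ E₀]
  {E₁ : Type*} [NormedAddCommGroup E₁] [NormedSpace ℝ E₁] [FiniteDimensional ℝ E₁]
  {E₂ : Type*} [NormedAddCommGroup E₂] [NormedSpace ℝ E₂] [FiniteDimensional ℝ E₂]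
  {M₀ : Type*} [TopologicalSpace M₀] [ChartedSpace E₀ M₀] [IsManifold 𝓘(ℝ, E₀) ∞ M₀]
  {M₁ : Type*} [TopologicalSpace M₁] [ChartedSpace E₁ M₁] [IsManifold 𝓘(ℝ, E₁) ∞ M₁]
  {M₂ : Type*} [TopologicalSpace M₂] [ChartedSpace E₂ M₂] [IsManifold 𝓘(ℝ, E₂) ∞ M₂]
  [RiemannianBundle (fun x : M₀ => TangentSpace 𝓘(ℝ, E₀) x)]
  [RiemannianBundle (fun x : M₁ => TangentSpace 𝓘(ℝ, E₁) x)]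
  [RiemannianBundle (fun x : M₂ => TangentSpace 𝓘(ℝ, E₂) x)]
  [RiemannianBundle (fun p : M₀ × M₁ × M₂ => TangentSpace (prodModel E₀ E₁ E₂) p)]
  {f₁ f₂ : M₀ → ℝ} {θ : ℝ} {K : NearlyKaehlerStructure I M} {φ : M₀ × M₁ × M₂ → M}

theorem starProjection_congr {V : Type*} [NormedAddCommGroup V] [InnerProductSpace ℝ V]
    {S T : Submodule ℝ V} [S.HasOrthogonalProjection] [T.HasOrthogonalProjection] (h : S = T)
    (v : V) : S.starProjection v = T.starProjection v := by
  subst h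
  rfl

section Leaves

theorem hasMFDerivAt_comp_leaf₀ (hφ : ContMDiff (prodModel E₀ E₁ E₂) I ∞ φ) (p : M₀ × M₁ × M₂) :
    HasMFDerivAt 𝓘(ℝ, E₀) I (fun x => φ (x, p.2.1, p.2.2)) p.1
      (mfderiv (prodModel E₀ E₁ E₂) I φ p ∘L inc₀ E₀ E₁ E₂ p) :=
  HasMFDerivAt.comp p.1 (f := fun x : M₀ => (x, p.2.1, p.2.2))
    ((hφ p).mdifferentiableAt (by simp)).hasMFDerivAt (hasMFDerivAt_leaf₀ p)

theorem hasMFDerivAt_comp_leaf₁ (hφ : ContMDiff (prodModel E₀ E₁ E₂) I ∞ φ) (p : M₀ × M₁ × M₂) :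
    HasMFDerivAt 𝓘(ℝ, E₁) I (fun y => φ (p.1, y, p.2.2)) p.2.1
      (mfderiv (prodModel E₀ E₁ E₂) I φ p ∘L inc₁ E₀ E₁ E₂ p) :=
  HasMFDerivAt.comp p.2.1 (f := fun y : M₁ => (p.1, y, p.2.2))
    ((hφ p).mdifferentiableAt (by simp)).hasMFDerivAt (hasMFDerivAt_leaf₁ p)

theorem hasMFDerivAt_comp_leaf₂ (hφ : ContMDiff (prodModel E₀ E₁ E₂) I ∞ φ) (p : M₀ × M₁ × M₂) :
    HasMFDerivAt 𝓘(ℝ, E₂) I (fun z => φ (p.1, p.2.1, z)) p.2.2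
      (mfderiv (prodModel E₀ E₁ E₂) I φ p ∘L inc₂ E₀ E₁ E₂ p) :=
  HasMFDerivAt.comp p.2.2 (f := fun z : M₂ => (p.1, p.2.1, z))
    ((hφ p).mdifferentiableAt (by simp)).hasMFDerivAt (hasMFDerivAt_leaf₂ p)

end Leaves

/-- An isometric immersion of a bi-warped product, with holomorphic, totally real and proper slant
leaves. -/
structure IsBiWarpedImmersion (K : NearlyKaehlerStructure I M) (φ : M₀ × M₁ × M₂ → M)
    (f₁ f₂ : M₀ → ℝ) (θ : ℝ) : Prop where
  smooth₁ : ContMDiff 𝓘(ℝ, E₀) 𝓘(ℝ, ℝ) ∞ f₁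
  smooth₂ : ContMDiff 𝓘(ℝ, E₀) 𝓘(ℝ, ℝ) ∞ f₂
  pos₁ : ∀ x, 0 < f₁ x
  pos₂ : ∀ x, 0 < f₂ x
  warped : IsBiWarpedProductMetric E₀ E₁ E₂ M₁ M₂ f₁ f₂
  isometric : IsIsometricImmersion I (prodModel E₀ E₁ E₂) φ
  holomorphic : ∀ y z, IsHolomorphic I 𝓘(ℝ, E₀) K.J (fun x => φ (x, y, z))
  totallyReal : ∀ x z, IsTotallyReal I 𝓘(ℝ, E₁) K.J (fun y => φ (x, y, z))
  slant : ∀ x y, IsProperSlant I 𝓘(ℝ, E₂) K.J (fun z => φ (x, y, z)) θ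

namespace IsBiWarpedImmersion

variable (h : IsBiWarpedImmersion (E₀ := E₀) (E₁ := E₁) (E₂ := E₂) K φ f₁ f₂ θ)
  (p : M₀ × M₁ × M₂)
include h

theorem exists_J_inc₀ (X : TangentSpace 𝓘(ℝ, E₀) p.1) :
    ∃ Y : TangentSpace 𝓘(ℝ, E₀) p.1,
      K.J (φ p) (mfderiv (prodModel E₀ E₁ E₂) I φ p (inc₀ E₀ E₁ E₂ p X))
        = mfderiv (prodModel E₀ E₁ E₂) I φ p (inc₀ E₀ E₁ E₂ p Y) := by
  have h1 := h.holomorphic p.2.1 p.2.2 p.1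
  rw [tangentImage, (hasMFDerivAt_comp_leaf₀ h.isometric.1 p).mfderiv] at h1
  have h2 : K.J (φ p) (mfderiv (prodModel E₀ E₁ E₂) I φ p (inc₀ E₀ E₁ E₂ p X)) ∈
      (LinearMap.range (mfderiv (prodModel E₀ E₁ E₂) I φ p ∘L inc₀ E₀ E₁ E₂ p).toLinearMap).map
        (K.J (φ p)).toLinearMap := ⟨_, ⟨X, rfl⟩, rfl⟩
  obtain ⟨Y, hY⟩ := h1.le h2
  exact ⟨Y, hY.symm⟩

theorem inner_J_inc₁ (Z W : TangentSpace 𝓘(ℝ, E₁) p.2.1) :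
    inner ℝ (K.J (φ p) (mfderiv (prodModel E₀ E₁ E₂) I φ p (inc₁ E₀ E₁ E₂ p Z)))
      (mfderiv (prodModel E₀ E₁ E₂) I φ p (inc₁ E₀ E₁ E₂ p W)) = 0 := by
  have h1 := h.totallyReal p.1 p.2.2 p.2.1
  rw [tangentImage, (hasMFDerivAt_comp_leaf₁ h.isometric.1 p).mfderiv] at h1
  have h2 : K.J (φ p) (mfderiv (prodModel E₀ E₁ E₂) I φ p (inc₁ E₀ E₁ E₂ p Z)) ∈
      (LinearMap.range (mfderiv (prodModel E₀ E₁ E₂) I φ p ∘L inc₁ E₀ E₁ E₂ p).toLinearMap).map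
        (K.J (φ p)).toLinearMap := ⟨_, ⟨Z, rfl⟩, rfl⟩
  have h3 := h1 h2
  rw [Submodule.mem_orthogonal'] at h3
  exact h3 _ ⟨W, rfl⟩

/-- The tangent space of the slant leaf through `p`. -/
def slantSpace (_ : IsBiWarpedImmersion (E₀ := E₀) (E₁ := E₁) (E₂ := E₂) K φ f₁ f₂ θ)
    (p : M₀ × M₁ × M₂) : Submodule ℝ (TangentSpace I (φ p)) :=
  LinearMap.range (mfderiv (prodModel E₀ E₁ E₂) I φ p ∘L inc₂ E₀ E₁ E₂ p).toLinearMap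

/-- For the projection w of Jv one has ⟨Jv, w⟩ = ‖w‖², so the cosine of the angle between them is
‖w‖/‖Jv‖ = ‖w‖/‖v‖. -/
theorem norm_starProjection_J (v : TangentSpace I (φ p)) (hv : v ∈ h.slantSpace p) :
    ‖(h.slantSpace p).starProjection (K.J (φ p) v)‖ = Real.cos θ * ‖v‖ := by
  obtain ⟨h0, h1, h2⟩ := h.slant p.1 p.2.1
  have h3 := h2 p.2.2
  have hT : tangentImage I 𝓘(ℝ, E₂) (fun z => φ (p.1, p.2.1, z)) p.2.2 = h.slantSpace p := by
    rw [tangentImage, (hasMFDerivAt_comp_leaf₂ h.isometric.1 p).mfderiv]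
    rfl
  by_cases hv0 : v = 0
  · simp [hv0]
  have h4 : InnerProductGeometry.angle (K.J (φ p) v)
      ((h.slantSpace p).starProjection (K.J (φ p) v)) = θ := by
    rw [← starProjection_congr hT]
    exact h3 v (hT.ge hv) hv0
  set w := (h.slantSpace p).starProjection (K.J (φ p) v) with hw
  have hJ : ‖K.J (φ p) v‖ = ‖v‖ := K.norm_J _ v
  have hvn : 0 < ‖v‖ := norm_pos_iff.2 hv0
  have hinner : inner ℝ (K.J (φ p) v) w = ‖w‖ ^ 2 := by
    have := Submodule.starProjection_inner_eq_zero (K := h.slantSpace p) (K.J (φ p) v) w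
      (Submodule.starProjection_apply_mem _ _)
    rw [inner_sub_left, ← hw, real_inner_self_eq_norm_sq] at this
    linarith
  -- The angle with the zero vector is π/2 by convention, which θ < π/2 excludes.
  have hw0 : w ≠ 0 := by
    intro h0
    rw [h0, InnerProductGeometry.angle_zero_right] at h4
    linarith
  have hwn : 0 < ‖w‖ := norm_pos_iff.2 hw0
  have h5 := InnerProductGeometry.cos_angle (K.J (φ p) v) w
  rw [h4, hinner, hJ] at h5
  rw [h5]
  field_simp

theorem norm_sub_starProjection_J_sq (v : TangentSpace I (φ p)) (hv : v ∈ h.slantSpace p) :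
    ‖K.J (φ p) v - (h.slantSpace p).starProjection (K.J (φ p) v)‖ ^ 2
      = Real.sin θ ^ 2 * ‖v‖ ^ 2 := by
  have h1 := h.norm_starProjection_J p v hv
  set w := (h.slantSpace p).starProjection (K.J (φ p) v) with hw
  have hinner : inner ℝ (K.J (φ p) v) w = ‖w‖ ^ 2 := by
    have := Submodule.starProjection_inner_eq_zero (K := h.slantSpace p) (K.J (φ p) v) w
      (Submodule.starProjection_apply_mem _ _)
    rw [inner_sub_left, ← hw, real_inner_self_eq_norm_sq] at this
    linarith
  rw [norm_sub_sq_real, hinner, K.norm_J, h1, Real.sin_sq]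
  ring

theorem inner_mfderiv (u v : TangentSpace (prodModel E₀ E₁ E₂) p) :
    inner ℝ (mfderiv (prodModel E₀ E₁ E₂) I φ p u) (mfderiv (prodModel E₀ E₁ E₂) I φ p v)
      = inner ℝ u v := h.isometric.2 p u v

theorem inner_inc₀_inc₁ (X : TangentSpace 𝓘(ℝ, E₀) p.1) (Z : TangentSpace 𝓘(ℝ, E₁) p.2.1) :
    inner ℝ (inc₀ E₀ E₁ E₂ p X) (inc₁ E₀ E₁ E₂ p Z) = 0 := by
  rw [h.warped.inner_eq]; simp

theorem inner_inc₀_inc₂ (X : TangentSpace 𝓘(ℝ, E₀) p.1) (U : TangentSpace 𝓘(ℝ, E₂) p.2.2) :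
    inner ℝ (inc₀ E₀ E₁ E₂ p X) (inc₂ E₀ E₁ E₂ p U) = 0 := by
  rw [h.warped.inner_eq]; simp

theorem inner_inc₁_inc₂ (Z : TangentSpace 𝓘(ℝ, E₁) p.2.1) (U : TangentSpace 𝓘(ℝ, E₂) p.2.2) :
    inner ℝ (inc₁ E₀ E₁ E₂ p Z) (inc₂ E₀ E₁ E₂ p U) = 0 := by
  rw [h.warped.inner_eq]; simp

theorem inner_inc₀_inc₀ (X Y : TangentSpace 𝓘(ℝ, E₀) p.1) :
    inner ℝ (inc₀ E₀ E₁ E₂ p X) (inc₀ E₀ E₁ E₂ p Y) = inner ℝ X Y := by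
  rw [h.warped.inner_eq]; simp

theorem inner_inc₁_inc₁ (Z W : TangentSpace 𝓘(ℝ, E₁) p.2.1) :
    inner ℝ (inc₁ E₀ E₁ E₂ p Z) (inc₁ E₀ E₁ E₂ p W) = f₁ p.1 ^ 2 * inner ℝ Z W := by
  rw [h.warped.inner_eq]; simp

theorem inner_inc₂_inc₂ (U V : TangentSpace 𝓘(ℝ, E₂) p.2.2) :
    inner ℝ (inc₂ E₀ E₁ E₂ p U) (inc₂ E₀ E₁ E₂ p V) = f₂ p.1 ^ 2 * inner ℝ U V := by
  rw [h.warped.inner_eq]; simp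

theorem inner_J_inc₀_inc₁ (X : TangentSpace 𝓘(ℝ, E₀) p.1) (Z : TangentSpace 𝓘(ℝ, E₁) p.2.1) :
    inner ℝ (K.J (φ p) (mfderiv (prodModel E₀ E₁ E₂) I φ p (inc₀ E₀ E₁ E₂ p X)))
      (mfderiv (prodModel E₀ E₁ E₂) I φ p (inc₁ E₀ E₁ E₂ p Z)) = 0 := by
  obtain ⟨Y, hY⟩ := h.exists_J_inc₀ p X
  rw [hY, h.inner_mfderiv, h.inner_inc₀_inc₁]

theorem inner_J_inc₀_inc₂ (X : TangentSpace 𝓘(ℝ, E₀) p.1) (U : TangentSpace 𝓘(ℝ, E₂) p.2.2) :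
    inner ℝ (K.J (φ p) (mfderiv (prodModel E₀ E₁ E₂) I φ p (inc₀ E₀ E₁ E₂ p X)))
      (mfderiv (prodModel E₀ E₁ E₂) I φ p (inc₂ E₀ E₁ E₂ p U)) = 0 := by
  obtain ⟨Y, hY⟩ := h.exists_J_inc₀ p X
  rw [hY, h.inner_mfderiv, h.inner_inc₀_inc₂]

end IsBiWarpedImmersion

/-! ### Mixed components of the second fundamental form and the inequality. -/

variable [IsContMDiffRiemannianBundle I ∞ E (fun x : M => TangentSpace I x)]
  [IsContMDiffRiemannianBundle 𝓘(ℝ, E₀) ∞ E₀ (fun x : M₀ => TangentSpace 𝓘(ℝ, E₀) x)]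
  [IsContMDiffRiemannianBundle 𝓘(ℝ, E₁) ∞ E₁ (fun x : M₁ => TangentSpace 𝓘(ℝ, E₁) x)]
  [IsContMDiffRiemannianBundle 𝓘(ℝ, E₂) ∞ E₂ (fun x : M₂ => TangentSpace 𝓘(ℝ, E₂) x)]

namespace IsBiWarpedImmersion

variable (h : IsBiWarpedImmersion (E₀ := E₀) (E₁ := E₁) (E₂ := E₂) K φ f₁ f₂ θ)
  (p : M₀ × M₁ × M₂)
include h

/-- The form vanishes on a whole neighbourhood, as `inner_hess_J` requires, because the extended
fields stay in their distributions. -/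
theorem pullbackForm_inc₀_inc₁ (X : TangentSpace 𝓘(ℝ, E₀) p.1) (Z : TangentSpace 𝓘(ℝ, E₁) p.2.1) :
    pullbackForm K φ p (inc₀ E₀ E₁ E₂ p X) (inc₁ E₀ E₁ E₂ p Z) =ᶠ[𝓝 p] fun _ => 0 := by
  filter_upwards [chart_source_mem_nhds_self (ModelProd E₀ (ModelProd E₁ E₂)) p] with q hq
  rw [pullbackForm, extend_inc₀ hq, extend_inc₁ hq]
  exact h.inner_J_inc₀_inc₁ q _ _

theorem pullbackForm_inc₀_inc₂ (X : TangentSpace 𝓘(ℝ, E₀) p.1) (U : TangentSpace 𝓘(ℝ, E₂) p.2.2) :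
    pullbackForm K φ p (inc₀ E₀ E₁ E₂ p X) (inc₂ E₀ E₁ E₂ p U) =ᶠ[𝓝 p] fun _ => 0 := by
  filter_upwards [chart_source_mem_nhds_self (ModelProd E₀ (ModelProd E₁ E₂)) p] with q hq
  rw [pullbackForm, extend_inc₀ hq, extend_inc₂ hq]
  exact h.inner_J_inc₀_inc₂ q _ _

theorem pullbackForm_inc₁_inc₁ (Z W : TangentSpace 𝓘(ℝ, E₁) p.2.1) :
    pullbackForm K φ p (inc₁ E₀ E₁ E₂ p Z) (inc₁ E₀ E₁ E₂ p W) =ᶠ[𝓝 p] fun _ => 0 := by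
  filter_upwards [chart_source_mem_nhds_self (ModelProd E₀ (ModelProd E₁ E₂)) p] with q hq
  rw [pullbackForm, extend_inc₁ hq, extend_inc₁ hq]
  exact h.inner_J_inc₁ q _ _

theorem secondFundamentalForm_inc₀_inc₁ (X : TangentSpace 𝓘(ℝ, E₀) p.1)
    (Z : TangentSpace 𝓘(ℝ, E₁) p.2.1) :
    secondFundamentalForm I (prodModel E₀ E₁ E₂) φ p (inc₀ E₀ E₁ E₂ p X) (inc₁ E₀ E₁ E₂ p Z)
      = hess I (prodModel E₀ E₁ E₂) φ p (inc₀ E₀ E₁ E₂ p X) (inc₁ E₀ E₁ E₂ p Z)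
        - mvfderiv 𝓘(ℝ, E₀) (fun x => Real.log (f₁ x)) p.1 X
          • mfderiv (prodModel E₀ E₁ E₂) I φ p (inc₁ E₀ E₁ E₂ p Z) := by
  rw [← map_smul]
  refine secondFundamentalForm_eq_sub fun w => ?_
  rw [inner_hess_zero_one h.isometric h.warped h.smooth₁ h.smooth₂ h.pos₁ h.pos₂, h.inner_mfderiv,
    real_inner_smul_left]

theorem secondFundamentalForm_inc₀_inc₂ (X : TangentSpace 𝓘(ℝ, E₀) p.1)
    (U : TangentSpace 𝓘(ℝ, E₂) p.2.2) :
    secondFundamentalForm I (prodModel E₀ E₁ E₂) φ p (inc₀ E₀ E₁ E₂ p X) (inc₂ E₀ E₁ E₂ p U)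
      = hess I (prodModel E₀ E₁ E₂) φ p (inc₀ E₀ E₁ E₂ p X) (inc₂ E₀ E₁ E₂ p U)
        - mvfderiv 𝓘(ℝ, E₀) (fun x => Real.log (f₂ x)) p.1 X
          • mfderiv (prodModel E₀ E₁ E₂) I φ p (inc₂ E₀ E₁ E₂ p U) := by
  rw [← map_smul]
  refine secondFundamentalForm_eq_sub fun w => ?_
  rw [inner_hess_zero_two h.isometric h.warped h.smooth₁ h.smooth₂ h.pos₁ h.pos₂, h.inner_mfderiv,
    real_inner_smul_left]

variable {p} in
-- On D^⊥ the form ω vanishes identically, so neither the derivative term of `inner_hess_J` nor the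
-- tangential part (X ln f₁)Z of `hess` contributes; only the Koszul term in the direction JX
-- remains.
theorem inner_secondFundamentalForm_inc₀_inc₁_J {X Y : TangentSpace 𝓘(ℝ, E₀) p.1}
    (hY : K.J (φ p) (mfderiv (prodModel E₀ E₁ E₂) I φ p (inc₀ E₀ E₁ E₂ p X))
      = mfderiv (prodModel E₀ E₁ E₂) I φ p (inc₀ E₀ E₁ E₂ p Y))
    (Z W : TangentSpace 𝓘(ℝ, E₁) p.2.1) :
    inner ℝ (secondFundamentalForm I (prodModel E₀ E₁ E₂) φ p (inc₀ E₀ E₁ E₂ p X)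
        (inc₁ E₀ E₁ E₂ p Z))
      (K.J (φ p) (mfderiv (prodModel E₀ E₁ E₂) I φ p (inc₁ E₀ E₁ E₂ p W)))
      = -mvfderiv 𝓘(ℝ, E₀) (fun x => Real.log (f₁ x)) p.1 Y
        * inner ℝ (inc₁ E₀ E₁ E₂ p Z) (inc₁ E₀ E₁ E₂ p W) := by
  rw [h.secondFundamentalForm_inc₀_inc₁, inner_sub_left, real_inner_smul_left,
    inner_hess_J K h.isometric.1 hY (h.pullbackForm_inc₀_inc₁ p X Z)
      (h.pullbackForm_inc₀_inc₁ p X W), mvfderiv_congr (h.pullbackForm_inc₁_inc₁ p Z W),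
    mvfderiv_const, inner_hess_one_one_zero h.isometric h.warped h.smooth₁ h.smooth₂ h.pos₁ h.pos₂]
  have := K.inner_J_left (φ p) (mfderiv (prodModel E₀ E₁ E₂) I φ p (inc₁ E₀ E₁ E₂ p Z))
    (mfderiv (prodModel E₀ E₁ E₂) I φ p (inc₁ E₀ E₁ E₂ p W))
  rw [h.inner_J_inc₁] at this
  rw [zero_apply]
  linear_combination -(mvfderiv 𝓘(ℝ, E₀) (fun x => Real.log (f₁ x)) p.1 X) * this

variable {p} in
-- Unlike on D^⊥, ω and its derivative along X survive. That derivative is left as it is; only its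
-- sum against ω is computed, in `sum_mul_mvfderiv_pullbackForm`.
theorem inner_secondFundamentalForm_inc₀_inc₂_J {X Y : TangentSpace 𝓘(ℝ, E₀) p.1}
    (hY : K.J (φ p) (mfderiv (prodModel E₀ E₁ E₂) I φ p (inc₀ E₀ E₁ E₂ p X))
      = mfderiv (prodModel E₀ E₁ E₂) I φ p (inc₀ E₀ E₁ E₂ p Y))
    (U V : TangentSpace 𝓘(ℝ, E₂) p.2.2) :
    inner ℝ (secondFundamentalForm I (prodModel E₀ E₁ E₂) φ p (inc₀ E₀ E₁ E₂ p X)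
        (inc₂ E₀ E₁ E₂ p U))
      (K.J (φ p) (mfderiv (prodModel E₀ E₁ E₂) I φ p (inc₂ E₀ E₁ E₂ p V)))
      = -(1 / 3) * mvfderiv (prodModel E₀ E₁ E₂)
          (pullbackForm K φ p (inc₂ E₀ E₁ E₂ p U) (inc₂ E₀ E₁ E₂ p V)) p (inc₀ E₀ E₁ E₂ p X)
        + mvfderiv 𝓘(ℝ, E₀) (fun x => Real.log (f₂ x)) p.1 X
          * inner ℝ (K.J (φ p) (mfderiv (prodModel E₀ E₁ E₂) I φ p (inc₂ E₀ E₁ E₂ p U)))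
            (mfderiv (prodModel E₀ E₁ E₂) I φ p (inc₂ E₀ E₁ E₂ p V))
        - mvfderiv 𝓘(ℝ, E₀) (fun x => Real.log (f₂ x)) p.1 Y
          * inner ℝ (inc₂ E₀ E₁ E₂ p U) (inc₂ E₀ E₁ E₂ p V) := by
  rw [h.secondFundamentalForm_inc₀_inc₂, inner_sub_left, real_inner_smul_left,
    inner_hess_J K h.isometric.1 hY (h.pullbackForm_inc₀_inc₂ p X U)
      (h.pullbackForm_inc₀_inc₂ p X V),
    inner_hess_two_two_zero h.isometric h.warped h.smooth₁ h.smooth₂ h.pos₁ h.pos₂, K.inner_J_left]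
  ring

variable {p} in
-- Cauchy–Schwarz against the single vector JZ.
theorem sq_mul_norm_sq_le_secondFundamentalForm {X Y : TangentSpace 𝓘(ℝ, E₀) p.1}
    (hY : K.J (φ p) (mfderiv (prodModel E₀ E₁ E₂) I φ p (inc₀ E₀ E₁ E₂ p X))
      = mfderiv (prodModel E₀ E₁ E₂) I φ p (inc₀ E₀ E₁ E₂ p Y))
    (Z : TangentSpace 𝓘(ℝ, E₁) p.2.1) :
    mvfderiv 𝓘(ℝ, E₀) (fun x => Real.log (f₁ x)) p.1 Y ^ 2 * ‖inc₁ E₀ E₁ E₂ p Z‖ ^ 2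
      ≤ ‖secondFundamentalForm I (prodModel E₀ E₁ E₂) φ p (inc₀ E₀ E₁ E₂ p X)
        (inc₁ E₀ E₁ E₂ p Z)‖ ^ 2 := by
  have h1 := h.inner_secondFundamentalForm_inc₀_inc₁_J hY Z Z
  have h2 := abs_real_inner_le_norm (secondFundamentalForm I (prodModel E₀ E₁ E₂) φ p
    (inc₀ E₀ E₁ E₂ p X) (inc₁ E₀ E₁ E₂ p Z))
    (K.J (φ p) (mfderiv (prodModel E₀ E₁ E₂) I φ p (inc₁ E₀ E₁ E₂ p Z)))
  have h3 : ‖mfderiv (prodModel E₀ E₁ E₂) I φ p (inc₁ E₀ E₁ E₂ p Z)‖ = ‖inc₁ E₀ E₁ E₂ p Z‖ := by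
    rw [norm_eq_sqrt_real_inner, h.inner_mfderiv, ← norm_eq_sqrt_real_inner]
  rw [h1, K.norm_J, h3, real_inner_self_eq_norm_sq, abs_mul, abs_neg, abs_pow, abs_norm] at h2
  rcases (norm_nonneg (inc₁ E₀ E₁ E₂ p Z)).eq_or_lt with h0 | h0
  · rw [← h0]; simp
  · have h4 : |mvfderiv 𝓘(ℝ, E₀) (fun x => Real.log (f₁ x)) p.1 Y| * ‖inc₁ E₀ E₁ E₂ p Z‖
      ≤ ‖secondFundamentalForm I (prodModel E₀ E₁ E₂) φ p (inc₀ E₀ E₁ E₂ p X)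
        (inc₁ E₀ E₁ E₂ p Z)‖ := le_of_mul_le_mul_right (by linarith [sq ‖inc₁ E₀ E₁ E₂ p Z‖]) h0
    rw [← sq_abs, ← mul_pow]
    exact pow_le_pow_left₀ (by positivity) h4 2

/-- Each row sum is f₂² times the squared length of the projection of J b_k to the slant leaf, that
is f₂² · cos²θ · f₂². -/
theorem sum_inner_J_inc₂_sq {ι : Type*} [Fintype ι]
    (b : OrthonormalBasis ι ℝ (TangentSpace 𝓘(ℝ, E₂) p.2.2)) :
    ∑ k, ∑ l, inner ℝ (K.J (φ p) (mfderiv (prodModel E₀ E₁ E₂) I φ p (inc₂ E₀ E₁ E₂ p (b k))))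
        (mfderiv (prodModel E₀ E₁ E₂) I φ p (inc₂ E₀ E₁ E₂ p (b l))) ^ 2
      = Fintype.card ι * Real.cos θ ^ 2 * (f₂ p.1 ^ 2) ^ 2 := by
  have h1 : ∀ k, ∑ l, inner ℝ
        (K.J (φ p) (mfderiv (prodModel E₀ E₁ E₂) I φ p (inc₂ E₀ E₁ E₂ p (b k))))
        (mfderiv (prodModel E₀ E₁ E₂) I φ p (inc₂ E₀ E₁ E₂ p (b l))) ^ 2
      = Real.cos θ ^ 2 * (f₂ p.1 ^ 2) ^ 2 := by
    intro k
    refine (sum_inner_sq_eq_norm_starProjection_sq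
      (mfderiv (prodModel E₀ E₁ E₂) I φ p ∘L inc₂ E₀ E₁ E₂ p).toLinearMap (c := f₂ p.1 ^ 2)
      (fun u v => (h.inner_mfderiv p _ _).trans (h.inner_inc₂_inc₂ p u v)) b _).trans ?_
    have h2 := h.norm_starProjection_J p
      (mfderiv (prodModel E₀ E₁ E₂) I φ p (inc₂ E₀ E₁ E₂ p (b k))) ⟨b k, rfl⟩
    have h3 : ‖mfderiv (prodModel E₀ E₁ E₂) I φ p (inc₂ E₀ E₁ E₂ p (b k))‖ ^ 2 = f₂ p.1 ^ 2 := by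
      rw [← real_inner_self_eq_norm_sq, h.inner_mfderiv, h.inner_inc₂_inc₂,
        real_inner_self_eq_norm_sq, b.norm_eq_one]
      ring
    refine (congrArg (fun r : ℝ => f₂ p.1 ^ 2 * r ^ 2) h2).trans ?_
    rw [mul_pow, h3]
    ring
  rw [Finset.sum_congr rfl fun k _ => h1 k, Finset.sum_const, Finset.card_univ, nsmul_eq_mul,
    mul_assoc]

/-- `sum_inner_J_inc₂_sq` is differentiated along the holomorphic leaf: θ is the same on all slant
leaves and f₂⁴ has logarithmic derivative 4 X(ln f₂), of which the square ω² takes a factor 2. -/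
theorem sum_mul_mvfderiv_pullbackForm {ι : Type} [Fintype ι]
    (b : OrthonormalBasis ι ℝ (TangentSpace 𝓘(ℝ, E₂) p.2.2)) (X : TangentSpace 𝓘(ℝ, E₀) p.1) :
    ∑ k, ∑ l, inner ℝ (K.J (φ p) (mfderiv (prodModel E₀ E₁ E₂) I φ p (inc₂ E₀ E₁ E₂ p (b k))))
        (mfderiv (prodModel E₀ E₁ E₂) I φ p (inc₂ E₀ E₁ E₂ p (b l)))
        * mvfderiv (prodModel E₀ E₁ E₂)
          (pullbackForm K φ p (inc₂ E₀ E₁ E₂ p (b k)) (inc₂ E₀ E₁ E₂ p (b l))) p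
          (inc₀ E₀ E₁ E₂ p X)
      = 2 * mvfderiv 𝓘(ℝ, E₀) (fun x => Real.log (f₂ x)) p.1 X
        * (Fintype.card ι * Real.cos θ ^ 2 * (f₂ p.1 ^ 2) ^ 2) := by
  -- Only the first coordinate moves, so the extended fields keep the components b_k in the fixed
  -- tangent space of the third factor. The same basis, orthonormal for the unwarped metric, serves
  -- at every x.
  set G : ι → ι → M₀ → ℝ := fun k l x =>
    pullbackForm K φ p (inc₂ E₀ E₁ E₂ p (b k)) (inc₂ E₀ E₁ E₂ p (b l)) (x, p.2.1, p.2.2) with hG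
  have hleaf := hasMFDerivAt_leaf₀ (E₀ := E₀) (E₁ := E₁) (E₂ := E₂) p
  have hd k l := K.mdifferentiableAt_inner_J_mfderiv h.isometric.1 p (inc₂ E₀ E₁ E₂ p (b k))
    (inc₂ E₀ E₁ E₂ p (b l))
  have hGd k l : MDifferentiableAt 𝓘(ℝ, E₀) 𝓘(ℝ, ℝ) (G k l) p.1 :=
    MDifferentiableAt.comp p.1 (f := fun x : M₀ => (x, p.2.1, p.2.2)) (hd k l)
      hleaf.mdifferentiableAt
  have hG' k l : mvfderiv 𝓘(ℝ, E₀) (G k l) p.1 X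
      = mvfderiv (prodModel E₀ E₁ E₂)
          (pullbackForm K φ p (inc₂ E₀ E₁ E₂ p (b k)) (inc₂ E₀ E₁ E₂ p (b l))) p
          (inc₀ E₀ E₁ E₂ p X) := by
    refine (mvfderiv_comp_of_mdifferentiableAt (f := fun x : M₀ => (x, p.2.1, p.2.2)) (y := p) rfl
      (hd k l) hleaf.mdifferentiableAt X).trans ?_
    rw [hleaf.mfderiv]
    rfl
  have hGp k l : G k l p.1
      = inner ℝ (K.J (φ p) (mfderiv (prodModel E₀ E₁ E₂) I φ p (inc₂ E₀ E₁ E₂ p (b k))))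
        (mfderiv (prodModel E₀ E₁ E₂) I φ p (inc₂ E₀ E₁ E₂ p (b l))) := by
    change pullbackForm K φ p _ _ p = _
    rw [pullbackForm, extend_apply_self, extend_apply_self]
  have hsum : (fun x => ∑ k, ∑ l, G k l x * G k l x) =ᶠ[𝓝 p.1]
      fun x => Fintype.card ι * Real.cos θ ^ 2 * (f₂ x ^ 2 * f₂ x ^ 2) := by
    have hc : ContinuousAt (fun x : M₀ => (x, p.2.1, p.2.2)) p.1 := by fun_prop
    filter_upwards [hc.eventually
      (chart_source_mem_nhds_self (ModelProd E₀ (ModelProd E₁ E₂)) p)] with x hx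
    have h1 k l : G k l x * G k l x = inner ℝ (K.J (φ (x, p.2.1, p.2.2))
        (mfderiv (prodModel E₀ E₁ E₂) I φ (x, p.2.1, p.2.2)
          (inc₂ E₀ E₁ E₂ (x, p.2.1, p.2.2) (b k))))
        (mfderiv (prodModel E₀ E₁ E₂) I φ (x, p.2.1, p.2.2)
          (inc₂ E₀ E₁ E₂ (x, p.2.1, p.2.2) (b l))) ^ 2 := by
      rw [← sq]
      simp only [hG]
      rw [pullbackForm, extend_inc₂ hx, extend_inc₂ hx]
      simp only [extend_apply_self]
    simp_rw [h1]
    refine (h.sum_inner_J_inc₂_sq (x, p.2.1, p.2.2) b).trans ?_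
    ring
  have hf : MDifferentiableAt 𝓘(ℝ, E₀) 𝓘(ℝ, ℝ) f₂ p.1 :=
    (h.smooth₂ p.1).mdifferentiableAt (by simp)
  have hf2 : MDifferentiableAt 𝓘(ℝ, E₀) 𝓘(ℝ, ℝ) (fun x => f₂ x ^ 2) p.1 :=
    ((h.smooth₂ p.1).pow 2).mdifferentiableAt (by simp)
  have hf4 : MDifferentiableAt 𝓘(ℝ, E₀) 𝓘(ℝ, ℝ) (fun x => f₂ x ^ 2 * f₂ x ^ 2) p.1 := hf2.mul hf2
  have hGG k l : MDifferentiableAt 𝓘(ℝ, E₀) 𝓘(ℝ, ℝ) (fun x => G k l x * G k l x) p.1 :=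
    (hGd k l).mul (hGd k l)
  have key := congrArg (fun L => L X) (mvfderiv_congr (I := 𝓘(ℝ, E₀)) hsum)
  beta_reduce at key
  rw [mvfderiv_fun_sum _ fun k _ => MDifferentiableAt.fun_sum _ fun l _ => hGG k l] at key
  simp_rw [mvfderiv_fun_sum _ fun l _ => hGG _ l] at key
  rw [mvfderiv_fun_mul mdifferentiableAt_const hf4, mvfderiv_const,
    mvfderiv_fun_mul hf2 hf2] at key
  simp only [sum_apply, add_apply, smul_apply, smul_eq_mul, mvfderiv_sq_eq hf (h.pos₂ _),
    mvfderiv_fun_mul (hGd _ _) (hGd _ _), hG', hGp, ← two_mul, ← Finset.mul_sum, zero_apply] at key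
  linear_combination key / 2

/-- `le_sum_sq` bounds the sum of ⟨h(X, b_k), J b_l⟩² from below, `sum_inner_sq_le` applied to ξ =
h(X, b_k) bounds it from above; a common factor f₂² is cancelled. -/
theorem card_mul_le_secondFundamentalForm {ι : Type} [Fintype ι]
    (b : OrthonormalBasis ι ℝ (TangentSpace 𝓘(ℝ, E₂) p.2.2)) {X Y : TangentSpace 𝓘(ℝ, E₀) p.1}
    (hY : K.J (φ p) (mfderiv (prodModel E₀ E₁ E₂) I φ p (inc₀ E₀ E₁ E₂ p X))
      = mfderiv (prodModel E₀ E₁ E₂) I φ p (inc₀ E₀ E₁ E₂ p Y)) :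
    Fintype.card ι * f₂ p.1 ^ 2 *
        (Real.cos θ ^ 2 / 9 * mvfderiv 𝓘(ℝ, E₀) (fun x => Real.log (f₂ x)) p.1 X ^ 2
          + mvfderiv 𝓘(ℝ, E₀) (fun x => Real.log (f₂ x)) p.1 Y ^ 2)
      ≤ Real.sin θ ^ 2 * ∑ k, ‖secondFundamentalForm I (prodModel E₀ E₁ E₂) φ p
        (inc₀ E₀ E₁ E₂ p X) (inc₂ E₀ E₁ E₂ p (b k))‖ ^ 2 := by
  classical
  have hdiag (k : ι) : inner ℝ
      (K.J (φ p) (mfderiv (prodModel E₀ E₁ E₂) I φ p (inc₂ E₀ E₁ E₂ p (b k))))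
      (mfderiv (prodModel E₀ E₁ E₂) I φ p (inc₂ E₀ E₁ E₂ p (b k))) = 0 := K.inner_J_self _ _
  have hdiag' (k : ι) : mvfderiv (prodModel E₀ E₁ E₂)
      (pullbackForm K φ p (inc₂ E₀ E₁ E₂ p (b k)) (inc₂ E₀ E₁ E₂ p (b k))) p
      (inc₀ E₀ E₁ E₂ p X) = 0 := mvfderiv_pullbackForm_self K _ _
  have h1 := le_sum_sq _ _ (b := mvfderiv 𝓘(ℝ, E₀) (fun x => Real.log (f₂ x)) p.1 Y)
    (κ := f₂ p.1 ^ 2) hdiag hdiag' (h.sum_inner_J_inc₂_sq p b)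
    (h.sum_mul_mvfderiv_pullbackForm p b X)
  have h2 (k : ι) := sum_inner_sq_le
      (mfderiv (prodModel E₀ E₁ E₂) I φ p ∘L inc₂ E₀ E₁ E₂ p).toLinearMap
      (K.J (φ p) ∘L mfderiv (prodModel E₀ E₁ E₂) I φ p ∘L inc₂ E₀ E₁ E₂ p).toLinearMap
      (c := f₂ p.1 ^ 2) (s := Real.sin θ) (sq_nonneg _)
      (fun u v => (h.inner_mfderiv p _ _).trans (h.inner_inc₂_inc₂ p u v)) b
      (fun a => h.norm_sub_starProjection_J_sq p _ ⟨a, rfl⟩)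
      (secondFundamentalForm I (prodModel E₀ E₁ E₂) φ p (inc₀ E₀ E₁ E₂ p X)
        (inc₂ E₀ E₁ E₂ p (b k)))
      (fun a => inner_secondFundamentalForm_mfderiv _ _ _)
  have h3 : mvfderiv 𝓘(ℝ, E₀) (fun x => Real.log (f₂ x)) p.1 X ^ 2
        * (Fintype.card ι * Real.cos θ ^ 2 * (f₂ p.1 ^ 2) ^ 2) / 9
      + Fintype.card ι * (mvfderiv 𝓘(ℝ, E₀) (fun x => Real.log (f₂ x)) p.1 Y * f₂ p.1 ^ 2) ^ 2
      ≤ ∑ k, f₂ p.1 ^ 2 * Real.sin θ ^ 2 * ‖secondFundamentalForm I (prodModel E₀ E₁ E₂) φ p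
      (inc₀ E₀ E₁ E₂ p X) (inc₂ E₀ E₁ E₂ p (b k))‖ ^ 2 := by
    refine h1.trans (le_trans (le_of_eq ?_) (Finset.sum_le_sum fun k _ => h2 k))
    refine Finset.sum_congr rfl fun k _ => Finset.sum_congr rfl fun l _ => congrArg (· ^ 2) ?_
    refine Eq.trans ?_ (h.inner_secondFundamentalForm_inc₀_inc₂_J hY (b k) (b l)).symm
    rw [h.inner_inc₂_inc₂, orthonormal_iff_ite.1 b.orthonormal k l]
    simp
  rw [← Finset.mul_sum] at h3
  refine le_of_mul_le_mul_left ?_ (pow_pos (h.pos₂ p.1) 2)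
  linarith

/-- J acts isometrically on D at p. Consequently the squares of JX ln f, summed over an orthonormal
basis, again give ‖∇ ln f‖². -/
theorem exists_orthonormalBasis_J {ι : Type*} [Fintype ι]
    (b : OrthonormalBasis ι ℝ (TangentSpace 𝓘(ℝ, E₀) p.1)) :
    ∃ b' : OrthonormalBasis ι ℝ (TangentSpace 𝓘(ℝ, E₀) p.1), ∀ i,
      K.J (φ p) (mfderiv (prodModel E₀ E₁ E₂) I φ p (inc₀ E₀ E₁ E₂ p (b i)))
        = mfderiv (prodModel E₀ E₁ E₂) I φ p (inc₀ E₀ E₁ E₂ p (b' i)) := by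
  classical
  choose Y hY using fun i => h.exists_J_inc₀ p (b i)
  have ho : Orthonormal ℝ Y := by
    rw [orthonormal_iff_ite]
    intro i j
    rw [← orthonormal_iff_ite.1 b.orthonormal i j, ← h.inner_inc₀_inc₀, ← h.inner_mfderiv, ← hY,
      ← hY, K.inner_J, h.inner_mfderiv, h.inner_inc₀_inc₀]
  obtain ⟨b', hb'⟩ := exists_orthonormalBasis_coe_eq ho (finrank_eq_card_basis b.toBasis).symm
  exact ⟨b', fun i => by rw [hb', hY]⟩

theorem exists_adapted_orthonormalBasis {ι₀ ι₁ ι₂ : Type*} [Fintype ι₀] [Fintype ι₁] [Fintype ι₂]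
    (b₀ : OrthonormalBasis ι₀ ℝ (TangentSpace 𝓘(ℝ, E₀) p.1))
    (b₁ : OrthonormalBasis ι₁ ℝ (TangentSpace 𝓘(ℝ, E₁) p.2.1))
    (b₂ : OrthonormalBasis ι₂ ℝ (TangentSpace 𝓘(ℝ, E₂) p.2.2)) :
    ∃ b : OrthonormalBasis (ι₀ ⊕ ι₁ ⊕ ι₂) ℝ (TangentSpace (prodModel E₀ E₁ E₂) p),
      (∀ i, b (.inl i) = inc₀ E₀ E₁ E₂ p (b₀ i))
        ∧ (∀ j, b (.inr (.inl j)) = (f₁ p.1)⁻¹ • inc₁ E₀ E₁ E₂ p (b₁ j))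
        ∧ ∀ k, b (.inr (.inr k)) = (f₂ p.1)⁻¹ • inc₂ E₀ E₁ E₂ p (b₂ k) := by
  classical
  let v : ι₀ ⊕ ι₁ ⊕ ι₂ → TangentSpace (prodModel E₀ E₁ E₂) p :=
    Sum.elim (fun i => inc₀ E₀ E₁ E₂ p (b₀ i))
      (Sum.elim (fun j => (f₁ p.1)⁻¹ • inc₁ E₀ E₁ E₂ p (b₁ j))
        (fun k => (f₂ p.1)⁻¹ • inc₂ E₀ E₁ E₂ p (b₂ k)))
  have hf₁ := (h.pos₁ p.1).ne'
  have hf₂ := (h.pos₂ p.1).ne'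
  have ho : Orthonormal ℝ v := by
    rw [orthonormal_iff_ite]
    rintro (i | i | i) (j | j | j) <;>
      simp only [v, Sum.elim_inl, Sum.elim_inr, real_inner_smul_left, real_inner_smul_right,
        h.inner_inc₀_inc₁, h.inner_inc₀_inc₂, h.inner_inc₁_inc₂, h.inner_inc₀_inc₀,
        h.inner_inc₁_inc₁, h.inner_inc₂_inc₂, real_inner_comm (inc₀ E₀ E₁ E₂ p _) (inc₁ E₀ E₁ E₂ p _),
        real_inner_comm (inc₀ E₀ E₁ E₂ p _) (inc₂ E₀ E₁ E₂ p _),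
        real_inner_comm (inc₁ E₀ E₁ E₂ p _) (inc₂ E₀ E₁ E₂ p _),
        orthonormal_iff_ite.1 b₀.orthonormal, orthonormal_iff_ite.1 b₁.orthonormal,
        orthonormal_iff_ite.1 b₂.orthonormal, Sum.inl.injEq, Sum.inr.injEq, reduceCtorEq,
        if_false, mul_zero] <;>
      split_ifs <;> field_simp
  have hcard : Fintype.card (ι₀ ⊕ ι₁ ⊕ ι₂)
      = finrank ℝ (TangentSpace (prodModel E₀ E₁ E₂) p) := by
    rw [Fintype.card_sum, Fintype.card_sum, ← finrank_eq_card_basis b₀.toBasis,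
      ← finrank_eq_card_basis b₁.toBasis, ← finrank_eq_card_basis b₂.toBasis]
    have h1 : finrank ℝ (E₀ × E₁ × E₂) = finrank ℝ E₀ + (finrank ℝ E₁ + finrank ℝ E₂) := by
      rw [finrank_prod, finrank_prod]
    exact h1.symm
  obtain ⟨b, hb⟩ := exists_orthonormalBasis_coe_eq ho hcard
  exact ⟨b, fun i => by rw [hb]; rfl, fun i => by rw [hb]; rfl, fun i => by rw [hb]; rfl⟩

/-- Evaluation in an orthonormal frame adapted to the splitting. Unit vectors of the warped factors
carry the inverse warping functions, and symmetry of h doubles the mixed blocks. -/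
theorem normSqSecondFundamentalForm_eq {ι₀ ι₁ ι₂ : Type*} [Fintype ι₀] [Fintype ι₁] [Fintype ι₂]
    (b₀ : OrthonormalBasis ι₀ ℝ (TangentSpace 𝓘(ℝ, E₀) p.1))
    (b₁ : OrthonormalBasis ι₁ ℝ (TangentSpace 𝓘(ℝ, E₁) p.2.1))
    (b₂ : OrthonormalBasis ι₂ ℝ (TangentSpace 𝓘(ℝ, E₂) p.2.2)) :
    normSqSecondFundamentalForm I (prodModel E₀ E₁ E₂) φ p
      = (∑ i, ∑ j, ‖secondFundamentalForm I (prodModel E₀ E₁ E₂) φ p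
          (inc₀ E₀ E₁ E₂ p (b₀ i)) (inc₀ E₀ E₁ E₂ p (b₀ j))‖ ^ 2)
        + (f₁ p.1)⁻¹ ^ 4 * (∑ i, ∑ j, ‖secondFundamentalForm I (prodModel E₀ E₁ E₂) φ p
          (inc₁ E₀ E₁ E₂ p (b₁ i)) (inc₁ E₀ E₁ E₂ p (b₁ j))‖ ^ 2)
        + (f₂ p.1)⁻¹ ^ 4 * (∑ i, ∑ j, ‖secondFundamentalForm I (prodModel E₀ E₁ E₂) φ p
          (inc₂ E₀ E₁ E₂ p (b₂ i)) (inc₂ E₀ E₁ E₂ p (b₂ j))‖ ^ 2)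
        + 2 * ((f₁ p.1)⁻¹ ^ 2 * ∑ i, ∑ j, ‖secondFundamentalForm I (prodModel E₀ E₁ E₂) φ p
          (inc₀ E₀ E₁ E₂ p (b₀ i)) (inc₁ E₀ E₁ E₂ p (b₁ j))‖ ^ 2)
        + 2 * ((f₂ p.1)⁻¹ ^ 2 * ∑ i, ∑ j, ‖secondFundamentalForm I (prodModel E₀ E₁ E₂) φ p
          (inc₀ E₀ E₁ E₂ p (b₀ i)) (inc₂ E₀ E₁ E₂ p (b₂ j))‖ ^ 2)
        + 2 * ((f₁ p.1)⁻¹ ^ 2 * (f₂ p.1)⁻¹ ^ 2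
          * ∑ i, ∑ j, ‖secondFundamentalForm I (prodModel E₀ E₁ E₂) φ p
            (inc₁ E₀ E₁ E₂ p (b₁ i)) (inc₂ E₀ E₁ E₂ p (b₂ j))‖ ^ 2) := by
  obtain ⟨b, hb₀, hb₁, hb₂⟩ := h.exists_adapted_orthonormalBasis p b₀ b₁ b₂
  have h1 := sum_sum_norm_sq_apply_eq (secondFundamentalFormₗ h.isometric.1 p)
    (stdOrthonormalBasis ℝ (TangentSpace (prodModel E₀ E₁ E₂) p)) b
  refine h1.trans ?_
  simp only [Fintype.sum_sum_type, hb₀, hb₁, hb₂, map_smul, LinearMap.smul_apply, norm_smul]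
  simp only [mul_pow, ← Finset.mul_sum, Finset.sum_add_distrib, norm_inv, Real.norm_eq_abs,
    abs_of_pos (h.pos₁ p.1), abs_of_pos (h.pos₂ p.1), secondFundamentalFormₗ_apply]
  have h10 : ∑ i, ∑ j, ‖secondFundamentalForm I (prodModel E₀ E₁ E₂) φ p
      (inc₁ E₀ E₁ E₂ p (b₁ i)) (inc₀ E₀ E₁ E₂ p (b₀ j))‖ ^ 2
    = ∑ i, ∑ j, ‖secondFundamentalForm I (prodModel E₀ E₁ E₂) φ p
      (inc₀ E₀ E₁ E₂ p (b₀ i)) (inc₁ E₀ E₁ E₂ p (b₁ j))‖ ^ 2 := by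
    rw [Finset.sum_comm]
    simp_rw [secondFundamentalForm_comm h.isometric.1 (inc₁ E₀ E₁ E₂ p _) (inc₀ E₀ E₁ E₂ p _)]
  have h20 : ∑ i, ∑ j, ‖secondFundamentalForm I (prodModel E₀ E₁ E₂) φ p
      (inc₂ E₀ E₁ E₂ p (b₂ i)) (inc₀ E₀ E₁ E₂ p (b₀ j))‖ ^ 2
    = ∑ i, ∑ j, ‖secondFundamentalForm I (prodModel E₀ E₁ E₂) φ p
      (inc₀ E₀ E₁ E₂ p (b₀ i)) (inc₂ E₀ E₁ E₂ p (b₂ j))‖ ^ 2 := by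
    rw [Finset.sum_comm]
    simp_rw [secondFundamentalForm_comm h.isometric.1 (inc₂ E₀ E₁ E₂ p _) (inc₀ E₀ E₁ E₂ p _)]
  have h21 : ∑ i, ∑ j, ‖secondFundamentalForm I (prodModel E₀ E₁ E₂) φ p
      (inc₂ E₀ E₁ E₂ p (b₂ i)) (inc₁ E₀ E₁ E₂ p (b₁ j))‖ ^ 2
    = ∑ i, ∑ j, ‖secondFundamentalForm I (prodModel E₀ E₁ E₂) φ p
      (inc₁ E₀ E₁ E₂ p (b₁ i)) (inc₂ E₀ E₁ E₂ p (b₂ j))‖ ^ 2 := by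
    rw [Finset.sum_comm]
    simp_rw [secondFundamentalForm_comm h.isometric.1 (inc₂ E₀ E₁ E₂ p _) (inc₁ E₀ E₁ E₂ p _)]
  rw [h10, h20, h21]
  ring

theorem le_sum_norm_sq_inc₀_inc₁ {ι₀ ι₁ : Type*} [Fintype ι₀] [Fintype ι₁]
    (b₀ : OrthonormalBasis ι₀ ℝ (TangentSpace 𝓘(ℝ, E₀) p.1))
    (b₁ : OrthonormalBasis ι₁ ℝ (TangentSpace 𝓘(ℝ, E₁) p.2.1)) :
    finrank ℝ E₁ * ‖riemannianGradient 𝓘(ℝ, E₀) (fun x => Real.log (f₁ x)) p.1‖ ^ 2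
      ≤ (f₁ p.1)⁻¹ ^ 2 * ∑ i, ∑ j, ‖secondFundamentalForm I (prodModel E₀ E₁ E₂) φ p
          (inc₀ E₀ E₁ E₂ p (b₀ i)) (inc₁ E₀ E₁ E₂ p (b₁ j))‖ ^ 2 := by
  obtain ⟨b', hb'⟩ := h.exists_orthonormalBasis_J p b₀
  have hcard : finrank ℝ E₁ = Fintype.card ι₁ := finrank_eq_card_basis b₁.toBasis
  have h1 := Finset.sum_le_sum fun i (_ : i ∈ Finset.univ) =>
    Finset.sum_le_sum fun j (_ : j ∈ Finset.univ) => h.sq_mul_norm_sq_le_secondFundamentalForm (hb' i) (b₁ j)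
  have h2 : ∀ j, ‖inc₁ E₀ E₁ E₂ p (b₁ j)‖ ^ 2 = f₁ p.1 ^ 2 := fun j => by
    rw [← real_inner_self_eq_norm_sq, h.inner_inc₁_inc₁, real_inner_self_eq_norm_sq,
      b₁.norm_eq_one]
    ring
  simp_rw [h2, Finset.sum_const, Finset.card_univ, nsmul_eq_mul, ← hcard] at h1
  rw [← Finset.mul_sum, ← Finset.sum_mul, ← norm_riemannianGradient_sq] at h1
  have hf : f₁ p.1 ≠ 0 := (h.pos₁ p.1).ne'
  refine le_trans (le_of_eq ?_) (mul_le_mul_of_nonneg_left h1 (sq_nonneg (f₁ p.1)⁻¹))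
  field_simp

/-- Summation of `card_mul_le_secondFundamentalForm` over a basis of D; the terms in X and in JX
both become the squared gradient. -/
theorem le_sum_norm_sq_inc₀_inc₂ {ι₀ : Type*} {ι₂ : Type} [Fintype ι₀] [Fintype ι₂]
    (b₀ : OrthonormalBasis ι₀ ℝ (TangentSpace 𝓘(ℝ, E₀) p.1))
    (b₂ : OrthonormalBasis ι₂ ℝ (TangentSpace 𝓘(ℝ, E₂) p.2.2)) :
    finrank ℝ E₂ * (1 + 10 / 9 * Real.cot θ ^ 2)
        * ‖riemannianGradient 𝓘(ℝ, E₀) (fun x => Real.log (f₂ x)) p.1‖ ^ 2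
      ≤ (f₂ p.1)⁻¹ ^ 2 * ∑ i, ∑ j, ‖secondFundamentalForm I (prodModel E₀ E₁ E₂) φ p
          (inc₀ E₀ E₁ E₂ p (b₀ i)) (inc₂ E₀ E₁ E₂ p (b₂ j))‖ ^ 2 := by
  obtain ⟨b', hb'⟩ := h.exists_orthonormalBasis_J p b₀
  have hcard : finrank ℝ E₂ = Fintype.card ι₂ := finrank_eq_card_basis b₂.toBasis
  have h1 := Finset.sum_le_sum fun i (_ : i ∈ Finset.univ) => h.card_mul_le_secondFundamentalForm p b₂ (hb' i)
  simp_rw [← Finset.mul_sum, Finset.sum_add_distrib, ← Finset.mul_sum, ← hcard] at h1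
  rw [← norm_riemannianGradient_sq, ← norm_riemannianGradient_sq] at h1
  have hf : f₂ p.1 ≠ 0 := (h.pos₂ p.1).ne'
  obtain ⟨h0, hπ, -⟩ := h.slant p.1 p.2.1
  have hs : 0 < Real.sin θ := Real.sin_pos_of_pos_of_lt_pi h0 (by linarith [Real.pi_pos])
  have hs' : Real.sin θ ≠ 0 := hs.ne'
  have h2 : 0 ≤ (f₂ p.1)⁻¹ ^ 2 * (Real.sin θ)⁻¹ ^ 2 := by positivity
  refine le_trans (le_of_eq ?_) ((mul_le_mul_of_nonneg_left h1 h2).trans_eq ?_)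
  -- The identity sin²θ + (10/9)cos²θ = 1 + cos²θ/9 behind the constant 10/9.
  · rw [Real.cot_eq_cos_div_sin]
    field_simp
    linear_combination 9 * (finrank ℝ E₂ : ℝ)
      * ‖riemannianGradient 𝓘(ℝ, E₀) (fun x => Real.log (f₂ x)) p.1‖ ^ 2
      * Real.sin_sq_add_cos_sq θ
  · field_simp

/-- The three pure blocks are kept on the smaller side: dropping them gives the inequality, and
equality forces them to vanish. -/
theorem lower_add_le_normSqSecondFundamentalForm {ι₀ ι₁ : Type*} {ι₂ : Type} [Fintype ι₀]
    [Fintype ι₁] [Fintype ι₂] (b₀ : OrthonormalBasis ι₀ ℝ (TangentSpace 𝓘(ℝ, E₀) p.1))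
    (b₁ : OrthonormalBasis ι₁ ℝ (TangentSpace 𝓘(ℝ, E₁) p.2.1))
    (b₂ : OrthonormalBasis ι₂ ℝ (TangentSpace 𝓘(ℝ, E₂) p.2.2)) :
    2 * (finrank ℝ E₁ : ℝ) * ‖riemannianGradient 𝓘(ℝ, E₀) (fun x => Real.log (f₁ x)) p.1‖ ^ 2
        + 4 * ((1 / 2 : ℝ) * finrank ℝ E₂) * (1 + 10 / 9 * Real.cot θ ^ 2)
          * ‖riemannianGradient 𝓘(ℝ, E₀) (fun x => Real.log (f₂ x)) p.1‖ ^ 2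
        + ((∑ i, ∑ j, ‖secondFundamentalForm I (prodModel E₀ E₁ E₂) φ p
            (inc₀ E₀ E₁ E₂ p (b₀ i)) (inc₀ E₀ E₁ E₂ p (b₀ j))‖ ^ 2)
          + (f₁ p.1)⁻¹ ^ 4 * (∑ i, ∑ j, ‖secondFundamentalForm I (prodModel E₀ E₁ E₂) φ p
            (inc₁ E₀ E₁ E₂ p (b₁ i)) (inc₁ E₀ E₁ E₂ p (b₁ j))‖ ^ 2)
          + (f₂ p.1)⁻¹ ^ 4 * (∑ i, ∑ j, ‖secondFundamentalForm I (prodModel E₀ E₁ E₂) φ p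
            (inc₂ E₀ E₁ E₂ p (b₂ i)) (inc₂ E₀ E₁ E₂ p (b₂ j))‖ ^ 2))
      ≤ normSqSecondFundamentalForm I (prodModel E₀ E₁ E₂) φ p := by
  rw [h.normSqSecondFundamentalForm_eq p b₀ b₁ b₂]
  have h1 := h.le_sum_norm_sq_inc₀_inc₁ p b₀ b₁
  have h2 := h.le_sum_norm_sq_inc₀_inc₂ p b₀ b₂
  have h12 : 0 ≤ (f₁ p.1)⁻¹ ^ 2 * (f₂ p.1)⁻¹ ^ 2
    * ∑ i, ∑ j, ‖secondFundamentalForm I (prodModel E₀ E₁ E₂) φ p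
      (inc₁ E₀ E₁ E₂ p (b₁ i)) (inc₂ E₀ E₁ E₂ p (b₂ j))‖ ^ 2 := by positivity
  linarith

theorem lower_le_normSqSecondFundamentalForm :
    2 * (finrank ℝ E₁ : ℝ) * ‖riemannianGradient 𝓘(ℝ, E₀) (fun x => Real.log (f₁ x)) p.1‖ ^ 2
        + 4 * ((1 / 2 : ℝ) * finrank ℝ E₂) * (1 + 10 / 9 * Real.cot θ ^ 2)
          * ‖riemannianGradient 𝓘(ℝ, E₀) (fun x => Real.log (f₂ x)) p.1‖ ^ 2
      ≤ normSqSecondFundamentalForm I (prodModel E₀ E₁ E₂) φ p :=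
  (le_add_of_nonneg_right (by positivity)).trans
    (h.lower_add_le_normSqSecondFundamentalForm p (stdOrthonormalBasis ℝ _)
      (stdOrthonormalBasis ℝ _) (stdOrthonormalBasis ℝ _))

variable {p} in
theorem secondFundamentalForm_eq_zero
    (heq : normSqSecondFundamentalForm I (prodModel E₀ E₁ E₂) φ p
      = 2 * (finrank ℝ E₁ : ℝ) * ‖riemannianGradient 𝓘(ℝ, E₀) (fun x => Real.log (f₁ x)) p.1‖ ^ 2
        + 4 * ((1 / 2 : ℝ) * finrank ℝ E₂) * (1 + 10 / 9 * Real.cot θ ^ 2)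
          * ‖riemannianGradient 𝓘(ℝ, E₀) (fun x => Real.log (f₂ x)) p.1‖ ^ 2) :
    (∀ X Y, secondFundamentalForm I (prodModel E₀ E₁ E₂) φ p
        (inc₀ E₀ E₁ E₂ p X) (inc₀ E₀ E₁ E₂ p Y) = 0)
      ∧ (∀ Z W, secondFundamentalForm I (prodModel E₀ E₁ E₂) φ p
        (inc₁ E₀ E₁ E₂ p Z) (inc₁ E₀ E₁ E₂ p W) = 0)
      ∧ ∀ U V, secondFundamentalForm I (prodModel E₀ E₁ E₂) φ p
        (inc₂ E₀ E₁ E₂ p U) (inc₂ E₀ E₁ E₂ p V) = 0 := by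
  have b₀ := stdOrthonormalBasis ℝ (TangentSpace 𝓘(ℝ, E₀) p.1)
  have b₁ := stdOrthonormalBasis ℝ (TangentSpace 𝓘(ℝ, E₁) p.2.1)
  have b₂ := stdOrthonormalBasis ℝ (TangentSpace 𝓘(ℝ, E₂) p.2.2)
  have h0 := h.lower_add_le_normSqSecondFundamentalForm p b₀ b₁ b₂
  rw [heq, add_le_iff_nonpos_right] at h0
  have hc₁ : 0 < (f₁ p.1)⁻¹ ^ 4 := pow_pos (inv_pos.2 (h.pos₁ p.1)) 4
  have hc₂ : 0 < (f₂ p.1)⁻¹ ^ 4 := pow_pos (inv_pos.2 (h.pos₂ p.1)) 4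
  have h00 : 0 ≤ ∑ i, ∑ j, ‖secondFundamentalForm I (prodModel E₀ E₁ E₂) φ p
    (inc₀ E₀ E₁ E₂ p (b₀ i)) (inc₀ E₀ E₁ E₂ p (b₀ j))‖ ^ 2 := by positivity
  have h11 : 0 ≤ ∑ i, ∑ j, ‖secondFundamentalForm I (prodModel E₀ E₁ E₂) φ p
    (inc₁ E₀ E₁ E₂ p (b₁ i)) (inc₁ E₀ E₁ E₂ p (b₁ j))‖ ^ 2 := by positivity
  have h22 : 0 ≤ ∑ i, ∑ j, ‖secondFundamentalForm I (prodModel E₀ E₁ E₂) φ p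
    (inc₂ E₀ E₁ E₂ p (b₂ i)) (inc₂ E₀ E₁ E₂ p (b₂ j))‖ ^ 2 := by positivity
  have h11' := mul_nonneg hc₁.le h11
  have h22' := mul_nonneg hc₂.le h22
  refine ⟨?_, ?_, ?_⟩
  · refine eq_zero_of_sum_norm_sq_le_zero ((secondFundamentalFormₗ h.isometric.1 p).compl₁₂
      (inc₀ E₀ E₁ E₂ p).toLinearMap (inc₀ E₀ E₁ E₂ p).toLinearMap) b₀.toBasis ?_
    simp only [OrthonormalBasis.coe_toBasis]
    change ∑ i, ∑ j, ‖secondFundamentalForm I (prodModel E₀ E₁ E₂) φ p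
      (inc₀ E₀ E₁ E₂ p (b₀ i)) (inc₀ E₀ E₁ E₂ p (b₀ j))‖ ^ 2 ≤ 0
    linarith
  · refine eq_zero_of_sum_norm_sq_le_zero ((secondFundamentalFormₗ h.isometric.1 p).compl₁₂
      (inc₁ E₀ E₁ E₂ p).toLinearMap (inc₁ E₀ E₁ E₂ p).toLinearMap) b₁.toBasis ?_
    simp only [OrthonormalBasis.coe_toBasis]
    change ∑ i, ∑ j, ‖secondFundamentalForm I (prodModel E₀ E₁ E₂) φ p
      (inc₁ E₀ E₁ E₂ p (b₁ i)) (inc₁ E₀ E₁ E₂ p (b₁ j))‖ ^ 2 ≤ 0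
    refine le_of_mul_le_mul_left ?_ hc₁
    linarith
  · refine eq_zero_of_sum_norm_sq_le_zero ((secondFundamentalFormₗ h.isometric.1 p).compl₁₂
      (inc₂ E₀ E₁ E₂ p).toLinearMap (inc₂ E₀ E₁ E₂ p).toLinearMap) b₂.toBasis ?_
    simp only [OrthonormalBasis.coe_toBasis]
    change ∑ i, ∑ j, ‖secondFundamentalForm I (prodModel E₀ E₁ E₂) φ p
      (inc₂ E₀ E₁ E₂ p (b₂ i)) (inc₂ E₀ E₁ E₂ p (b₂ j))‖ ^ 2 ≤ 0
    refine le_of_mul_le_mul_left ?_ hc₂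
    linarith

end IsBiWarpedImmersion

/-! ### The leaves as submanifolds of the ambient manifold. -/

section Leaves

variable (hφ : ContMDiff (prodModel E₀ E₁ E₂) I ∞ φ) (p : M₀ × M₁ × M₂)
include hφ

theorem hess_leaf₀ (X Y : TangentSpace 𝓘(ℝ, E₀) p.1) :
    hess I 𝓘(ℝ, E₀) (fun x => φ (x, p.2.1, p.2.2)) p.1 X Y
      = hess I (prodModel E₀ E₁ E₂) φ p (inc₀ E₀ E₁ E₂ p X) (inc₀ E₀ E₁ E₂ p Y) := by
  have hc : ContinuousAt (fun x : M₀ => (x, p.2.1, p.2.2)) p.1 := by fun_prop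
  have hd (x : M₀) := hasMFDerivAt_leaf₀ (E₀ := E₀) (E₁ := E₁) (E₂ := E₂) (x, p.2.1, p.2.2)
  refine (hess_comp (f := fun x : M₀ => (x, p.2.1, p.2.2)) (w := inc₀ E₀ E₁ E₂ p Y) hφ
    (fun x => (hd x).mdifferentiableAt) ?_).trans ?_
  · filter_upwards [hc.eventually
      (chart_source_mem_nhds_self (ModelProd E₀ (ModelProd E₁ E₂)) p)] with x hx
    rw [(hd x).mfderiv]
    exact (extend_inc₀ hx Y).symm
  · rw [(hd p.1).mfderiv]

theorem hess_leaf₁ (Z W : TangentSpace 𝓘(ℝ, E₁) p.2.1) :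
    hess I 𝓘(ℝ, E₁) (fun y => φ (p.1, y, p.2.2)) p.2.1 Z W
      = hess I (prodModel E₀ E₁ E₂) φ p (inc₁ E₀ E₁ E₂ p Z) (inc₁ E₀ E₁ E₂ p W) := by
  have hc : ContinuousAt (fun y : M₁ => (p.1, y, p.2.2)) p.2.1 := by fun_prop
  have hd (y : M₁) := hasMFDerivAt_leaf₁ (E₀ := E₀) (E₁ := E₁) (E₂ := E₂) (p.1, y, p.2.2)
  refine (hess_comp (f := fun y : M₁ => (p.1, y, p.2.2)) (w := inc₁ E₀ E₁ E₂ p W) hφ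
    (fun y => (hd y).mdifferentiableAt) ?_).trans ?_
  · filter_upwards [hc.eventually
      (chart_source_mem_nhds_self (ModelProd E₀ (ModelProd E₁ E₂)) p)] with y hy
    rw [(hd y).mfderiv]
    exact (extend_inc₁ hy W).symm
  · rw [(hd p.2.1).mfderiv]

theorem hess_leaf₂ (U V : TangentSpace 𝓘(ℝ, E₂) p.2.2) :
    hess I 𝓘(ℝ, E₂) (fun z => φ (p.1, p.2.1, z)) p.2.2 U V
      = hess I (prodModel E₀ E₁ E₂) φ p (inc₂ E₀ E₁ E₂ p U) (inc₂ E₀ E₁ E₂ p V) := by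
  have hc : ContinuousAt (fun z : M₂ => (p.1, p.2.1, z)) p.2.2 := by fun_prop
  have hd (z : M₂) := hasMFDerivAt_leaf₂ (E₀ := E₀) (E₁ := E₁) (E₂ := E₂) (p.1, p.2.1, z)
  refine (hess_comp (f := fun z : M₂ => (p.1, p.2.1, z)) (w := inc₂ E₀ E₁ E₂ p V) hφ
    (fun z => (hd z).mdifferentiableAt) ?_).trans ?_
  · filter_upwards [hc.eventually
      (chart_source_mem_nhds_self (ModelProd E₀ (ModelProd E₁ E₂)) p)] with z hz
    rw [(hd z).mfderiv]
    exact (extend_inc₂ hz V).symm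
  · rw [(hd p.2.2).mfderiv]

end Leaves

section Distributions

variable {p : M₀ × M₁ × M₂}

theorem inc₀_mem_dist₀ (X : TangentSpace 𝓘(ℝ, E₀) p.1) :
    inc₀ E₀ E₁ E₂ p X ∈ dist₀ E₀ E₁ E₂ p :=
  ⟨X, congrArg (fun L : E₀ →L[ℝ] E₀ × E₁ × E₂ => L X) (hasMFDerivAt_leaf₀ p).mfderiv⟩

theorem inc₁_mem_dist₁ (Z : TangentSpace 𝓘(ℝ, E₁) p.2.1) :
    inc₁ E₀ E₁ E₂ p Z ∈ dist₁ E₀ E₁ E₂ p :=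
  ⟨Z, congrArg (fun L : E₁ →L[ℝ] E₀ × E₁ × E₂ => L Z) (hasMFDerivAt_leaf₁ p).mfderiv⟩

theorem inc₂_mem_dist₂ (U : TangentSpace 𝓘(ℝ, E₂) p.2.2) :
    inc₂ E₀ E₁ E₂ p U ∈ dist₂ E₀ E₁ E₂ p :=
  ⟨U, congrArg (fun L : E₂ →L[ℝ] E₀ × E₁ × E₂ => L U) (hasMFDerivAt_leaf₂ p).mfderiv⟩

end Distributions

/-! ### The equality case and the mixed blocks. -/

namespace IsBiWarpedImmersion

variable (h : IsBiWarpedImmersion (E₀ := E₀) (E₁ := E₁) (E₂ := E₂) K φ f₁ f₂ θ)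
include h

variable {p : M₀ × M₁ × M₂}

theorem inner_inc₀_right (t : TangentSpace (prodModel E₀ E₁ E₂) p)
    (X : TangentSpace 𝓘(ℝ, E₀) p.1) :
    inner ℝ t (inc₀ E₀ E₁ E₂ p X) = inner ℝ (pr₀ E₀ E₁ E₂ p t) X := by
  rw [h.warped.inner_eq]; simp

theorem inner_inc₁_right (t : TangentSpace (prodModel E₀ E₁ E₂) p)
    (Z : TangentSpace 𝓘(ℝ, E₁) p.2.1) :
    inner ℝ t (inc₁ E₀ E₁ E₂ p Z) = f₁ p.1 ^ 2 * inner ℝ (pr₁ E₀ E₁ E₂ p t) Z := by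
  rw [h.warped.inner_eq]; simp

theorem inner_inc₂_right (t : TangentSpace (prodModel E₀ E₁ E₂) p)
    (U : TangentSpace 𝓘(ℝ, E₂) p.2.2) :
    inner ℝ t (inc₂ E₀ E₁ E₂ p U) = f₂ p.1 ^ 2 * inner ℝ (pr₂ E₀ E₁ E₂ p t) U := by
  rw [h.warped.inner_eq]; simp

theorem pr₁_eq_zero {t : TangentSpace (prodModel E₀ E₁ E₂) p}
    (ht : ∀ Z, inner ℝ t (inc₁ E₀ E₁ E₂ p Z) = 0) : pr₁ E₀ E₁ E₂ p t = 0 := by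
  have h1 := ht (pr₁ E₀ E₁ E₂ p t)
  rw [h.inner_inc₁_right] at h1
  exact inner_self_eq_zero.1
    ((mul_eq_zero.1 h1).resolve_left (pow_ne_zero 2 (h.pos₁ p.1).ne'))

theorem pr₂_eq_zero {t : TangentSpace (prodModel E₀ E₁ E₂) p}
    (ht : ∀ U, inner ℝ t (inc₂ E₀ E₁ E₂ p U) = 0) : pr₂ E₀ E₁ E₂ p t = 0 := by
  have h1 := ht (pr₂ E₀ E₁ E₂ p t)
  rw [h.inner_inc₂_right] at h1
  exact inner_self_eq_zero.1
    ((mul_eq_zero.1 h1).resolve_left (pow_ne_zero 2 (h.pos₂ p.1).ne'))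

theorem pr₀_eq_smul {f : M₀ → ℝ} {c : ℝ} {t : TangentSpace (prodModel E₀ E₁ E₂) p}
    (ht : ∀ X, inner ℝ t (inc₀ E₀ E₁ E₂ p X) = -mvfderiv 𝓘(ℝ, E₀) f p.1 X * c) :
    pr₀ E₀ E₁ E₂ p t = c • -riemannianGradient 𝓘(ℝ, E₀) f p.1 := by
  refine ext_inner_right ℝ fun X => ?_
  rw [← h.inner_inc₀_right, ht, real_inner_smul_left, inner_neg_left, inner_riemannianGradient]
  ring

/-- When h vanishes on D, `hess` of the leaf is dφ of some tangent vector t of the product; Koszul's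
formula shows that t has no component along the other two factors, so `hess` is tangent to the leaf.
-/
theorem isTotallyGeodesic_leaf₀ (y : M₁) (z : M₂)
    (h0 : ∀ x X Y, secondFundamentalForm I (prodModel E₀ E₁ E₂) φ (x, y, z)
      (inc₀ E₀ E₁ E₂ (x, y, z) X) (inc₀ E₀ E₁ E₂ (x, y, z) Y) = 0) :
    IsTotallyGeodesic I 𝓘(ℝ, E₀) (fun x => φ (x, y, z)) := by
  intro x X Y
  have hd := hasMFDerivAt_comp_leaf₀ h.isometric.1 (x, y, z)
  obtain ⟨t, ht⟩ := exists_secondFundamentalForm_eq (I := I) (φ := φ) (p := (x, y, z))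
    (inc₀ E₀ E₁ E₂ (x, y, z) X) (inc₀ E₀ E₁ E₂ (x, y, z) Y)
  rw [h0, eq_comm, sub_eq_zero] at ht
  have h1 : pr₁ E₀ E₁ E₂ (x, y, z) t = 0 := h.pr₁_eq_zero fun Z => by
    rw [← h.inner_mfderiv, ← ht]
    exact inner_hess_zero_zero_one h.isometric h.warped h.smooth₁ h.smooth₂ h.pos₁ h.pos₂ _ X Y Z
  have h2 : pr₂ E₀ E₁ E₂ (x, y, z) t = 0 := h.pr₂_eq_zero fun U => by
    rw [← h.inner_mfderiv, ← ht]
    exact inner_hess_zero_zero_two h.isometric h.warped h.smooth₁ h.smooth₂ h.pos₁ h.pos₂ _ X Y U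
  refine secondFundamentalForm_eq_of_hess_eq (t := pr₀ E₀ E₁ E₂ (x, y, z) t) ?_
    fun w => inner_zero_left _
  refine (hess_leaf₀ h.isometric.1 (x, y, z) X Y).trans ?_
  rw [ht, hd.mfderiv, add_zero]
  conv_lhs => rw [← inc_pr (x, y, z) t]
  rw [h1, h2, map_zero, map_zero, add_zero, add_zero]
  rfl

/-- As for the holomorphic leaves, but the component of t along D is -g(Z,W)∇ ln f₁. The mean
curvature vector of the leaf is therefore the image of -∇ ln f₁. -/
theorem isTotallyUmbilical_leaf₁ (x : M₀) (z : M₂)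
    (h0 : ∀ y Z W, secondFundamentalForm I (prodModel E₀ E₁ E₂) φ (x, y, z)
      (inc₁ E₀ E₁ E₂ (x, y, z) Z) (inc₁ E₀ E₁ E₂ (x, y, z) W) = 0) :
    IsTotallyUmbilical I 𝓘(ℝ, E₁) (fun y => φ (x, y, z)) := by
  intro y
  have hd := hasMFDerivAt_comp_leaf₁ h.isometric.1 (x, y, z)
  set G : TangentSpace 𝓘(ℝ, E₀) x :=
    -riemannianGradient 𝓘(ℝ, E₀) (fun x => Real.log (f₁ x)) x with hG
  have hη (W : TangentSpace 𝓘(ℝ, E₁) y) :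
      inner ℝ (mfderiv (prodModel E₀ E₁ E₂) I φ (x, y, z) (inc₀ E₀ E₁ E₂ (x, y, z) G))
        (mfderiv 𝓘(ℝ, E₁) I (fun y => φ (x, y, z)) y W) = 0 := by
    rw [hd.mfderiv]
    exact (h.inner_mfderiv _ _ _).trans (h.inner_inc₀_inc₁ (x, y, z) G W)
  refine ⟨mfderiv (prodModel E₀ E₁ E₂) I φ (x, y, z) (inc₀ E₀ E₁ E₂ (x, y, z) G), ?_, ?_⟩
  · rw [Submodule.mem_orthogonal']
    rintro _ ⟨W, rfl⟩
    exact hη W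
  intro Z W
  obtain ⟨t, ht⟩ := exists_secondFundamentalForm_eq (I := I) (φ := φ) (p := (x, y, z))
    (inc₁ E₀ E₁ E₂ (x, y, z) Z) (inc₁ E₀ E₁ E₂ (x, y, z) W)
  rw [h0, eq_comm, sub_eq_zero] at ht
  set c : ℝ := inner ℝ (mfderiv 𝓘(ℝ, E₁) I (fun y => φ (x, y, z)) y Z)
    (mfderiv 𝓘(ℝ, E₁) I (fun y => φ (x, y, z)) y W) with hc
  have hcc : c = inner ℝ (inc₁ E₀ E₁ E₂ (x, y, z) Z) (inc₁ E₀ E₁ E₂ (x, y, z) W) := by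
    rw [hc, hd.mfderiv]
    exact h.inner_mfderiv _ _ _
  have h1 : pr₀ E₀ E₁ E₂ (x, y, z) t = c • G := h.pr₀_eq_smul fun X => by
    rw [← h.inner_mfderiv, ← ht, hcc]
    exact inner_hess_one_one_zero h.isometric h.warped h.smooth₁ h.smooth₂ h.pos₁ h.pos₂ _ X Z W
  have h2 : pr₂ E₀ E₁ E₂ (x, y, z) t = 0 := h.pr₂_eq_zero fun U => by
    rw [← h.inner_mfderiv, ← ht]
    exact inner_hess_one_one_two h.isometric h.warped h.smooth₁ h.smooth₂ h.pos₁ h.pos₂ _ U Z W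
  refine secondFundamentalForm_eq_of_hess_eq (t := pr₁ E₀ E₁ E₂ (x, y, z) t) ?_ fun w => ?_
  · refine (hess_leaf₁ h.isometric.1 (x, y, z) Z W).trans ?_
    rw [ht, hd.mfderiv]
    conv_lhs => rw [← inc_pr (x, y, z) t]
    rw [h1, h2, map_zero, add_zero, map_add, map_smul, map_smul, add_comm]
    rfl
  · rw [real_inner_smul_left, hη, mul_zero]

theorem isTotallyUmbilical_leaf₂ (x : M₀) (y : M₁)
    (h0 : ∀ z U V, secondFundamentalForm I (prodModel E₀ E₁ E₂) φ (x, y, z)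
      (inc₂ E₀ E₁ E₂ (x, y, z) U) (inc₂ E₀ E₁ E₂ (x, y, z) V) = 0) :
    IsTotallyUmbilical I 𝓘(ℝ, E₂) (fun z => φ (x, y, z)) := by
  intro z
  have hd := hasMFDerivAt_comp_leaf₂ h.isometric.1 (x, y, z)
  set G : TangentSpace 𝓘(ℝ, E₀) x :=
    -riemannianGradient 𝓘(ℝ, E₀) (fun x => Real.log (f₂ x)) x with hG
  have hη (V : TangentSpace 𝓘(ℝ, E₂) z) :
      inner ℝ (mfderiv (prodModel E₀ E₁ E₂) I φ (x, y, z) (inc₀ E₀ E₁ E₂ (x, y, z) G))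
        (mfderiv 𝓘(ℝ, E₂) I (fun z => φ (x, y, z)) z V) = 0 := by
    rw [hd.mfderiv]
    exact (h.inner_mfderiv _ _ _).trans (h.inner_inc₀_inc₂ (x, y, z) G V)
  refine ⟨mfderiv (prodModel E₀ E₁ E₂) I φ (x, y, z) (inc₀ E₀ E₁ E₂ (x, y, z) G), ?_, ?_⟩
  · rw [Submodule.mem_orthogonal']
    rintro _ ⟨V, rfl⟩
    exact hη V
  intro U V
  obtain ⟨t, ht⟩ := exists_secondFundamentalForm_eq (I := I) (φ := φ) (p := (x, y, z))
    (inc₂ E₀ E₁ E₂ (x, y, z) U) (inc₂ E₀ E₁ E₂ (x, y, z) V)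
  rw [h0, eq_comm, sub_eq_zero] at ht
  set c : ℝ := inner ℝ (mfderiv 𝓘(ℝ, E₂) I (fun z => φ (x, y, z)) z U)
    (mfderiv 𝓘(ℝ, E₂) I (fun z => φ (x, y, z)) z V) with hc
  have hcc : c = inner ℝ (inc₂ E₀ E₁ E₂ (x, y, z) U) (inc₂ E₀ E₁ E₂ (x, y, z) V) := by
    rw [hc, hd.mfderiv]
    exact h.inner_mfderiv _ _ _
  have h1 : pr₀ E₀ E₁ E₂ (x, y, z) t = c • G := h.pr₀_eq_smul fun X => by
    rw [← h.inner_mfderiv, ← ht, hcc]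
    exact inner_hess_two_two_zero h.isometric h.warped h.smooth₁ h.smooth₂ h.pos₁ h.pos₂ _ X U V
  have h2 : pr₁ E₀ E₁ E₂ (x, y, z) t = 0 := h.pr₁_eq_zero fun Z => by
    rw [← h.inner_mfderiv, ← ht]
    exact inner_hess_two_two_one h.isometric h.warped h.smooth₁ h.smooth₂ h.pos₁ h.pos₂ _ U V Z
  refine secondFundamentalForm_eq_of_hess_eq (t := pr₂ E₀ E₁ E₂ (x, y, z) t) ?_ fun w => ?_
  · refine (hess_leaf₂ h.isometric.1 (x, y, z) U V).trans ?_
    rw [ht, hd.mfderiv]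
    conv_lhs => rw [← inc_pr (x, y, z) t]
    rw [h1, h2, map_zero, add_zero, map_add, map_smul, map_smul, add_comm]
    rfl
  · rw [real_inner_smul_left, hη, mul_zero]

variable (p) in
-- The vector corresponding to JV is a witness, as J² = -1. It makes any prescribed direction V
-- available as -JX in the formulas for h.
theorem exists_J_inc₀_eq_neg (V : TangentSpace 𝓘(ℝ, E₀) p.1) :
    ∃ X : TangentSpace 𝓘(ℝ, E₀) p.1,
      K.J (φ p) (mfderiv (prodModel E₀ E₁ E₂) I φ p (inc₀ E₀ E₁ E₂ p X))
        = mfderiv (prodModel E₀ E₁ E₂) I φ p (inc₀ E₀ E₁ E₂ p (-V)) := by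
  obtain ⟨X, hX⟩ := h.exists_J_inc₀ p V
  exact ⟨X, by rw [← hX, K.J_sq, map_neg, map_neg]⟩

/-- For V with V ln f₁ ≠ 0 and JX = -V one gets ⟨h(X,Z), JZ⟩ = (V ln f₁)‖Z‖², which is nonzero for Z
≠ 0. -/
theorem not_isMixedTotallyGeodesic_dist₁ [ConnectedSpace M₀] [Nonempty M₁] [Nonempty M₂]
    (hdim : 0 < finrank ℝ E₁) (hc : ¬ ∃ c, ∀ x, f₁ x = c) :
    ¬ IsMixedTotallyGeodesic I (prodModel E₀ E₁ E₂) φ (dist₀ E₀ E₁ E₂) (dist₁ E₀ E₁ E₂) := by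
  intro hmix
  obtain ⟨x, V, hV⟩ := exists_mvfderiv_log_ne_zero h.smooth₁ h.pos₁ hc
  obtain ⟨y⟩ := ‹Nonempty M₁›
  obtain ⟨z⟩ := ‹Nonempty M₂›
  have : Nontrivial (TangentSpace 𝓘(ℝ, E₁) y) := (finrank_pos_iff (R := ℝ) (M := E₁)).1 hdim
  obtain ⟨Z, hZ⟩ := exists_ne (0 : TangentSpace 𝓘(ℝ, E₁) y)
  obtain ⟨X, hX⟩ := h.exists_J_inc₀_eq_neg (x, y, z) V
  have h1 := h.inner_secondFundamentalForm_inc₀_inc₁_J hX Z Z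
  rw [hmix _ _ (inc₀_mem_dist₀ X) _ (inc₁_mem_dist₁ Z), inner_zero_left, h.inner_inc₁_inc₁,
    map_neg, neg_neg] at h1
  exact mul_ne_zero hV (mul_ne_zero (pow_ne_zero 2 (h.pos₁ x).ne') (inner_self_ne_zero.2 hZ))
    h1.symm

/-- The same test on the diagonal, where ω(U,U) and its derivative vanish because ω is alternating.
-/
theorem not_isMixedTotallyGeodesic_dist₂ [ConnectedSpace M₀] [Nonempty M₁] [Nonempty M₂]
    (hdim : 0 < finrank ℝ E₂) (hc : ¬ ∃ c, ∀ x, f₂ x = c) :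
    ¬ IsMixedTotallyGeodesic I (prodModel E₀ E₁ E₂) φ (dist₀ E₀ E₁ E₂) (dist₂ E₀ E₁ E₂) := by
  intro hmix
  obtain ⟨x, V, hV⟩ := exists_mvfderiv_log_ne_zero h.smooth₂ h.pos₂ hc
  obtain ⟨y⟩ := ‹Nonempty M₁›
  obtain ⟨z⟩ := ‹Nonempty M₂›
  have : Nontrivial (TangentSpace 𝓘(ℝ, E₂) z) := (finrank_pos_iff (R := ℝ) (M := E₂)).1 hdim
  obtain ⟨U, hU⟩ := exists_ne (0 : TangentSpace 𝓘(ℝ, E₂) z)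
  obtain ⟨X, hX⟩ := h.exists_J_inc₀_eq_neg (x, y, z) V
  have h1 := h.inner_secondFundamentalForm_inc₀_inc₂_J hX U U
  rw [hmix _ _ (inc₀_mem_dist₀ X) _ (inc₂_mem_dist₂ U), inner_zero_left, h.inner_inc₂_inc₂,
    K.inner_J_self, mvfderiv_pullbackForm_self, map_neg] at h1
  refine mul_ne_zero hV (mul_ne_zero (pow_ne_zero 2 (h.pos₂ x).ne') (inner_self_ne_zero.2 hU)) ?_
  change (0 : ℝ) = _ + _ - -mvfderiv 𝓘(ℝ, E₀) (fun y => Real.log (f₂ y)) x V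
    * (f₂ x ^ 2 * inner ℝ U U) at h1
  linarith

end IsBiWarpedImmersion

end BiWarpedImmersion

end BiWarped

end

/-! ### The theorem. -/

open BiWarped in
theorem theorem4p1
    -- the nearly Kaehler manifold
    {E : Type*} [NormedAddCommGroup E] [NormedSpace ℝ E] [FiniteDimensional ℝ E]
    {M : Type*} [TopologicalSpace M] [ChartedSpace E M] [IsManifold 𝓘(ℝ, E) ∞ M]
    [RiemannianBundle (fun x : M => TangentSpace 𝓘(ℝ, E) x)]
    [IsContMDiffRiemannianBundle 𝓘(ℝ, E) ∞ E (fun x : M => TangentSpace 𝓘(ℝ, E) x)]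
    (K : NearlyKaehlerStructure 𝓘(ℝ, E) M)
    -- the Riemannian manifolds `M_T`, `M_⊥`, `M_θ`
    {E₀ : Type*} [NormedAddCommGroup E₀] [NormedSpace ℝ E₀] [FiniteDimensional ℝ E₀]
    {MT : Type*} [TopologicalSpace MT] [ChartedSpace E₀ MT] [IsManifold 𝓘(ℝ, E₀) ∞ MT]
    [RiemannianBundle (fun x : MT => TangentSpace 𝓘(ℝ, E₀) x)]
    [IsContMDiffRiemannianBundle 𝓘(ℝ, E₀) ∞ E₀ (fun x : MT => TangentSpace 𝓘(ℝ, E₀) x)]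
    [ConnectedSpace MT]
    {E₁ : Type*} [NormedAddCommGroup E₁] [NormedSpace ℝ E₁] [FiniteDimensional ℝ E₁]
    {Mperp : Type*} [TopologicalSpace Mperp] [ChartedSpace E₁ Mperp]
    [IsManifold 𝓘(ℝ, E₁) ∞ Mperp]
    [RiemannianBundle (fun x : Mperp => TangentSpace 𝓘(ℝ, E₁) x)]
    [IsContMDiffRiemannianBundle 𝓘(ℝ, E₁) ∞ E₁ (fun x : Mperp => TangentSpace 𝓘(ℝ, E₁) x)]
    [Nonempty Mperp]
    {E₂ : Type*} [NormedAddCommGroup E₂] [NormedSpace ℝ E₂] [FiniteDimensional ℝ E₂]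
    {Mθ : Type*} [TopologicalSpace Mθ] [ChartedSpace E₂ Mθ] [IsManifold 𝓘(ℝ, E₂) ∞ Mθ]
    [RiemannianBundle (fun x : Mθ => TangentSpace 𝓘(ℝ, E₂) x)]
    [IsContMDiffRiemannianBundle 𝓘(ℝ, E₂) ∞ E₂ (fun x : Mθ => TangentSpace 𝓘(ℝ, E₂) x)]
    [Nonempty Mθ]
    -- the bi-warped product
    [RiemannianBundle (fun p : MT × Mperp × Mθ => TangentSpace (prodModel E₀ E₁ E₂) p)]
    (f₁ f₂ : MT → ℝ)
    (hf₁ : ContMDiff 𝓘(ℝ, E₀) 𝓘(ℝ, ℝ) ∞ f₁) (hf₂ : ContMDiff 𝓘(ℝ, E₀) 𝓘(ℝ, ℝ) ∞ f₂)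
    (hf₁_pos : ∀ x, 0 < f₁ x) (hf₂_pos : ∀ x, 0 < f₂ x)
    (hwarped : IsBiWarpedProductMetric E₀ E₁ E₂ Mperp Mθ f₁ f₂)
    -- its isometric immersion, and the types of its factors as submanifolds
    (φ : MT × Mperp × Mθ → M)
    (hφ : IsIsometricImmersion 𝓘(ℝ, E) (prodModel E₀ E₁ E₂) φ)
    (θ : ℝ)
    (hT : ∀ y z, IsHolomorphic 𝓘(ℝ, E) 𝓘(ℝ, E₀) K.J (fun x => φ (x, y, z)))
    (hperp : ∀ x z, IsTotallyReal 𝓘(ℝ, E) 𝓘(ℝ, E₁) K.J (fun y => φ (x, y, z)))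
    (hθ : ∀ x y, IsProperSlant 𝓘(ℝ, E) 𝓘(ℝ, E₂) K.J (fun z => φ (x, y, z)) θ) :
    let p : ℝ := Module.finrank ℝ E₁
    let q : ℝ := (1 / 2 : ℝ) * Module.finrank ℝ E₂
    let lower : MT × Mperp × Mθ → ℝ := fun m =>
      2 * p * ‖riemannianGradient 𝓘(ℝ, E₀) (fun x => Real.log (f₁ x)) m.1‖ ^ 2
        + 4 * q * (1 + 10 / 9 * Real.cot θ ^ 2)
          * ‖riemannianGradient 𝓘(ℝ, E₀) (fun x => Real.log (f₂ x)) m.1‖ ^ 2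
    (∀ m, normSqSecondFundamentalForm 𝓘(ℝ, E) (prodModel E₀ E₁ E₂) φ m ≥ lower m)
    ∧ ((∀ m, normSqSecondFundamentalForm 𝓘(ℝ, E) (prodModel E₀ E₁ E₂) φ m = lower m) →
      (∀ y z, IsTotallyGeodesic 𝓘(ℝ, E) 𝓘(ℝ, E₀) (fun x => φ (x, y, z)))
      ∧ (∀ x z, IsTotallyUmbilical 𝓘(ℝ, E) 𝓘(ℝ, E₁) (fun y => φ (x, y, z)))
      ∧ (∀ x y, IsTotallyUmbilical 𝓘(ℝ, E) 𝓘(ℝ, E₂) (fun z => φ (x, y, z)))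
      ∧ (0 < Module.finrank ℝ E₁ → (¬ ∃ c, ∀ x, f₁ x = c) →
          ¬ IsMixedTotallyGeodesic 𝓘(ℝ, E) (prodModel E₀ E₁ E₂) φ
            (dist₀ E₀ E₁ E₂) (dist₁ E₀ E₁ E₂))
      ∧ (0 < Module.finrank ℝ E₂ → (¬ ∃ c, ∀ x, f₂ x = c) →
          ¬ IsMixedTotallyGeodesic 𝓘(ℝ, E) (prodModel E₀ E₁ E₂) φ
            (dist₀ E₀ E₁ E₂) (dist₂ E₀ E₁ E₂))) := by
  have h : IsBiWarpedImmersion (E₀ := E₀) (E₁ := E₁) (E₂ := E₂) K φ f₁ f₂ θ :=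
    ⟨hf₁, hf₂, hf₁_pos, hf₂_pos, hwarped, hφ, hT, hperp, hθ⟩
  intro p q lower
  refine ⟨fun m => h.lower_le_normSqSecondFundamentalForm m, fun heq => ?_⟩
  have h0 := fun m => h.secondFundamentalForm_eq_zero (heq m)
  exact ⟨fun y z => h.isTotallyGeodesic_leaf₀ y z fun x => (h0 (x, y, z)).1,
    fun x z => h.isTotallyUmbilical_leaf₁ x z fun y => (h0 (x, y, z)).2.1,
    fun x y => h.isTotallyUmbilical_leaf₂ x y fun z => (h0 (x, y, z)).2.2,
    h.not_isMixedTotallyGeodesic_dist₁, h.not_isMixedTotallyGeodesic_dist₂⟩
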